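/- **Graphs.** A *graph* is a compact Hausdorff space $G$ that is a union of finitely many homeomorphic copies of $[0,1]$, any two of which intersect at most at their endpoints. A *vertex* of $G$ is a point that has no open neighborhood homeomorphic to $]0,1[$. A *PMG map* is a continuous map $f:G\to G$ for which there is a finite set $C\subseteq G$ such that $f$ is injective on each connected component of $G\setminus C$. Let $\mathrm{Fix}^-(f)$ be the set of all fixed points $x$ of $f$ that are not vertices and such that $f$, read in a chart of $G$ at $x$ with values in $\mathbb R$, is strictly decreasing on a neighborhood of $x$. Let $f_{*i}$ be the endomorphism of the real singular homology $H_i(G;\mathbb R)$ induced by $f$, and define the formal power series $$\zeta^-(z)=\exp\sum_{n\ge1}\frac{2\,\#\mathrm{Fix}^-(f^n)}{n}z^n,\quad \zeta^L(z)=\exp\sum_{n\ge1}\frac{\mathrm{tr}\,(f_{*0})^n-\mathrm{tr}\,(f_{*1})^n}{n}z^n,\quad \zeta^{MT}(z)=\zeta^-(z)\,\zeta^L(z)^{-1}.$$ **PM maps.** Let $\Omega=[a_1,b_1]\cup\dots\cup[a_m,b_m]\subset\mathbb R$ with $a_1<b_1<a_2<\dots<a_m<b_m$, and $\partial\Omega=\{a_1,b_1,\dots,a_m,b_m\}$.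 A *PM map* is a map $F:\Omega\setminus C_F\to\Omega$, where $C_F\subset\Omega$ is finite with $\partial\Omega\subseteq C_F$, that is continuous and strictly monotone on each connected component of $\Omega\setminus C_F$. The PMG map $f$ is *induced* by $F$ if there is a continuous map $\pi:\Omega\to G$ such that every vertex of $G$ lies in $\pi(\partial\Omega)$, $\pi$ maps $\Omega\setminus\partial\Omega$ homeomorphically onto $G\setminus\pi(\partial\Omega)$, and $\pi(F(x))=f(\pi(x))$ for all $x\in\Omega\setminus C_F$. **Traces of pairs.** Let $V$ be a real vector space, $V_0,V_1\subseteq V$ subspaces of finite codimension, and $\varphi_j:V_j\to V_j$ linear for $j=0,1$. The pair $(\varphi_0,\varphi_1)$ has *finite rank* if for $j=0,1$ there are linear maps $\overline\varphi_j:V\to V$ that extend $\varphi_j$ and induce $\widetilde\varphi_j:V/V_j\to V/V_j$, such that $\overline\varphi_1-\overline\varphi_0$ has finite rank. Its *trace*, which does not depend on the choice of the extensions, is then $\mathrm{tr}(\varphi_0,\varphi_1)=\mathrm{tr}(\overline\varphi_1-\overline\varphi_0)-\mathrm{tr}\,\widetilde\varphi_1+\mathrm{tr}\,\widetilde\varphi_0$.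 **The kneading determinant.** Let $S_0(\Omega;\mathbb R)$ be the real vector space with basis the points of $\Omega$, and $S_1(\Omega;\mathbb R)$ its subspace spanned by the vectors $y-x$ with $x,y$ in the same connected component of $\Omega$. For $x\in\Omega\setminus C_F$ let $\epsilon(x)=\pm1$ according to whether $F$ is increasing or decreasing near $x$. Let $\epsilon F_{\#0}$ be the endomorphism of $S_0(\Omega;\mathbb R)$ that maps $x$ to $\epsilon(x)F(x)$ if $x\in\Omega\setminus C_F$, and to $0$ if $x\in C_F$. Let $\epsilon F_{\#1}$ be the unique endomorphism of $S_1(\Omega;\mathbb R)$ such that, for all $x<y$ with $]x,y[\,\subseteq\Omega\setminus C_F$, the vector $y-x$ is mapped to $\epsilon([x,y])\,(F(y-)-F(x+))$, where $F(y-)$ and $F(x+)$ are the one-sided limits and $\epsilon([x,y])=\pm1$ according to whether $F$ is increasing or decreasing on $]x,y[$. The pairs $((\epsilon F_{\#0})^n,(\epsilon F_{\#1})^n)$, $n\ge1$, on $S_0(\Omega;\mathbb R)$ have finite rank, and $$D(z)=\exp\Big(-\sum_{n\ge1}\mathrm{tr}\big((\epsilon F_{\#0})^n,(\epsilon F_{\#1})^n\big)\frac{z^n}{n}\Big).$$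 **Corollary.** Let $f:G\to G$ be a PMG map on a graph $G$, induced by a PM map $F$. Let $\rho\in[0,\infty]$ be the radius of convergence of $\zeta^{MT}(z)$, and let $z_0\in\mathbb C$ with $|z_0|<1$ be a zero of $D(z)$ (the series $D(z)$ converges at $z_0$, with sum $0$). Then $\rho\le|z_0|$. -/

import Mathlib

universe u

noncomputable section

namespace PMGraph

open Set Topology Function

/-! ### Formal power series -/

/-- The formal power series `exp (∑_{n ≥ 1} (s n / n) zⁿ)`. -/
def expSeries (s : ℕ → ℝ) : PowerSeries ℝ :=
  (PowerSeries.exp ℝ).subst (PowerSeries.mk fun n : ℕ => if n = 0 then 0 else s n / (n : ℝ))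

/-- The radius of convergence, in `[0, ∞]`, of a real power series (in the complex variable `z`). -/
def radius (A : PowerSeries ℝ) : ENNReal :=
  (FormalMultilinearSeries.ofScalars ℂ fun n : ℕ => ((PowerSeries.coeff n A : ℝ) : ℂ)).radius

/-- `z` is a zero of the power series `A`: the series converges at `z`, with sum `0`. -/
def IsZeroOf (A : PowerSeries ℝ) (z : ℂ) : Prop :=
  HasSum (fun n : ℕ => ((PowerSeries.coeff n A : ℝ) : ℂ) * z ^ n) 0

/-! ### Traces of pairs of endomorphisms -/

section Pairs

variable {V : Type*} [AddCommGroup V] [Module ℝ V]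

/-- The trace of an endomorphism of finite rank: the trace of its restriction to its image. -/
def finRankTrace (φ : Module.End ℝ V) : ℝ :=
  LinearMap.trace ℝ (LinearMap.range φ)
    (φ.restrict (p := LinearMap.range φ) (q := LinearMap.range φ)
      fun x _ => LinearMap.mem_range_self φ x)

/-- `φbar : V → V` and `φtil : V / V₀ → V / V₀` form, together with `φ : V₀ → V₀`, an endomorphism
of the exact sequence `0 → V₀ → V → V / V₀ → 0`. -/
def IsExtensionOf {V₀ : Submodule ℝ V} (φ : Module.End ℝ V₀) (φbar : Module.End ℝ V)
    (φtil : Module.End ℝ (V ⧸ V₀)) : Prop :=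
  (∀ v : V₀, φbar (v : V) = (φ v : V)) ∧ ∀ v : V, φtil (V₀.mkQ v) = V₀.mkQ (φbar v)

/-- The pair of endomorphisms `(φ₀, φ₁)` on `V` (defined on the subspaces `V₀`, `V₁` of finite
codimension) has finite rank, and `t` is its trace. -/
def IsPairTrace {V₀ V₁ : Submodule ℝ V} (φ₀ : Module.End ℝ V₀) (φ₁ : Module.End ℝ V₁) (t : ℝ) :
    Prop :=
  ∃ (φbar₀ φbar₁ : Module.End ℝ V) (φtil₀ : Module.End ℝ (V ⧸ V₀))
    (φtil₁ : Module.End ℝ (V ⧸ V₁)),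
    IsExtensionOf φ₀ φbar₀ φtil₀ ∧ IsExtensionOf φ₁ φbar₁ φtil₁ ∧
    FiniteDimensional ℝ (LinearMap.range (φbar₁ - φbar₀)) ∧
    t = finRankTrace (φbar₁ - φbar₀) - LinearMap.trace ℝ (V ⧸ V₁) φtil₁
      + LinearMap.trace ℝ (V ⧸ V₀) φtil₀

open Classical in
/-- The trace of a pair of endomorphisms of finite rank (it does not depend on the extensions used
to compute it; the value is `0` by convention for a pair that is not of finite rank). -/
def pairTrace {V₀ V₁ : Submodule ℝ V} (φ₀ : Module.End ℝ V₀) (φ₁ : Module.End ℝ V₁) : ℝ :=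
  if h : ∃ t, IsPairTrace φ₀ φ₁ t then h.choose else 0

/-- The determinant `exp (-∑_{n ≥ 1} tr(φ₀ⁿ, φ₁ⁿ) zⁿ / n)` of a pair of endomorphisms. -/
def pairDet {V₀ V₁ : Submodule ℝ V} (φ₀ : Module.End ℝ V₀) (φ₁ : Module.End ℝ V₁) :
    PowerSeries ℝ :=
  expSeries fun n => -pairTrace (φ₀ ^ n) (φ₁ ^ n)

end Pairs

/-! ### The spaces `S₀(X; ℝ)` and `S₁(X; ℝ)` -/

/-- The real vector space with basis the points of `X`. -/
abbrev S0 (X : Type*) : Type _ := X →₀ ℝ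

/-- The subspace of `S₀(X; ℝ)` generated by the vectors `y - x`, for `x` and `y` in the same
connected component of `X`. -/
def S1 (X : Type*) [TopologicalSpace X] : Submodule ℝ (S0 X) :=
  Submodule.span ℝ {v | ∃ x y : X, y ∈ connectedComponent x ∧
    v = Finsupp.single y (1 : ℝ) - Finsupp.single x (1 : ℝ)}

/-! ### Piecewise monotone maps on finite unions of compact intervals -/

/-- The union of the intervals `[a i, b i]`. -/
def unionIcc {m : ℕ} (a b : Fin m → ℝ) : Set ℝ := ⋃ i, Icc (a i) (b i)

/-- A piecewise monotone map `F : Ω \ C → Ω`, where `Ω = [a₁, b₁] ∪ … ∪ [aₘ, bₘ]` with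
`a₁ < b₁ < a₂ < … < aₘ < bₘ`, and `C` is a finite subset of `Ω` that contains all the endpoints.
The values of `toFun` outside `Ω \ C` play no role. -/
structure PMMap where
  /-- the number of intervals -/
  m : ℕ
  /-- the left endpoints -/
  a : Fin m → ℝ
  /-- the right endpoints -/
  b : Fin m → ℝ
  a_lt_b : ∀ i, a i < b i
  b_lt_a : ∀ i j, i < j → b i < a j
  /-- the finite set where the map is not defined -/
  C : Finset ℝ
  C_subset : (C : Set ℝ) ⊆ unionIcc a b
  a_mem_C : ∀ i, a i ∈ C
  b_mem_C : ∀ i, b i ∈ C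
  /-- the map -/
  toFun : ℝ → ℝ
  mapsTo : ∀ x ∈ unionIcc a b \ (C : Set ℝ), toFun x ∈ unionIcc a b
  continuousOn : ∀ x ∈ unionIcc a b \ (C : Set ℝ),
    ContinuousOn toFun (connectedComponentIn (unionIcc a b \ (C : Set ℝ)) x)
  monotoneOn : ∀ x ∈ unionIcc a b \ (C : Set ℝ),
    StrictMonoOn toFun (connectedComponentIn (unionIcc a b \ (C : Set ℝ)) x) ∨
      StrictAntiOn toFun (connectedComponentIn (unionIcc a b \ (C : Set ℝ)) x)

namespace PMMap

variable (F : PMMap)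

/-- The set `Ω`. -/
def Ω : Set ℝ := unionIcc F.a F.b

/-- The boundary of `Ω`, i.e. the set of all endpoints, as a subset of `Ω`. -/
def boundary : Set F.Ω := {x | ∃ i, (x : ℝ) = F.a i ∨ (x : ℝ) = F.b i}

/-- The value `F(x) ∈ Ω` at a point `x` of `Ω \ C`. -/
def app (x : F.Ω) (hx : (x : ℝ) ∉ F.C) : F.Ω := ⟨F.toFun x, F.mapsTo x ⟨x.2, hx⟩⟩

open Classical in
/-- The basis vector of `S₀(Ω; ℝ)` given by a point `x` of `Ω` (and `0` if `x` is not in `Ω`). -/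
def pt (x : ℝ) : S0 F.Ω := if h : x ∈ F.Ω then Finsupp.single ⟨x, h⟩ 1 else 0

/-- `F` is monotone on `[x, y]`, where `x < y`: the open interval is contained in `Ω \ C`. -/
def IsMonoInterval (x y : ℝ) : Prop := x < y ∧ Ioo x y ⊆ F.Ω \ (F.C : Set ℝ)

open Classical in
/-- The sign of `F` on an interval of monotonicity `[x, y]`: `1` or `-1` according to whether `F`
is increasing or decreasing on the open interval. -/
def epsInterval (x y : ℝ) : ℝ := if StrictMonoOn F.toFun (Ioo x y) then 1 else -1

open Classical in
/-- The sign of `F` at a point `x` of `Ω`: `0` at points of `C`, otherwise `1` or `-1` according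
to whether `F` is increasing or decreasing on a neighborhood of `x`. -/
def eps (x : ℝ) : ℝ :=
  if x ∈ F.C then 0 else if ∃ U ∈ 𝓝 x, StrictMonoOn F.toFun U then 1 else -1

open Classical in
/-- The endomorphism of `S₀(Ω; ℝ)` that maps `x` to `F(x)` if `x ∉ C`, and to `0` if `x ∈ C`. -/
def sharpZero : Module.End ℝ (S0 F.Ω) :=
  Finsupp.linearCombination ℝ fun x : F.Ω => if (x : ℝ) ∈ F.C then 0 else F.pt (F.toFun x)

/-- The endomorphism of `S₀(Ω; ℝ)` that maps each point `x` to `ε(x) F_{#0}(x)`. -/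
def epsSharpZero : Module.End ℝ (S0 F.Ω) :=
  Finsupp.linearCombination ℝ fun x : F.Ω => F.eps x • F.sharpZero (Finsupp.single x 1)

/-- The defining property of the endomorphism `ε F_{#1}` of `S₁(Ω; ℝ)`: if `F` is monotone on
`[x, y]`, then `y - x` is mapped to `ε([x, y]) (F(y-) - F(x+))`. -/
def IsEpsSharpOne (E : Module.End ℝ (S1 F.Ω)) : Prop :=
  ∀ x y : ℝ, F.IsMonoInterval x y → ∀ v : S1 F.Ω, (v : S0 F.Ω) = F.pt y - F.pt x →
    (E v : S0 F.Ω) =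
      F.epsInterval x y • (F.pt (leftLim F.toFun y) - F.pt (rightLim F.toFun x))

/-! Existence and uniqueness of this endomorphism. -/

variable {F}

theorem isClosed_Ω : IsClosed F.Ω := isClosed_iUnion_of_finite fun _ => isClosed_Icc

theorem IsMonoInterval.Icc_subset {x y : ℝ} (h : F.IsMonoInterval x y) : Icc x y ⊆ F.Ω := by
  rw [← closure_Ioo h.1.ne]
  exact closure_minimal (fun z hz => (h.2 hz).1) isClosed_Ω

theorem IsMonoInterval.subset_component {x y z : ℝ} (h : F.IsMonoInterval x y) (hz : z ∈ Ioo x y) :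
    Ioo x y ⊆ connectedComponentIn (F.Ω \ (F.C : Set ℝ)) z :=
  isPreconnected_Ioo.subset_connectedComponentIn hz h.2

theorem IsMonoInterval.continuousOn {x y : ℝ} (h : F.IsMonoInterval x y) :
    ContinuousOn F.toFun (Ioo x y) := by
  obtain ⟨z, hz⟩ := nonempty_Ioo.2 h.1
  exact (F.continuousOn z (h.2 hz)).mono (h.subset_component hz)

theorem IsMonoInterval.monotoneOn {x y : ℝ} (h : F.IsMonoInterval x y) :
    StrictMonoOn F.toFun (Ioo x y) ∨ StrictAntiOn F.toFun (Ioo x y) := by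
  obtain ⟨z, hz⟩ := nonempty_Ioo.2 h.1
  exact (F.monotoneOn z (h.2 hz)).imp (fun H => H.mono (h.subset_component hz))
    fun H => H.mono (h.subset_component hz)

theorem not_strictMonoOn_and_strictAntiOn {f : ℝ → ℝ} {x y : ℝ} (h : x < y)
    (h1 : StrictMonoOn f (Ioo x y)) (h2 : StrictAntiOn f (Ioo x y)) : False := by
  obtain ⟨z, hz⟩ := nonempty_Ioo.2 h
  obtain ⟨w, hw⟩ := nonempty_Ioo.2 hz.2
  have hw' : w ∈ Ioo x y := ⟨hz.1.trans hw.1, hw.2⟩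
  exact lt_asymm (h1 hz hw' hw.1) (h2 hz hw' hw.1)

theorem IsMonoInterval.strictMonoOn_iff {s t x y : ℝ} (h : F.IsMonoInterval s t) (hxy : x < y)
    (hs : Ioo x y ⊆ Ioo s t) :
    StrictMonoOn F.toFun (Ioo x y) ↔ StrictMonoOn F.toFun (Ioo s t) := by
  refine ⟨fun H => h.monotoneOn.resolve_right fun H' => ?_, fun H => H.mono hs⟩
  exact not_strictMonoOn_and_strictAntiOn hxy H (H'.mono hs)

theorem IsMonoInterval.exists_left {x y : ℝ} (h : F.IsMonoInterval x y) :
    (∃ p, Filter.Tendsto F.toFun (𝓝[<] y) (𝓝 p)) ∧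
      ∃ p, Filter.Tendsto F.toFun (𝓝[>] x) (𝓝 p) := by
  have hb : Bornology.IsBounded (F.toFun '' Ioo x y) := by
    have : Bornology.IsBounded F.Ω :=
      (Bornology.isBounded_iUnion).2 fun i => Metric.isBounded_Icc _ _
    refine this.subset ?_
    rintro _ ⟨z, hz, rfl⟩
    exact F.mapsTo z (h.2 hz)
  have hA := hb.bddAbove
  have hB := hb.bddBelow
  rcases h.monotoneOn with H | H
  · exact ⟨⟨_, H.monotoneOn.tendsto_nhdsWithin_Ioo_left (nonempty_Ioo.2 h.1) hA⟩,
      ⟨_, H.monotoneOn.tendsto_nhdsWithin_Ioo_right (nonempty_Ioo.2 h.1) hB⟩⟩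
  · have H' : MonotoneOn (fun z => -F.toFun z) (Ioo x y) := H.antitoneOn.neg
    have hA' : BddAbove ((fun z => -F.toFun z) '' Ioo x y) := by
      obtain ⟨B, hB⟩ := hB
      refine ⟨-B, ?_⟩
      rintro _ ⟨z, hz, rfl⟩
      exact neg_le_neg (hB ⟨z, hz, rfl⟩)
    have hB' : BddBelow ((fun z => -F.toFun z) '' Ioo x y) := by
      obtain ⟨B, hB⟩ := hA
      refine ⟨-B, ?_⟩
      rintro _ ⟨z, hz, rfl⟩
      exact neg_le_neg (hB ⟨z, hz, rfl⟩)
    have l := (H'.tendsto_nhdsWithin_Ioo_left (nonempty_Ioo.2 h.1) hA').neg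
    have r := (H'.tendsto_nhdsWithin_Ioo_right (nonempty_Ioo.2 h.1) hB').neg
    simp only [neg_neg] at l r
    exact ⟨⟨_, l⟩, ⟨_, r⟩⟩

theorem IsMonoInterval.limits_mem {x y : ℝ} (h : F.IsMonoInterval x y) :
    leftLim F.toFun y ∈ closure (F.toFun '' Ioo x y) ∧
      rightLim F.toFun x ∈ closure (F.toFun '' Ioo x y) := by
  have h1 := tendsto_leftLim_of_tendsto h.exists_left.1
  have h2 := tendsto_rightLim_of_tendsto h.exists_left.2
  refine ⟨mem_closure_of_tendsto h1 ?_, mem_closure_of_tendsto h2 ?_⟩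
  · filter_upwards [Ioo_mem_nhdsLT h.1] with z hz using ⟨z, hz, rfl⟩
  · filter_upwards [Ioo_mem_nhdsGT h.1] with z hz using ⟨z, hz, rfl⟩

theorem pt_sub_pt_mem {K : Set ℝ} (hK : IsPreconnected K) (hKΩ : K ⊆ F.Ω) {x y : ℝ} (hx : x ∈ K)
    (hy : y ∈ K) : F.pt y - F.pt x ∈ S1 F.Ω := by
  refine Submodule.subset_span ⟨⟨x, hKΩ hx⟩, ⟨y, hKΩ hy⟩, ?_, ?_⟩
  · have : y ∈ connectedComponentIn F.Ω x := hK.subset_connectedComponentIn hx hKΩ hy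
    rw [connectedComponentIn_eq_image (hKΩ hx)] at this
    obtain ⟨z, hz, rfl⟩ := this
    exact hz
  · simp [pt, hKΩ hx, hKΩ hy]

theorem IsMonoInterval.image_mem {x y : ℝ} (h : F.IsMonoInterval x y) :
    F.pt (leftLim F.toFun y) - F.pt (rightLim F.toFun x) ∈ S1 F.Ω := by
  have hK : IsPreconnected (closure (F.toFun '' Ioo x y)) :=
    (isPreconnected_Ioo.image _ h.continuousOn).closure
  refine pt_sub_pt_mem hK (closure_minimal ?_ isClosed_Ω) h.limits_mem.2 h.limits_mem.1
  rintro _ ⟨z, hz, rfl⟩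
  exact F.mapsTo z (h.2 hz)

theorem exists_isMonoInterval {x : ℝ} (hx : x ∈ F.Ω) (hC : x ∉ F.C) :
    ∃ s t, s < x ∧ x < t ∧ F.IsMonoInterval s t := by
  obtain ⟨i, hi⟩ := mem_iUnion.1 hx
  have ha : F.a i < x := lt_of_le_of_ne hi.1 fun h => hC (h ▸ F.a_mem_C i)
  have hb : x < F.b i := lt_of_le_of_ne hi.2 fun h => hC (h ▸ F.b_mem_C i)
  have hU : Ioo (F.a i) (F.b i) \ (F.C : Set ℝ) ∈ 𝓝 x :=
    (isOpen_Ioo.sdiff F.C.finite_toSet.isClosed).mem_nhds ⟨⟨ha, hb⟩, hC⟩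
  obtain ⟨s, t, hst, hU⟩ := mem_nhds_iff_exists_Ioo_subset.1 hU
  exact ⟨s, t, hst.1, hst.2, hst.1.trans hst.2, fun z hz =>
    ⟨mem_iUnion.2 ⟨i, Ioo_subset_Icc_self (hU hz).1⟩, (hU hz).2⟩⟩

theorem continuousAt {x : ℝ} (hx : x ∈ F.Ω) (hC : x ∉ F.C) : ContinuousAt F.toFun x := by
  obtain ⟨s, t, hs, ht, h⟩ := exists_isMonoInterval hx hC
  exact h.continuousOn.continuousAt (Ioo_mem_nhds hs ht)

/-- The vectors `y - x`, for `F` monotone on `[x, y]`, span `S₁(Ω; ℝ)`. -/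
theorem S1_le_of_mono (W : Submodule ℝ (S0 F.Ω))
    (hW : ∀ x y, F.IsMonoInterval x y → F.pt y - F.pt x ∈ W) : S1 F.Ω ≤ W := by
  have key : ∀ (n : ℕ) (x y : ℝ), x < y → Icc x y ⊆ F.Ω →
      (F.C.filter fun c => x < c ∧ c < y).card ≤ n → F.pt y - F.pt x ∈ W := by
    intro n
    induction n with
    | zero =>
      intro x y hxy hI hn
      refine hW x y ⟨hxy, fun z hz => ⟨hI (Ioo_subset_Icc_self hz), fun hzC => ?_⟩⟩
      rw [Nat.le_zero, Finset.card_eq_zero] at hn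
      exact Finset.notMem_empty z (hn ▸ Finset.mem_filter.2 ⟨hzC, hz⟩)
    | succ n ih =>
      intro x y hxy hI hn
      by_cases hc : ∃ c ∈ F.C, x < c ∧ c < y
      · obtain ⟨c, hcC, hxc, hcy⟩ := hc
        have h1 := ih x c hxc (fun z hz => hI ⟨hz.1, hz.2.trans hcy.le⟩) (by
          refine Nat.le_of_lt_succ (lt_of_lt_of_le (Finset.card_lt_card ?_) hn)
          refine Finset.ssubset_iff_of_subset ?_ |>.2 ⟨c, by simp [hcC, hxc, hcy], by simp⟩
          intro d hd
          simp only [Finset.mem_filter] at hd ⊢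
          exact ⟨hd.1, hd.2.1, hd.2.2.trans hcy⟩)
        have h2 := ih c y hcy (fun z hz => hI ⟨hxc.le.trans hz.1, hz.2⟩) (by
          refine Nat.le_of_lt_succ (lt_of_lt_of_le (Finset.card_lt_card ?_) hn)
          refine Finset.ssubset_iff_of_subset ?_ |>.2 ⟨c, by simp [hcC, hxc, hcy], by simp⟩
          intro d hd
          simp only [Finset.mem_filter] at hd ⊢
          exact ⟨hd.1, hxc.trans hd.2.1, hd.2.2⟩)
        simpa using W.add_mem h2 h1
      · push Not at hc
        refine hW x y ⟨hxy, fun z hz => ⟨hI (Ioo_subset_Icc_self hz), fun hzC => ?_⟩⟩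
        exact absurd hz.2 (not_lt.2 (hc z hzC hz.1))
  refine Submodule.span_le.2 ?_
  rintro _ ⟨x, y, hxy, rfl⟩
  have hx : Finsupp.single x (1 : ℝ) = F.pt x := by simp [pt]
  have hy : Finsupp.single y (1 : ℝ) = F.pt y := by simp [pt]
  rw [hx, hy]
  have hK : (connectedComponentIn F.Ω (x : ℝ)).OrdConnected :=
    isPreconnected_connectedComponentIn.ordConnected
  have hxK : (x : ℝ) ∈ connectedComponentIn F.Ω (x : ℝ) := mem_connectedComponentIn x.2
  have hyK : (y : ℝ) ∈ connectedComponentIn F.Ω (x : ℝ) := by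
    rw [connectedComponentIn_eq_image x.2]
    exact ⟨y, hxy, rfl⟩
  rcases lt_trichotomy (x : ℝ) y with h | h | h
  · exact key _ _ _ h ((hK.out hxK hyK).trans (connectedComponentIn_subset _ _)) le_rfl
  · simp [h]
  · have := key _ _ _ h ((hK.out hyK hxK).trans (connectedComponentIn_subset _ _)) le_rfl
    simpa using W.neg_mem this

open Classical in
/-- An endomorphism of `S₀(Ω; ℝ)` that extends `ε F_{#1}`. -/
theorem exists_extension : ∃ ψ : Module.End ℝ (S0 F.Ω), ∀ x y, F.IsMonoInterval x y →
    ψ (F.pt y - F.pt x) =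
      F.epsInterval x y • (F.pt (leftLim F.toFun y) - F.pt (rightLim F.toFun x)) := by
  let vm : ℝ → S0 F.Ω := fun c =>
    (if ∃ s < c, StrictMonoOn F.toFun (Ioo s c) then (1 : ℝ) else -1) • F.pt (leftLim F.toFun c)
  let vp : ℝ → S0 F.Ω := fun c =>
    (if ∃ s > c, StrictMonoOn F.toFun (Ioo c s) then (1 : ℝ) else -1) • F.pt (rightLim F.toFun c)
  let g : ℝ → S0 F.Ω := fun x => (if x ∈ F.C then 0 else F.eps x • F.pt (F.toFun x))
    + (∑ c ∈ F.C, if c ≤ x ∧ Icc c x ⊆ F.Ω then vm c else 0)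
    - ∑ c ∈ F.C, if c < x ∧ Icc c x ⊆ F.Ω then vp c else 0
  refine ⟨Finsupp.linearCombination ℝ fun x : F.Ω => g x, fun x y h => ?_⟩
  have hI := h.Icc_subset
  have hxΩ : x ∈ F.Ω := hI ⟨le_rfl, h.1.le⟩
  have hyΩ : y ∈ F.Ω := hI ⟨h.1.le, le_rfl⟩
  have hx : F.pt x = Finsupp.single ⟨x, hxΩ⟩ 1 := by simp [pt, hxΩ]
  have hy : F.pt y = Finsupp.single ⟨y, hyΩ⟩ 1 := by simp [pt, hyΩ]
  rw [map_sub, hx, hy, Finsupp.linearCombination_single, Finsupp.linearCombination_single,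
    one_smul, one_smul]
  -- enlarging or shrinking intervals
  have hsub : ∀ c ∈ F.C, ¬ (x < c ∧ c < y) := fun c hc hc' => (h.2 hc').2 hc
  have hIcc : ∀ c, c ≤ x → (Icc c y ⊆ F.Ω ↔ Icc c x ⊆ F.Ω) := by
    intro c hc
    refine ⟨fun H z hz => H ⟨hz.1, hz.2.trans h.1.le⟩, fun H z hz => ?_⟩
    rcases le_total z x with hzx | hzx
    · exact H ⟨hz.1, hzx⟩
    · exact hI ⟨hzx, hz.2⟩
  have hm : (∑ c ∈ F.C, if c ≤ y ∧ Icc c y ⊆ F.Ω then vm c else 0)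
      = (∑ c ∈ F.C, if c ≤ x ∧ Icc c x ⊆ F.Ω then vm c else 0)
        + if y ∈ F.C then vm y else 0 := by
    rw [← Finset.sum_ite_eq F.C y vm, ← Finset.sum_add_distrib]
    refine Finset.sum_congr rfl fun c hc => ?_
    by_cases hcy : y = c
    · subst hcy
      have h1 : y ≤ y ∧ Icc y y ⊆ F.Ω := ⟨le_rfl, by simpa using hyΩ⟩
      have h2 : ¬ (y ≤ x ∧ Icc y x ⊆ F.Ω) := fun H => absurd H.1 (not_le.2 h.1)
      rw [if_pos h1, if_neg h2, if_pos rfl, zero_add]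
    · rw [if_neg hcy, add_zero]
      have : (c ≤ y ∧ Icc c y ⊆ F.Ω) ↔ (c ≤ x ∧ Icc c x ⊆ F.Ω) := by
        refine ⟨fun H => ?_, fun H => ⟨H.1.trans h.1.le, (hIcc c H.1).2 H.2⟩⟩
        have hcx : c ≤ x := by
          by_contra hcx
          exact hsub c hc ⟨not_le.1 hcx, lt_of_le_of_ne H.1 (Ne.symm hcy)⟩
        exact ⟨hcx, (hIcc c hcx).1 H.2⟩
      simp only [this]
  have hp : (∑ c ∈ F.C, if c < y ∧ Icc c y ⊆ F.Ω then vp c else 0)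
      = (∑ c ∈ F.C, if c < x ∧ Icc c x ⊆ F.Ω then vp c else 0)
        + if x ∈ F.C then vp x else 0 := by
    rw [← Finset.sum_ite_eq F.C x vp, ← Finset.sum_add_distrib]
    refine Finset.sum_congr rfl fun c hc => ?_
    by_cases hcx : x = c
    · subst hcx
      have h1 : x < y ∧ Icc x y ⊆ F.Ω := ⟨h.1, hI⟩
      have h2 : ¬ (x < x ∧ Icc x x ⊆ F.Ω) := fun H => lt_irrefl _ H.1
      rw [if_pos h1, if_neg h2, if_pos rfl, zero_add]
    · rw [if_neg hcx, add_zero]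
      have : (c < y ∧ Icc c y ⊆ F.Ω) ↔ (c < x ∧ Icc c x ⊆ F.Ω) := by
        refine ⟨fun H => ?_, fun H => ⟨H.1.trans h.1, (hIcc c H.1.le).2 H.2⟩⟩
        have hcx' : c ≤ x := by
          by_contra hcx'
          exact hsub c hc ⟨not_le.1 hcx', H.1⟩
        exact ⟨lt_of_le_of_ne hcx' (Ne.symm hcx), (hIcc c hcx').1 H.2⟩
      simp only [this]
  -- the contributions of the two endpoints
  have hY : (if y ∈ F.C then 0 else F.eps y • F.pt (F.toFun y)) + (if y ∈ F.C then vm y else 0)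
      = F.epsInterval x y • F.pt (leftLim F.toFun y) := by
    by_cases hyC : y ∈ F.C
    · rw [if_pos hyC, if_pos hyC, zero_add]
      have : (∃ s < y, StrictMonoOn F.toFun (Ioo s y)) ↔ StrictMonoOn F.toFun (Ioo x y) := by
        refine ⟨fun ⟨s, hs, H⟩ => ?_, fun H => ⟨x, h.1, H⟩⟩
        have hmax : max s x < y := max_lt hs h.1
        exact (h.strictMonoOn_iff hmax (Ioo_subset_Ioo_left (le_max_right _ _))).1
          (H.mono (Ioo_subset_Ioo_left (le_max_left _ _)))
      simp only [vm, epsInterval, this]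
    · rw [if_neg hyC, if_neg hyC, add_zero,
        (continuousAt hyΩ hyC).continuousWithinAt.leftLim_eq]
      congr 1
      obtain ⟨s, t, hs, ht, hst⟩ := exists_isMonoInterval hyΩ hyC
      have hmax : max s x < y := max_lt hs h.1
      have e : (∃ U ∈ 𝓝 y, StrictMonoOn F.toFun U) ↔ StrictMonoOn F.toFun (Ioo x y) := by
        rw [← h.strictMonoOn_iff hmax (Ioo_subset_Ioo_left (le_max_right _ _)),
          hst.strictMonoOn_iff hmax (Ioo_subset_Ioo (le_max_left _ _) ht.le)]
        refine ⟨fun ⟨U, hU, H⟩ => ?_, fun H => ⟨_, Ioo_mem_nhds hs ht, H⟩⟩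
        obtain ⟨p, q, hpq, hpU⟩ := mem_nhds_iff_exists_Ioo_subset.1 hU
        have hmax' : max s p < y := max_lt hs hpq.1
        exact (hst.strictMonoOn_iff hmax' (Ioo_subset_Ioo (le_max_left _ _) ht.le)).1
          (H.mono ((Ioo_subset_Ioo (le_max_right _ _) hpq.2.le).trans hpU))
      simp only [eps, hyC, epsInterval, e, if_false]
  have hX : (if x ∈ F.C then 0 else F.eps x • F.pt (F.toFun x)) + (if x ∈ F.C then vp x else 0)
      = F.epsInterval x y • F.pt (rightLim F.toFun x) := by
    by_cases hxC : x ∈ F.C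
    · rw [if_pos hxC, if_pos hxC, zero_add]
      have : (∃ s > x, StrictMonoOn F.toFun (Ioo x s)) ↔ StrictMonoOn F.toFun (Ioo x y) := by
        refine ⟨fun ⟨s, hs, H⟩ => ?_, fun H => ⟨y, h.1, H⟩⟩
        have hmin : x < min s y := lt_min hs h.1
        exact (h.strictMonoOn_iff hmin (Ioo_subset_Ioo_right (min_le_right _ _))).1
          (H.mono (Ioo_subset_Ioo_right (min_le_left _ _)))
      simp only [vp, epsInterval, this]
    · rw [if_neg hxC, if_neg hxC, add_zero,
        (continuousAt hxΩ hxC).continuousWithinAt.rightLim_eq]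
      congr 1
      obtain ⟨s, t, hs, ht, hst⟩ := exists_isMonoInterval hxΩ hxC
      have hmin : x < min t y := lt_min ht h.1
      have e : (∃ U ∈ 𝓝 x, StrictMonoOn F.toFun U) ↔ StrictMonoOn F.toFun (Ioo x y) := by
        rw [← h.strictMonoOn_iff hmin (Ioo_subset_Ioo_right (min_le_right _ _)),
          hst.strictMonoOn_iff hmin (Ioo_subset_Ioo hs.le (min_le_left _ _))]
        refine ⟨fun ⟨U, hU, H⟩ => ?_, fun H => ⟨_, Ioo_mem_nhds hs ht, H⟩⟩
        obtain ⟨p, q, hpq, hpU⟩ := mem_nhds_iff_exists_Ioo_subset.1 hU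
        have hmin' : x < min t q := lt_min ht hpq.2
        exact (hst.strictMonoOn_iff hmin' (Ioo_subset_Ioo hs.le (min_le_left _ _))).1
          (H.mono ((Ioo_subset_Ioo hpq.1.le (min_le_right _ _)).trans hpU))
      simp only [eps, hxC, epsInterval, e, if_false]
  rw [smul_sub, ← hY, ← hX]
  simp only [g]
  rw [hm, hp]
  abel

variable (F)

theorem existsUnique_epsSharpOne : ∃! E : Module.End ℝ (S1 F.Ω), F.IsEpsSharpOne E := by
  obtain ⟨ψ, hψ⟩ := exists_extension (F := F)
  have hS : S1 F.Ω ≤ (S1 F.Ω).comap ψ := S1_le_of_mono _ fun x y h => by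
    rw [Submodule.mem_comap, hψ x y h]
    exact Submodule.smul_mem _ _ h.image_mem
  let E₀ : Module.End ℝ (S1 F.Ω) := ψ.restrict (p := S1 F.Ω) (q := S1 F.Ω) fun v hv => hS hv
  have hE₀ : ∀ v : S1 F.Ω, (E₀ v : S0 F.Ω) = ψ v := fun v => rfl
  refine ⟨E₀, fun x y h v hv => ?_, fun E hE => ?_⟩
  · rw [hE₀, ← hψ x y h, ← hv]
  · have hle : S1 F.Ω ≤ (LinearMap.eqLocus E E₀).map (S1 F.Ω).subtype := by
      refine S1_le_of_mono _ fun x y h => ?_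
      have hmem : F.pt y - F.pt x ∈ S1 F.Ω :=
        pt_sub_pt_mem isPreconnected_Icc h.Icc_subset (left_mem_Icc.2 h.1.le)
          (right_mem_Icc.2 h.1.le)
      refine ⟨⟨_, hmem⟩, ?_, rfl⟩
      rw [SetLike.mem_coe, LinearMap.mem_eqLocus]
      refine Subtype.ext ?_
      rw [hE x y h ⟨_, hmem⟩ rfl, hE₀, ← hψ x y h]
    refine LinearMap.ext fun v => ?_
    obtain ⟨w, hw, hwv⟩ := hle v.2
    have : w = v := Subtype.ext hwv
    subst this
    exact LinearMap.mem_eqLocus.1 hw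

/-- The endomorphism `ε F_{#1}` of `S₁(Ω; ℝ)`. -/
def epsSharpOne : Module.End ℝ (S1 F.Ω) := F.existsUnique_epsSharpOne.choose

/-- The kneading determinant `D(z)` of `F`: the determinant of the pair `(ε F_{#0}, ε F_{#1})` of
endomorphisms on `S₀(Ω; ℝ)`, the first being defined on the whole space. -/
def kneadingDet : PowerSeries ℝ :=
  pairDet (V₀ := ⊤) ((Submodule.topEquiv (R := ℝ) (M := S0 F.Ω)).symm.conj F.epsSharpZero)
    F.epsSharpOne

end PMMap

/-! ### Graphs and piecewise monotone graph maps -/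

section Graphs

variable {G : Type u} [TopologicalSpace G]

variable (G) in
/-- A graph: a compact Hausdorff space that is a union of finitely many homeomorphic copies of
`[0, 1]`, any two of which intersect at most at their endpoints. -/
def IsGraph : Prop :=
  CompactSpace G ∧ T2Space G ∧ ∃ (k : ℕ) (e : Fin k → unitInterval → G),
    (∀ i, IsEmbedding (e i)) ∧ (⋃ i, range (e i)) = univ ∧
    ∀ i j, i ≠ j → range (e i) ∩ range (e j) ⊆ {e i 0, e i 1} ∩ {e j 0, e j 1}

variable (G) in
/-- The vertices: the points without an open neighborhood homeomorphic to `]0, 1[`. -/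
def vertices : Set G :=
  {x | ¬ ∃ U : Set G, IsOpen U ∧ x ∈ U ∧ Nonempty (U ≃ₜ Ioo (0 : ℝ) 1)}

/-- Piecewise monotone graph maps. -/
def IsPMG (f : G → G) : Prop :=
  Continuous f ∧ ∃ C : Set G, C.Finite ∧ ∀ x ∈ Cᶜ, InjOn f (connectedComponentIn Cᶜ x)

/-- The set of fixed points of negative type: the fixed points `x`, not vertices, such that `f`,
read in a chart `e` onto an open subset of `ℝ`, is decreasing on a neighborhood `U` of `x`. -/
def fixNeg (f : G → G) : Set G :=
  {x | f x = x ∧ x ∉ vertices G ∧ ∃ e : OpenPartialHomeomorph G ℝ, ∃ U ∈ 𝓝 x,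
    U ⊆ e.source ∧ f '' U ⊆ e.source ∧
    ∀ y ∈ U, ∀ z ∈ U, e y < e z → e (f z) < e (f y)}

/-- The map `f_{*i}` induced by `f` on the real singular homology `H_i(G; ℝ)`. -/
def homologyMap (f : C(G, G)) (i : ℕ) :
    Module.End ℝ (((AlgebraicTopology.singularHomologyFunctor (ModuleCat.{u} ℝ) i).obj
      (ModuleCat.of ℝ (ULift.{u} ℝ))).obj (TopCat.of G)) :=
  (((AlgebraicTopology.singularHomologyFunctor (ModuleCat.{u} ℝ) i).obj
    (ModuleCat.of ℝ (ULift.{u} ℝ))).map (TopCat.ofHom f)).hom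

/-- The Lefschetz zeta function of `f`. -/
def zetaL (f : C(G, G)) : PowerSeries ℝ :=
  expSeries fun n =>
    LinearMap.trace ℝ _ (homologyMap f 0 ^ n) - LinearMap.trace ℝ _ (homologyMap f 1 ^ n)

/-- The negative zeta function of `f`. -/
def zetaNeg (f : C(G, G)) : PowerSeries ℝ :=
  expSeries fun n => 2 * ((fixNeg f^[n]).ncard : ℝ)

/-- The Milnor-Thurston zeta function of `f`. -/
def zetaMT (f : C(G, G)) : PowerSeries ℝ := zetaNeg f * (zetaL f)⁻¹

/-- `f` is induced by the piecewise monotone map `F` via `π`: the continuous map `π : Ω → G` maps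
`Ω \ ∂Ω` homeomorphically onto `G \ π(∂Ω)`, all vertices lie in `π(∂Ω)`, and `π ∘ F = f ∘ π` on
`Ω \ C`. -/
structure IsInducedVia (f : G → G) (F : PMMap) (π : F.Ω → G) : Prop where
  continuous : Continuous π
  vertices_subset : vertices G ⊆ π '' F.boundary
  isEmbedding : IsEmbedding (F.boundaryᶜ.domRestrict π)
  image_eq : π '' F.boundaryᶜ = (π '' F.boundary)ᶜ
  comm : ∀ (x : F.Ω) (hx : (x : ℝ) ∉ F.C), π (F.app x hx) = f (π x)

/-- `f` is induced by `F`. -/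
def IsInducedBy (f : G → G) (F : PMMap) : Prop := ∃ π : F.Ω → G, IsInducedVia f F π

end Graphs

end PMGraph

end

noncomputable section

namespace PMGraph

open Set Topology Function


/-! ### Exponential power series -/

/-! All the series involved are exponentials `exp ∑ sₙ zⁿ / n`, so `ζ^MT(z) D(z) = exp ∑ pₙ zⁿ / n`
with `pₙ = 2 #Fix⁻(fⁿ) - (tr f_{*0}ⁿ - tr f_{*1}ⁿ) - tr((ε F_{#0})ⁿ, (ε F_{#1})ⁿ)`. The point is
that `pₙ` is bounded in `n` (`exists_bound`). Then the coefficients of `exp (-∑ pₙ zⁿ / n)` grow at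
most polynomially, so this inverse converges in the unit disk. If `ζ^MT` converged absolutely at a
zero of `D` there, the product of the three values would be both `0` and `1`
(`radius_le_of_isZeroOf`).

For the bound, extend `(ε F_{#1})ⁿ` to `S₀` by a retraction onto `S₁` and cut each component of `Ω`
at the finitely many points where `Fⁿ` is undefined. On a branch `]x, y[` of `Fⁿ` with one-sided
limits `p` and `q`, the difference of the two endomorphisms is a difference of two rank-one maps.
Its trace is `d + 2 N`, where `N` counts the decreasing fixed points in the branch and `d = [y ≤ q]
- [x < p]` (`d = 0` if the image lies in another component).

Let `h` be a real lift of `fⁿ` restricted to the edge `i`, followed by the map of `G` to a circle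
that collapses all other edges. In the affine coordinate `t`, `d = ⌊h(y) - t(y)⌋ + 1 - ⌈h(x) -
t(x)⌉`. Summed over the branches of an edge, these terms telescope to the rotation of `h` along the
edge, up to a bounded rounding error and one unit for each cut point at which `h - t` is an integer.
Such a cut point is fixed by `fⁿ` and its orbit meets the image of `C_F`, so it lies in a finite set
of critical periodic orbits that does not depend on `n` (`ncard_cutInt_le`).

The total rotation is the sum over the edges of the winding number of the image of the edge around
itself. Up to a bounded error this is the trace on `H₁` (`exists_bound_trace_one`), because winding
numbers embed `H₁` in `ℝᵐ` and a functional that vanishes on cycles is bounded on paths. The trace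
on `H₀` takes finitely many values. Finally, `Fix⁻(fⁿ)` agrees with the decreasing fixed points of
`Fⁿ` except on a fixed finite set (`exists_bound_fixNeg`). -/

open PowerSeries in
theorem hasSubst_exponent (s : ℕ → ℝ) :
    HasSubst (PowerSeries.mk fun n : ℕ => if n = 0 then 0 else s n / (n : ℝ)) :=
  HasSubst.of_constantCoeff_zero' (by simp [← coeff_zero_eq_constantCoeff_apply])

-- Differentiation cancels the division by `n`. The algebra of `expSeries` rests on this
-- differential equation; the value `s 0` never enters.
open PowerSeries in
theorem derivative_expSeries (s : ℕ → ℝ) :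
    d⁄dX ℝ (expSeries s) = expSeries s * PowerSeries.mk fun n => s (n + 1) := by
  rw [expSeries, derivative_subst (hasSubst_exponent s), derivative_exp]
  congr 1
  ext n
  rw [coeff_derivative, coeff_mk, coeff_mk, if_neg n.succ_ne_zero]
  push_cast
  field_simp

open PowerSeries in
theorem constantCoeff_expSeries (s : ℕ → ℝ) : coeff 0 (expSeries s) = 1 := by
  rw [expSeries, coeff_subst' (hasSubst_exponent s), finsum_eq_single _ 0]
  · simp
  · intro d hd
    rw [coeff_zero_eq_constantCoeff_apply, map_pow]
    simp [← coeff_zero_eq_constantCoeff_apply, hd]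

-- The coefficient of degree `n + 1` of a solution of `Y' = Y D` is determined by the lower ones, as
-- `n + 1` is invertible. This replaces formal logarithms: exponentials are compared through their
-- logarithmic derivatives.
open PowerSeries in
theorem eq_of_derivative_eq_mul {A B D : PowerSeries ℝ} (hA : d⁄dX ℝ A = A * D)
    (hB : d⁄dX ℝ B = B * D) (h0 : coeff 0 A = coeff 0 B) : A = B := by
  ext n
  induction n using Nat.strong_induction_on with
  | _ n ih =>
    cases n with
    | zero => exact h0
    | succ n =>
      have hA' := congrArg (coeff n) hA
      have hB' := congrArg (coeff n) hB
      rw [coeff_derivative, coeff_mul] at hA' hB'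
      have : (∑ q ∈ Finset.HasAntidiagonal.antidiagonal n, coeff q.1 A * coeff q.2 D)
          = ∑ q ∈ Finset.HasAntidiagonal.antidiagonal n, coeff q.1 B * coeff q.2 D :=
        Finset.sum_congr rfl fun q hq => by
          rw [ih q.1 (by have := Finset.HasAntidiagonal.mem_antidiagonal.1 hq; omega)]
      rw [this, ← hB'] at hA'
      exact mul_right_cancel₀ (by positivity : (n : ℝ) + 1 ≠ 0) hA'

open PowerSeries in
theorem expSeries_mul (s t : ℕ → ℝ) :
    expSeries s * expSeries t = expSeries fun n => s n + t n := by
  refine eq_of_derivative_eq_mul (D := PowerSeries.mk fun n => s (n + 1) + t (n + 1)) ?_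
    (derivative_expSeries _) ?_
  · rw [Derivation.leibniz, derivative_expSeries, derivative_expSeries, smul_eq_mul, smul_eq_mul]
    have : (PowerSeries.mk fun n => s (n + 1) + t (n + 1))
        = PowerSeries.mk (fun n => s (n + 1)) + PowerSeries.mk fun n => t (n + 1) := by
      ext n; simp
    rw [this]
    ring
  · rw [constantCoeff_expSeries, coeff_mul]
    simp [-coeff_zero_eq_constantCoeff, constantCoeff_expSeries]

open PowerSeries in
theorem expSeries_zero : expSeries (fun _ => 0) = 1 := by
  refine eq_of_derivative_eq_mul (D := 0) ?_ (by simp) (by simp [constantCoeff_expSeries])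
  rw [derivative_expSeries]
  rfl

theorem expSeries_inv (s : ℕ → ℝ) : (expSeries s)⁻¹ = expSeries fun n => -s n := by
  have h : PowerSeries.constantCoeff (expSeries s) ≠ 0 := by
    rw [← PowerSeries.coeff_zero_eq_constantCoeff_apply, constantCoeff_expSeries]
    exact one_ne_zero
  rw [PowerSeries.inv_eq_iff_mul_eq_one h, expSeries_mul]
  simpa using expSeries_zero

open PowerSeries in
/-- The coefficients of `exp (∑ sₙ zⁿ / n)` are dominated by those of `(1 - z)⁻ᵏ⁻¹` if
`|sₙ| ≤ k + 1`. -/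
theorem abs_coeff_expSeries_le (s : ℕ → ℝ) (k : ℕ) (hs : ∀ n, n ≠ 0 → |s n| ≤ k + 1) (n : ℕ) :
    |coeff n (expSeries s)| ≤ ((n + k).choose k : ℝ) := by
  induction n using Nat.strong_induction_on with
  | _ n ih =>
    cases n with
    | zero => simp [constantCoeff_expSeries]
    | succ n =>
      have h := congrArg (coeff n) (derivative_expSeries s)
      rw [coeff_derivative, coeff_mul, Finset.Nat.sum_antidiagonal_eq_sum_range_succ_mk] at h
      have hle : |coeff (n + 1) (expSeries s)| * ((n : ℝ) + 1)
          ≤ (k + 1) * ((n + k + 1).choose (k + 1) : ℝ) := by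
        rw [← abs_of_pos (by positivity : (0 : ℝ) < (n : ℝ) + 1), ← abs_mul, h]
        refine (Finset.abs_sum_le_sum_abs _ _).trans ?_
        -- The hockey-stick identity makes the binomial bound reproduce itself under the recursion
        -- `(n + 1) aₙ₊₁ = ∑ sᵢ₊₁ aₙ₋ᵢ`.
        rw [← Nat.sum_range_add_choose n k]
        push_cast
        rw [Finset.mul_sum]
        refine Finset.sum_le_sum fun i hi => ?_
        rw [abs_mul, coeff_mk, mul_comm]
        exact mul_le_mul (hs _ (Nat.succ_ne_zero _)) (ih i (Finset.mem_range.1 hi)) (abs_nonneg _)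
          (by positivity)
      have hc : ((n + k + 1).choose (k + 1) : ℝ) * (k + 1)
          = ((n + 1 + k).choose k : ℝ) * ((n : ℝ) + 1) := by
        have := Nat.choose_succ_right_eq (n + k + 1) k
        rw [show n + k + 1 - k = n + 1 by omega, show n + k + 1 = n + 1 + k by omega] at this
        rw [show n + k + 1 = n + 1 + k by omega]
        exact_mod_cast this
      rw [mul_comm ((k : ℝ) + 1), hc] at hle
      exact le_of_mul_le_mul_right hle (by positivity)

/-- For bounded `s` the coefficients grow at most polynomially, so the radius of convergence is at
least `1`. -/
theorem summable_expSeries (s : ℕ → ℝ) (K : ℝ) (hs : ∀ n, n ≠ 0 → |s n| ≤ K) {z : ℂ}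
    (hz : ‖z‖ < 1) :
    Summable fun n : ℕ => ‖((PowerSeries.coeff n (expSeries s) : ℝ) : ℂ) * z ^ n‖ := by
  obtain ⟨k, hk⟩ := exists_nat_ge K
  have hb := abs_coeff_expSeries_le s k fun n hn =>
    (hs n hn).trans (hk.trans (by simp))
  refine Summable.of_nonneg_of_le (fun _ => norm_nonneg _) (fun n => ?_)
    (summable_choose_mul_geometric_of_norm_lt_one (R := ℝ) k (r := ‖z‖) (by simpa using hz))
  rw [norm_mul, norm_pow, Complex.norm_real]
  exact mul_le_mul_of_nonneg_right (hb n) (by positivity)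

theorem summable_of_lt_radius (A : PowerSeries ℝ) {z : ℂ}
    (h : ENNReal.ofReal ‖z‖ < radius A) :
    Summable fun n : ℕ => ‖((PowerSeries.coeff n A : ℝ) : ℂ) * z ^ n‖ := by
  have h' : ((‖z‖₊ : NNReal) : ENNReal) < radius A := by
    rwa [← enorm_eq_nnnorm, ← ofReal_norm]
  have := FormalMultilinearSeries.summable_norm_mul_pow _ h'
  refine this.congr fun n => ?_
  rw [FormalMultilinearSeries.ofScalars_norm, norm_mul, norm_pow, coe_nnnorm]

/-- Products of power series that converge absolutely at `z`. -/
theorem summable_mul_and_tsum_mul (A B : PowerSeries ℝ) {z : ℂ}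
    (hA : Summable fun n : ℕ => ‖((PowerSeries.coeff n A : ℝ) : ℂ) * z ^ n‖)
    (hB : Summable fun n : ℕ => ‖((PowerSeries.coeff n B : ℝ) : ℂ) * z ^ n‖) :
    (Summable fun n : ℕ => ‖((PowerSeries.coeff n (A * B) : ℝ) : ℂ) * z ^ n‖) ∧
      (∑' n : ℕ, ((PowerSeries.coeff n A : ℝ) : ℂ) * z ^ n)
        * (∑' n : ℕ, ((PowerSeries.coeff n B : ℝ) : ℂ) * z ^ n)
        = ∑' n : ℕ, ((PowerSeries.coeff n (A * B) : ℝ) : ℂ) * z ^ n := by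
  have e : ∀ n : ℕ, ((PowerSeries.coeff n (A * B) : ℝ) : ℂ) * z ^ n
      = ∑ q ∈ Finset.HasAntidiagonal.antidiagonal n, (((PowerSeries.coeff q.1 A : ℝ) : ℂ) * z ^ q.1)
        * (((PowerSeries.coeff q.2 B : ℝ) : ℂ) * z ^ q.2) := by
    intro n
    rw [PowerSeries.coeff_mul]
    push_cast
    rw [Finset.sum_mul]
    refine Finset.sum_congr rfl fun q hq => ?_
    rw [← Finset.HasAntidiagonal.mem_antidiagonal.1 hq, pow_add]
    ring
  simp only [e]
  have h1 := summable_norm_sum_mul_antidiagonal_of_summable_norm hA hB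
  have h2 := tsum_mul_tsum_eq_tsum_sum_antidiagonal_of_summable_norm hA hB
  exact ⟨h1, h2⟩

/-- If `A D = exp (∑ pₙ zⁿ / n)` with `pₙ` bounded, then `A` does not converge beyond the modulus
of a zero of `D` in the open unit disk. -/
theorem radius_le_of_isZeroOf {A D : PowerSeries ℝ} {p : ℕ → ℝ} {K : ℝ}
    (hp : ∀ n, n ≠ 0 → |p n| ≤ K) (hAD : A * D = expSeries p) {z : ℂ} (hz : ‖z‖ < 1)
    (hD : IsZeroOf D z) : radius A ≤ ENNReal.ofReal ‖z‖ := by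
  by_contra hlt
  have sA := summable_of_lt_radius A (not_le.1 hlt)
  have sD : Summable fun n : ℕ => ‖((PowerSeries.coeff n D : ℝ) : ℂ) * z ^ n‖ :=
    hD.summable.norm
  -- The inverse of `expSeries p` has the bounded data `-p`, so it converges in the unit disk.
  have sQ := summable_expSeries (fun n => -p n) K (fun n hn => by simpa using hp n hn) hz
  obtain ⟨sAD, tAD⟩ := summable_mul_and_tsum_mul A D sA sD
  obtain ⟨-, t⟩ := summable_mul_and_tsum_mul (A * D) _ sAD sQ
  have h1 : A * D * expSeries (fun n => -p n) = 1 := by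
    rw [hAD, expSeries_mul]
    simpa using expSeries_zero
  have h2 : ∑' n : ℕ, ((PowerSeries.coeff n (1 : PowerSeries ℝ) : ℝ) : ℂ) * z ^ n = 1 := by
    rw [tsum_eq_single 0 fun n hn => by rw [PowerSeries.coeff_one, if_neg hn]; simp]
    simp
  -- The factor `D(z) = 0` makes the left side vanish, while the formal product is `1`.
  rw [← tAD, HasSum.tsum_eq hD, h1, h2] at t
  simp at t


/-! ### Traces of endomorphisms of finite rank -/

section FiniteRank

variable {V : Type*} [AddCommGroup V] [Module ℝ V]

/-- `φ` has finite rank and trace `t`. -/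
def HasFinRankTrace (φ : Module.End ℝ V) (t : ℝ) : Prop :=
  FiniteDimensional ℝ (LinearMap.range φ) ∧ finRankTrace φ = t

/-- The two sides are the traces of the two compositions of the inclusion `range φ → W` with `φ : W
→ range φ`. The freedom to choose `W` yields additivity: two maps of finite rank share a common `W`.
-/
theorem finRankTrace_eq_trace_restrict {φ : Module.End ℝ V} {W : Submodule ℝ V}
    [FiniteDimensional ℝ W] (h : ∀ x, φ x ∈ W) :
    finRankTrace φ = LinearMap.trace ℝ W (φ.restrict (p := W) (q := W) fun x _ => h x) := by
  have hle : LinearMap.range φ ≤ W := by rintro _ ⟨x, rfl⟩; exact h x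
  have : FiniteDimensional ℝ (LinearMap.range φ) := Submodule.finiteDimensional_of_le hle
  exact LinearMap.trace_comp_comm' (Submodule.inclusion hle) (φ.rangeRestrict.comp W.subtype)

/-- The trace of an endomorphism that factors through a space of finite dimension. -/
theorem hasFinRankTrace_comp {U : Type*} [AddCommGroup U] [Module ℝ U] [FiniteDimensional ℝ U]
    (a : U →ₗ[ℝ] V) (b : V →ₗ[ℝ] U) :
    HasFinRankTrace (a ∘ₗ b) (LinearMap.trace ℝ U (b ∘ₗ a)) := by
  have hle : LinearMap.range (a ∘ₗ b) ≤ LinearMap.range a := LinearMap.range_comp_le_range b a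
  refine ⟨Submodule.finiteDimensional_of_le hle, ?_⟩
  rw [finRankTrace_eq_trace_restrict (W := LinearMap.range a) fun x => ⟨b x, rfl⟩]
  exact LinearMap.trace_comp_comm' (b.comp (LinearMap.range a).subtype) a.rangeRestrict

theorem HasFinRankTrace.add {φ ψ : Module.End ℝ V} {s t : ℝ} (hφ : HasFinRankTrace φ s)
    (hψ : HasFinRankTrace ψ t) : HasFinRankTrace (φ + ψ) (s + t) := by
  obtain ⟨h1, rfl⟩ := hφ
  obtain ⟨h2, rfl⟩ := hψ
  let W := LinearMap.range φ ⊔ LinearMap.range ψ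
  have m1 : ∀ x, φ x ∈ W := fun x => Submodule.mem_sup_left ⟨x, rfl⟩
  have m2 : ∀ x, ψ x ∈ W := fun x => Submodule.mem_sup_right ⟨x, rfl⟩
  have m3 : ∀ x, (φ + ψ) x ∈ W := fun x => W.add_mem (m1 x) (m2 x)
  have hle : LinearMap.range (φ + ψ) ≤ W := by rintro _ ⟨x, rfl⟩; exact m3 x
  refine ⟨Submodule.finiteDimensional_of_le hle, ?_⟩
  rw [finRankTrace_eq_trace_restrict m1, finRankTrace_eq_trace_restrict m2,
    finRankTrace_eq_trace_restrict m3, ← map_add]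
  rfl

theorem hasFinRankTrace_zero : HasFinRankTrace (0 : Module.End ℝ V) 0 := by
  simpa using hasFinRankTrace_comp (0 : PUnit →ₗ[ℝ] V) (0 : V →ₗ[ℝ] PUnit)

theorem hasFinRankTrace_smulRight (l : V →ₗ[ℝ] ℝ) (u : V) :
    HasFinRankTrace (l.smulRight u) (l u) := by
  convert! hasFinRankTrace_comp (LinearMap.toSpanSingleton ℝ V u) l using 1
  rw [LinearMap.trace_eq_matrix_trace ℝ (Module.Basis.singleton Unit ℝ)]
  simp [Matrix.trace, LinearMap.toMatrix_apply]

theorem HasFinRankTrace.neg {φ : Module.End ℝ V} {s : ℝ} (hφ : HasFinRankTrace φ s) :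
    HasFinRankTrace (-φ) (-s) := by
  obtain ⟨h1, rfl⟩ := hφ
  have m1 : ∀ x, (-φ) x ∈ LinearMap.range φ := fun x => ⟨-x, by simp⟩
  have hle : LinearMap.range (-φ) ≤ LinearMap.range φ := by rintro _ ⟨x, rfl⟩; exact m1 x
  refine ⟨Submodule.finiteDimensional_of_le hle, ?_⟩
  rw [finRankTrace_eq_trace_restrict m1, finRankTrace, ← map_neg]
  rfl

theorem HasFinRankTrace.sub {φ ψ : Module.End ℝ V} {s t : ℝ} (hφ : HasFinRankTrace φ s)
    (hψ : HasFinRankTrace ψ t) : HasFinRankTrace (φ - ψ) (s - t) := by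
  simpa only [sub_eq_add_neg] using hφ.add hψ.neg

theorem HasFinRankTrace.sum {ι : Type*} (s : Finset ι) {φ : ι → Module.End ℝ V} {t : ι → ℝ}
    (h : ∀ i ∈ s, HasFinRankTrace (φ i) (t i)) :
    HasFinRankTrace (∑ i ∈ s, φ i) (∑ i ∈ s, t i) := by
  classical
  induction s using Finset.induction_on with
  | empty => simpa using hasFinRankTrace_zero
  | insert i s hi ih =>
    rw [Finset.sum_insert hi, Finset.sum_insert hi]
    exact (h i (Finset.mem_insert_self _ _)).add
      (ih fun j hj => h j (Finset.mem_insert_of_mem hj))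

/-! ### Traces of pairs -/

variable {V₀ V₁ : Submodule ℝ V}

/-- Two extensions of the same endomorphism of `V₀` differ by an endomorphism of finite rank, with
trace the difference of the traces on the quotient. -/
theorem IsExtensionOf.hasFinRankTrace_sub [FiniteDimensional ℝ (V ⧸ V₀)] {φ : Module.End ℝ V₀}
    {φbar φbar' : Module.End ℝ V} {φtil φtil' : Module.End ℝ (V ⧸ V₀)}
    (h : IsExtensionOf φ φbar φtil) (h' : IsExtensionOf φ φbar' φtil') :
    HasFinRankTrace (φbar' - φbar) (LinearMap.trace ℝ _ φtil' - LinearMap.trace ℝ _ φtil) := by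
  have hk : V₀ ≤ LinearMap.ker (φbar' - φbar) := fun v hv => by
    simp [h.1 ⟨v, hv⟩, h'.1 ⟨v, hv⟩]
  -- The difference vanishes on `V₀`, so it factors through `V ⧸ V₀`; composing the factors in the
  -- other order gives `φtil' - φtil`.
  have e1 : (V₀.liftQ (φbar' - φbar) hk) ∘ₗ V₀.mkQ = φbar' - φbar := V₀.liftQ_mkQ _ hk
  have e2 : V₀.mkQ ∘ₗ (V₀.liftQ (φbar' - φbar) hk) = φtil' - φtil := by
    refine Submodule.linearMap_qext _ (LinearMap.ext fun v => ?_)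
    simp only [LinearMap.comp_apply, LinearMap.sub_apply, h.2, h'.2]
    simp
  have := hasFinRankTrace_comp (V₀.liftQ (φbar' - φbar) hk) V₀.mkQ
  rwa [e1, e2, map_sub] at this

/-- Write `β₁ - β₀ = (α₁ - α₀) + (β₁ - α₁) - (β₀ - α₀)`. The traces of the last two differences are
exactly compensated by the traces on the quotients. -/
theorem IsPairTrace.unique [FiniteDimensional ℝ (V ⧸ V₀)] [FiniteDimensional ℝ (V ⧸ V₁)]
    {φ₀ : Module.End ℝ V₀} {φ₁ : Module.End ℝ V₁} {s t : ℝ} (hs : IsPairTrace φ₀ φ₁ s)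
    (ht : IsPairTrace φ₀ φ₁ t) : s = t := by
  obtain ⟨α₀, α₁, a₀, a₁, hα₀, hα₁, hf, rfl⟩ := hs
  obtain ⟨β₀, β₁, b₀, b₁, hβ₀, hβ₁, -, rfl⟩ := ht
  have h := (HasFinRankTrace.add ⟨hf, rfl⟩ (hα₁.hasFinRankTrace_sub hβ₁)).sub
    (hα₀.hasFinRankTrace_sub hβ₀)
  have e : α₁ - α₀ + (β₁ - α₁) - (β₀ - α₀) = β₁ - β₀ := by abel
  rw [e] at h
  rw [h.2]
  ring

theorem pairTrace_eq [FiniteDimensional ℝ (V ⧸ V₀)] [FiniteDimensional ℝ (V ⧸ V₁)]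
    {φ₀ : Module.End ℝ V₀} {φ₁ : Module.End ℝ V₁} {t : ℝ} (ht : IsPairTrace φ₀ φ₁ t) :
    pairTrace φ₀ φ₁ = t := by
  have h : ∃ t, IsPairTrace φ₀ φ₁ t := ⟨t, ht⟩
  rw [pairTrace, dif_pos h]
  exact h.choose_spec.unique ht

theorem linearEquiv_conj_pow {W : Type*} [AddCommGroup W] [Module ℝ W] (e : V ≃ₗ[ℝ] W)
    (φ : Module.End ℝ V) (n : ℕ) : e.conj φ ^ n = e.conj (φ ^ n) := by
  induction n with
  | zero => exact (LinearMap.ext fun w => by simp [LinearEquiv.conj_apply])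
  | succ n ih =>
    rw [pow_succ, pow_succ, Module.End.mul_eq_comp, Module.End.mul_eq_comp, LinearEquiv.conj_comp,
      ih]

/-- The trace of a pair whose first member is defined on the whole space, computed by means of a
retraction onto the domain of the second one. -/
theorem pairTrace_topEquiv_conj [FiniteDimensional ℝ (V ⧸ V₁)] (φ : Module.End ℝ V)
    (E : Module.End ℝ V₁) (r : V →ₗ[ℝ] V₁) (hr : ∀ v : V₁, r v = v) (n : ℕ) {t : ℝ}
    (h : HasFinRankTrace (V₁.subtype ∘ₗ (E ^ n) ∘ₗ r - φ ^ n) t) :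
    pairTrace ((Submodule.topEquiv (R := ℝ) (M := V)).symm.conj φ ^ n) (E ^ n) = t := by
  have hpow := linearEquiv_conj_pow (Submodule.topEquiv (R := ℝ) (M := V)).symm φ n
  rw [hpow]
  -- The quotient by the whole space is zero, and the extension through `r` has values in `V₁`, so
  -- it induces zero on `V ⧸ V₁`: no quotient contributes to the trace.
  refine pairTrace_eq ⟨φ ^ n, _, 0, 0, ⟨fun v => rfl, fun v => ?_⟩, ⟨fun v => ?_, fun v => ?_⟩,
    h.1, ?_⟩
  · exact Subsingleton.elim _ _
  · simp [hr]
  · exact ((Submodule.Quotient.mk_eq_zero V₁).2 (Subtype.prop _)).symm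
  · rw [h.2]
    simp

end FiniteRank


/-! ### Monotone functions on open intervals -/

theorem _root_.StrictMonoOn.image_Ioo_of_tendsto {f : ℝ → ℝ} {x y p q : ℝ} (hxy : x < y)
    (hf : StrictMonoOn f (Ioo x y)) (hc : ContinuousOn f (Ioo x y))
    (hp : Filter.Tendsto f (𝓝[>] x) (𝓝 p)) (hq : Filter.Tendsto f (𝓝[<] y) (𝓝 q)) :
    p < q ∧ f '' Ioo x y = Ioo p q := by
  have hpl : ∀ s ∈ Ioo x y, p < f s := by
    intro s hs
    obtain ⟨u, hu⟩ := nonempty_Ioo.2 hs.1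
    have hu' : u ∈ Ioo x y := ⟨hu.1, hu.2.trans hs.2⟩
    refine lt_of_le_of_lt (le_of_tendsto hp ?_) (hf hu' hs hu.2)
    filter_upwards [Ioo_mem_nhdsGT hu.1] with z hz
    exact (hf ⟨hz.1, hz.2.trans hu'.2⟩ hu' hz.2).le
  have hql : ∀ s ∈ Ioo x y, f s < q := by
    intro s hs
    obtain ⟨u, hu⟩ := nonempty_Ioo.2 hs.2
    have hu' : u ∈ Ioo x y := ⟨hs.1.trans hu.1, hu.2⟩
    refine lt_of_lt_of_le (hf hs hu' hu.1) (ge_of_tendsto hq ?_)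
    filter_upwards [Ioo_mem_nhdsLT hu.2] with z hz
    exact (hf hu' ⟨hu'.1.trans hz.1, hz.2⟩ hz.1).le
  obtain ⟨m, hm⟩ := nonempty_Ioo.2 hxy
  refine ⟨(hpl m hm).trans (hql m hm), Subset.antisymm ?_ fun v hv => ?_⟩
  · rintro _ ⟨s, hs, rfl⟩
    exact ⟨hpl s hs, hql s hs⟩
  · obtain ⟨s, hsv, hs⟩ :=
      ((hp.eventually (gt_mem_nhds hv.1)).and (Ioo_mem_nhdsGT hxy)).exists
    obtain ⟨t, htv, ht⟩ :=
      ((hq.eventually (lt_mem_nhds hv.2)).and (Ioo_mem_nhdsLT hxy)).exists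
    exact isPreconnected_Ioo.intermediate_value hs ht hc ⟨hsv.le, htv.le⟩

theorem _root_.StrictAntiOn.image_Ioo_of_tendsto {f : ℝ → ℝ} {x y p q : ℝ} (hxy : x < y)
    (hf : StrictAntiOn f (Ioo x y)) (hc : ContinuousOn f (Ioo x y))
    (hp : Filter.Tendsto f (𝓝[>] x) (𝓝 p)) (hq : Filter.Tendsto f (𝓝[<] y) (𝓝 q)) :
    q < p ∧ f '' Ioo x y = Ioo q p := by
  obtain ⟨h1, h2⟩ := StrictMonoOn.image_Ioo_of_tendsto (f := fun s => -f s) hxy hf.neg hc.neg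
    hp.neg hq.neg
  refine ⟨neg_lt_neg_iff.1 h1, ?_⟩
  have : f '' Ioo x y = Neg.neg '' ((fun s => -f s) '' Ioo x y) := by
    rw [image_image]; simp
  rw [this, h2]
  simp

/-- An induction principle for intervals cut by a finite set. -/
theorem interval_induction {S : Set ℝ} (hS : S.Finite) {P : ℝ → ℝ → Prop}
    (base : ∀ x y, x < y → (∀ z ∈ Ioo x y, z ∉ S) → P x y)
    (step : ∀ x c y, x < c → c < y → c ∈ S → P x c → P c y → P x y) {x y : ℝ} (hxy : x < y) :
    P x y := by
  have key : ∀ (n : ℕ) (x y : ℝ), x < y → (S ∩ Ioo x y).ncard ≤ n → P x y := by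
    intro n
    induction n with
    | zero =>
      intro x y hxy hn
      refine base x y hxy fun z hz hzS => ?_
      rw [Nat.le_zero, ncard_eq_zero (hS.inter_of_left _)] at hn
      exact (hn ▸ (⟨hzS, hz⟩ : z ∈ S ∩ Ioo x y) : z ∈ (∅ : Set ℝ))
    | succ n ih =>
      intro x y hxy hn
      by_cases hc : ∃ c ∈ S, c ∈ Ioo x y
      · obtain ⟨c, hcS, hc⟩ := hc
        have lt : ∀ I ⊆ Ioo x y, c ∉ I → (S ∩ I).ncard ≤ n := fun I hI hcI =>
          Nat.le_of_lt_succ (lt_of_lt_of_le (ncard_lt_ncard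
            ⟨inter_subset_inter_right _ hI, fun H => hcI (H ⟨hcS, hc⟩).2⟩
            (hS.inter_of_left _)) hn)
        exact step x c y hc.1 hc.2 hcS
          (ih _ _ hc.1 (lt _ (Ioo_subset_Ioo_right hc.2.le) fun h => lt_irrefl _ h.2))
          (ih _ _ hc.2 (lt _ (Ioo_subset_Ioo_left hc.1.le) fun h => lt_irrefl _ h.1))
      · exact base x y hxy fun z hz hzS => hc ⟨z, hzS, hz⟩
  exact key _ x y hxy le_rfl

namespace PMMap

variable {F : PMMap}

/-! ### The components of the domain -/

theorem Icc_subset_Ω (i : Fin F.m) : Icc (F.a i) (F.b i) ⊆ F.Ω :=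
  subset_iUnion (fun i => Icc (F.a i) (F.b i)) i

theorem eq_of_mem_Icc {i j : Fin F.m} {x : ℝ} (hi : x ∈ Icc (F.a i) (F.b i))
    (hj : x ∈ Icc (F.a j) (F.b j)) : i = j := by
  rcases lt_trichotomy i j with h | h | h
  · exact absurd (F.b_lt_a i j h) (not_lt.2 (hj.1.trans hi.2))
  · exact h
  · exact absurd (F.b_lt_a j i h) (not_lt.2 (hi.1.trans hj.2))

theorem subset_Icc_of_isPreconnected {K : Set ℝ} (hK : IsPreconnected K) (hKΩ : K ⊆ F.Ω)
    {i : Fin F.m} {x : ℝ} (hx : x ∈ K) (hi : x ∈ Icc (F.a i) (F.b i)) :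
    K ⊆ Icc (F.a i) (F.b i) := by
  have hO : IsClosed (⋃ j ∈ {j : Fin F.m | j ≠ i}, Icc (F.a j) (F.b j)) :=
    (toFinite _).isClosed_biUnion fun _ _ => isClosed_Icc
  refine (isPreconnected_iff_subset_of_disjoint_closed.1 hK _ _ isClosed_Icc hO ?_ ?_).resolve_right
    fun H => ?_
  · intro y hy
    obtain ⟨j, hj⟩ := mem_iUnion.1 (hKΩ hy)
    by_cases h : j = i
    · exact Or.inl (h ▸ hj)
    · exact Or.inr (mem_biUnion (show j ∈ {j | j ≠ i} from h) hj)
  · rw [eq_empty_iff_forall_notMem]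
    rintro y ⟨-, hy, hy'⟩
    obtain ⟨j, hj, hyj⟩ := mem_iUnion₂.1 hy'
    exact hj (eq_of_mem_Icc hyj hy)
  · obtain ⟨j, hj, hyj⟩ := mem_iUnion₂.1 (H hx)
    exact hj (eq_of_mem_Icc hyj hi)

/-! ### Iterates -/

variable (F) in
/-- The set of all points of `Ω` where the `n`-th iterate of `F` is not defined. -/
def iterC : ℕ → Set ℝ
  | 0 => ∅
  | n + 1 => {x | x ∈ F.Ω ∧ (x ∈ F.C ∨ F.toFun x ∈ iterC n)}

theorem C_subset_iterC (n : ℕ) : (F.C : Set ℝ) ⊆ F.iterC (n + 1) :=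
  fun _ hx => ⟨F.C_subset hx, Or.inl hx⟩

/-- Between consecutive points of `C` the map is injective, so each piece contains at most one
preimage. This keeps the sets `iterC n` finite. -/
theorem finite_fiber (p : ℝ) : {s | s ∈ F.Ω ∧ s ∉ F.C ∧ F.toFun s = p}.Finite := by
  have key : ∀ i : Fin F.m,
      {s | s ∈ Ioo (F.a i) (F.b i) ∧ s ∉ F.C ∧ F.toFun s = p}.Finite := by
    intro i
    refine interval_induction (S := F.C) (P := fun x y => Icc x y ⊆ F.Ω →
      {s | s ∈ Ioo x y ∧ s ∉ F.C ∧ F.toFun s = p}.Finite) F.C.finite_toSet ?_ ?_ (F.a_lt_b i)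
      (Icc_subset_Ω i)
    · intro x y hxy hz hI
      have hm : F.IsMonoInterval x y := ⟨hxy, fun z hzI => ⟨hI (Ioo_subset_Icc_self hzI), hz z hzI⟩⟩
      have hinj : InjOn F.toFun (Ioo x y) := hm.monotoneOn.elim (·.injOn) (·.injOn)
      exact Set.Subsingleton.finite fun s hs t ht =>
        hinj hs.1 ht.1 (hs.2.2.trans ht.2.2.symm)
    · intro x c y hxc hcy hc h1 h2 hI
      refine ((h1 fun z hz => hI ⟨hz.1, hz.2.trans hcy.le⟩).union
        (h2 fun z hz => hI ⟨hxc.le.trans hz.1, hz.2⟩)).subset ?_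
      rintro s ⟨hs, hsC, hsp⟩
      rcases lt_trichotomy s c with h | h | h
      · exact Or.inl ⟨⟨hs.1, h⟩, hsC, hsp⟩
      · exact absurd hc (h ▸ hsC)
      · exact Or.inr ⟨⟨h, hs.2⟩, hsC, hsp⟩
  refine (finite_iUnion key).subset ?_
  rintro s ⟨hs, hsC, hsp⟩
  obtain ⟨i, hi⟩ := mem_iUnion.1 hs
  exact mem_iUnion.2 ⟨i, ⟨lt_of_le_of_ne hi.1 fun h => hsC (h ▸ F.a_mem_C i),
    lt_of_le_of_ne hi.2 fun h => hsC (h ▸ F.b_mem_C i)⟩, hsC, hsp⟩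

theorem finite_iterC (n : ℕ) : (F.iterC n).Finite := by
  induction n with
  | zero => exact finite_empty
  | succ n ih =>
    refine (F.C.finite_toSet.union (ih.biUnion fun p _ => finite_fiber (F := F) p)).subset ?_
    rintro x ⟨hx, hxC | hxC⟩
    · exact Or.inl hxC
    · by_cases h : x ∈ F.C
      · exact Or.inl h
      · exact Or.inr (mem_biUnion hxC ⟨hx, h, rfl⟩)

theorem iterate_mem_Ω {n : ℕ} {x : ℝ} (hx : x ∈ F.Ω) (hC : x ∉ F.iterC n) :
    F.toFun^[n] x ∈ F.Ω := by
  induction n generalizing x with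
  | zero => exact hx
  | succ n ih =>
    have h1 : x ∉ F.C := fun h => hC ⟨hx, Or.inl h⟩
    exact ih (F.mapsTo x ⟨hx, h1⟩) fun h => hC ⟨hx, Or.inr h⟩

open Classical in
theorem eps_eq_epsInterval {x y s : ℝ} (h : F.IsMonoInterval x y) (hs : s ∈ Ioo x y) :
    F.eps s = F.epsInterval x y := by
  have e : (∃ U ∈ 𝓝 s, StrictMonoOn F.toFun U) ↔ StrictMonoOn F.toFun (Ioo x y) := by
    refine ⟨fun ⟨U, hU, H⟩ => ?_, fun H => ⟨_, Ioo_mem_nhds hs.1 hs.2, H⟩⟩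
    obtain ⟨p, q, hpq, hpU⟩ := mem_nhds_iff_exists_Ioo_subset.1
      (Filter.inter_mem hU (Ioo_mem_nhds hs.1 hs.2))
    exact (h.strictMonoOn_iff (hpq.1.trans hpq.2) fun z hz => (hpU hz).2).1
      (H.mono fun z hz => (hpU hz).1)
  have hC : s ∉ F.C := (h.2 hs).2
  rw [eps, epsInterval, if_neg hC]
  exact if_congr e rfl rfl

theorem pt_eq_single {x : ℝ} (hx : x ∈ F.Ω) : F.pt x = Finsupp.single ⟨x, hx⟩ 1 := by
  simp [pt, hx]

theorem epsSharpZero_pt {x : ℝ} (hx : x ∈ F.Ω) (hC : x ∉ F.C) :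
    F.epsSharpZero (F.pt x) = F.eps x • F.pt (F.toFun x) := by
  simp [pt_eq_single hx, epsSharpZero, sharpZero, hC]

theorem epsSharpZero_pt_of_mem {x : ℝ} (hC : x ∈ F.C) :
    F.epsSharpZero (F.pt x) = 0 := by
  simp [pt_eq_single (F.C_subset hC : x ∈ F.Ω), epsSharpZero, sharpZero, hC]

/-- The orbit of `x` meets `C` before step `n`, and there `ε F_{#0}` vanishes. -/
theorem epsSharpZero_pow_pt_of_mem {n : ℕ} {x : ℝ} (hx : x ∈ F.iterC n) :
    (F.epsSharpZero ^ n) (F.pt x) = 0 := by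
  induction n generalizing x with
  | zero => exact absurd hx (notMem_empty x)
  | succ n ih =>
    rw [pow_succ, Module.End.mul_apply]
    by_cases hC : x ∈ F.C
    · rw [epsSharpZero_pt_of_mem hC, map_zero]
    · rw [epsSharpZero_pt hx.1 hC, map_smul, ih (hx.2.resolve_left hC), smul_zero]

theorem epsSharpOne_apply {x y : ℝ} (h : F.IsMonoInterval x y) {v : S1 F.Ω}
    (hv : (v : S0 F.Ω) = F.pt y - F.pt x) : (F.epsSharpOne v : S0 F.Ω) =
      F.epsInterval x y • (F.pt (leftLim F.toFun y) - F.pt (rightLim F.toFun x)) :=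
  F.existsUnique_epsSharpOne.choose_spec.1 x y h v hv

variable (F) in
/-- The `n`-th iterate of `F` is monotone of sign `σ` on `]x, y[`, with one-sided limits `p` at `x`
and `q` at `y`. -/
structure IsBranch (n : ℕ) (x y σ p q : ℝ) : Prop where
  lt : x < y
  sign : (σ = 1 ∧ StrictMonoOn F.toFun^[n] (Ioo x y)) ∨
    (σ = -1 ∧ StrictAntiOn F.toFun^[n] (Ioo x y))
  continuousOn : ContinuousOn F.toFun^[n] (Ioo x y)
  mapsTo : ∀ s ∈ Ioo x y, F.toFun^[n] s ∈ F.Ω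
  tendsto_right : Filter.Tendsto F.toFun^[n] (𝓝[>] x) (𝓝 p)
  tendsto_left : Filter.Tendsto F.toFun^[n] (𝓝[<] y) (𝓝 q)
  zero : ∀ s ∈ Ioo x y, (F.epsSharpZero ^ n) (F.pt s) = σ • F.pt (F.toFun^[n] s)
  one : ∀ v : S1 F.Ω, (v : S0 F.Ω) = F.pt y - F.pt x →
    ((F.epsSharpOne ^ n) v : S0 F.Ω) = σ • (F.pt q - F.pt p)

/-- Induction with `Fⁿ⁺¹ = Fⁿ ∘ F`: `F` maps `]x, y[` onto the open interval between its one-sided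
limits, which is free of points of `iterC n`. A decreasing `F` exchanges the two ends of that
interval and changes the sign. -/
theorem exists_isBranch (n : ℕ) {x y : ℝ} (hxy : x < y) (hI : Ioo x y ⊆ F.Ω)
    (hC : ∀ s ∈ Ioo x y, s ∉ F.iterC n) : ∃ σ p q, F.IsBranch n x y σ p q := by
  induction n generalizing x y with
  | zero =>
    exact ⟨1, x, y, hxy, Or.inl ⟨rfl, strictMonoOn_id⟩, continuousOn_id, fun s hs => hI hs,
      Filter.tendsto_id.mono_left nhdsWithin_le_nhds,
      Filter.tendsto_id.mono_left nhdsWithin_le_nhds,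
      fun s hs => by simp, fun v hv => by simp [hv]⟩
  | succ n ih =>
    have hm : F.IsMonoInterval x y := ⟨hxy, fun s hs =>
      ⟨hI hs, fun h => hC s hs ⟨hI hs, Or.inl h⟩⟩⟩
    have hl := tendsto_leftLim_of_tendsto hm.exists_left.1
    have hr := tendsto_rightLim_of_tendsto hm.exists_left.2
    set q₁ := leftLim F.toFun y with hq₁
    set p₁ := rightLim F.toFun x with hp₁
    have hbad : ∀ s ∈ Ioo x y, F.toFun s ∈ F.Ω ∧ F.toFun s ∉ F.iterC n := fun s hs =>
      ⟨F.mapsTo s (hm.2 hs), fun h => hC s hs ⟨hI hs, Or.inr h⟩⟩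
    have hzero : ∀ s ∈ Ioo x y, (F.epsSharpZero ^ (n + 1)) (F.pt s)
        = F.epsInterval x y • (F.epsSharpZero ^ n) (F.pt (F.toFun s)) := fun s hs => by
      rw [pow_succ, Module.End.mul_apply, epsSharpZero_pt (hm.2 hs).1 (hm.2 hs).2, map_smul,
        eps_eq_epsInterval hm hs]
    rcases hm.monotoneOn with H | H
    · obtain ⟨hlt, himg⟩ := H.image_Ioo_of_tendsto hxy hm.continuousOn hr hl
      have hmem : ∀ s ∈ Ioo x y, F.toFun s ∈ Ioo p₁ q₁ := fun s hs => himg ▸ mem_image_of_mem _ hs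
      have heps : F.epsInterval x y = 1 := if_pos H
      have hsub : ∀ t ∈ Ioo p₁ q₁, t ∈ F.Ω ∧ t ∉ F.iterC n := by
        rw [← himg]; rintro _ ⟨s, hs, rfl⟩; exact hbad s hs
      obtain ⟨σ, p, q, B⟩ := ih hlt (fun t ht => (hsub t ht).1) fun t ht => (hsub t ht).2
      have hr' : Filter.Tendsto F.toFun (𝓝[>] x) (𝓝[>] p₁) :=
        tendsto_nhdsWithin_iff.2 ⟨hr, by
          filter_upwards [Ioo_mem_nhdsGT hxy] with s hs using (hmem s hs).1⟩
      have hl' : Filter.Tendsto F.toFun (𝓝[<] y) (𝓝[<] q₁) :=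
        tendsto_nhdsWithin_iff.2 ⟨hl, by
          filter_upwards [Ioo_mem_nhdsLT hxy] with s hs using (hmem s hs).2⟩
      refine ⟨σ, p, q, hxy, ?_, B.continuousOn.comp hm.continuousOn hmem,
        fun s hs => B.mapsTo _ (hmem s hs), B.tendsto_right.comp hr', B.tendsto_left.comp hl',
        fun s hs => ?_, fun v hv => ?_⟩
      · exact B.sign.imp (fun h => ⟨h.1, h.2.comp H hmem⟩)
          fun h => ⟨h.1, h.2.comp_strictMonoOn H hmem⟩
      · rw [hzero s hs, heps, one_smul, B.zero _ (hmem s hs)]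
        rfl
      · rw [pow_succ, Module.End.mul_apply]
        refine B.one _ ?_
        rw [epsSharpOne_apply hm hv, heps, one_smul]
    · obtain ⟨hlt, himg⟩ := H.image_Ioo_of_tendsto hxy hm.continuousOn hr hl
      have hmem : ∀ s ∈ Ioo x y, F.toFun s ∈ Ioo q₁ p₁ := fun s hs => himg ▸ mem_image_of_mem _ hs
      have heps : F.epsInterval x y = -1 :=
        if_neg fun H' => not_strictMonoOn_and_strictAntiOn hxy H' H
      have hsub : ∀ t ∈ Ioo q₁ p₁, t ∈ F.Ω ∧ t ∉ F.iterC n := by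
        rw [← himg]; rintro _ ⟨s, hs, rfl⟩; exact hbad s hs
      obtain ⟨σ, p, q, B⟩ := ih hlt (fun t ht => (hsub t ht).1) fun t ht => (hsub t ht).2
      have hr' : Filter.Tendsto F.toFun (𝓝[>] x) (𝓝[<] p₁) :=
        tendsto_nhdsWithin_iff.2 ⟨hr, by
          filter_upwards [Ioo_mem_nhdsGT hxy] with s hs using (hmem s hs).2⟩
      have hl' : Filter.Tendsto F.toFun (𝓝[<] y) (𝓝[>] q₁) :=
        tendsto_nhdsWithin_iff.2 ⟨hl, by
          filter_upwards [Ioo_mem_nhdsLT hxy] with s hs using (hmem s hs).1⟩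
      refine ⟨-σ, q, p, hxy, ?_, B.continuousOn.comp hm.continuousOn hmem,
        fun s hs => B.mapsTo _ (hmem s hs), B.tendsto_left.comp hr', B.tendsto_right.comp hl',
        fun s hs => ?_, fun v hv => ?_⟩
      · exact B.sign.symm.imp (fun h => ⟨by rw [h.1, neg_neg], h.2.comp H hmem⟩)
          fun h => ⟨by rw [h.1], h.2.comp_strictAntiOn H hmem⟩
      · rw [hzero s hs, heps, B.zero _ (hmem s hs), smul_smul, neg_one_mul]
        rfl
      -- The sign of `F` cancels the reversal of the ends: `y - x` goes to the positively oriented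
      -- difference `p₁ - q₁`, to which the induction hypothesis applies.
      · rw [pow_succ, Module.End.mul_apply, neg_smul, ← smul_neg, neg_sub]
        refine B.one _ ?_
        rw [epsSharpOne_apply hm hv, heps, neg_one_smul, neg_sub]

namespace IsBranch

variable {n : ℕ} {x y σ p q : ℝ}

theorem right_mem (B : F.IsBranch n x y σ p q) : p ∈ closure (F.toFun^[n] '' Ioo x y) :=
  mem_closure_of_tendsto B.tendsto_right (by
    filter_upwards [Ioo_mem_nhdsGT B.lt] with s hs using mem_image_of_mem _ hs)

theorem left_mem (B : F.IsBranch n x y σ p q) : q ∈ closure (F.toFun^[n] '' Ioo x y) :=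
  mem_closure_of_tendsto B.tendsto_left (by
    filter_upwards [Ioo_mem_nhdsLT B.lt] with s hs using mem_image_of_mem _ hs)

/-- The image of a branch is contained in one component of `Ω`. -/
theorem exists_component (B : F.IsBranch n x y σ p q) : ∃ k : Fin F.m,
    p ∈ Icc (F.a k) (F.b k) ∧ q ∈ Icc (F.a k) (F.b k) ∧
      ∀ s ∈ Ioo x y, F.toFun^[n] s ∈ Icc (F.a k) (F.b k) := by
  obtain ⟨m, hm⟩ := nonempty_Ioo.2 B.lt
  obtain ⟨k, hk⟩ := mem_iUnion.1 (B.mapsTo m hm)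
  have hK : F.toFun^[n] '' Ioo x y ⊆ Icc (F.a k) (F.b k) :=
    subset_Icc_of_isPreconnected (isPreconnected_Ioo.image _ B.continuousOn)
      (by rintro _ ⟨s, hs, rfl⟩; exact B.mapsTo s hs) (mem_image_of_mem _ hm) hk
  have hcl := closure_minimal hK isClosed_Icc
  exact ⟨k, hcl B.right_mem, hcl B.left_mem, fun s hs => hK (mem_image_of_mem _ hs)⟩

theorem sign_unique (B : F.IsBranch n x y σ p q) {x' y' σ' p' q' : ℝ}
    (B' : F.IsBranch n x' y' σ' p' q') (h : Ioo x' y' ⊆ Ioo x y) : σ' = σ := by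
  rcases B.sign with ⟨rfl, H⟩ | ⟨rfl, H⟩ <;> rcases B'.sign with ⟨rfl, H'⟩ | ⟨rfl, H'⟩
  · rfl
  · exact (not_strictMonoOn_and_strictAntiOn B'.lt (H.mono h) H').elim
  · exact (not_strictMonoOn_and_strictAntiOn B'.lt H' (H.mono h)).elim
  · rfl

/-- The image of `s - x`, for `s` in the interior of the branch. -/
theorem one_of_mem (B : F.IsBranch n x y σ p q) (hI : Ioo x y ⊆ F.Ω)
    (hC : ∀ s ∈ Ioo x y, s ∉ F.iterC n) {s : ℝ} (hs : s ∈ Ioo x y) (v : S1 F.Ω)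
    (hv : (v : S0 F.Ω) = F.pt s - F.pt x) :
    ((F.epsSharpOne ^ n) v : S0 F.Ω) = σ • (F.pt (F.toFun^[n] s) - F.pt p) := by
  have hsub : Ioo x s ⊆ Ioo x y := Ioo_subset_Ioo_right hs.2.le
  obtain ⟨σ', p', q', B'⟩ := exists_isBranch n hs.1 (hsub.trans hI) fun t ht => hC t (hsub ht)
  rw [B'.one v hv, B.sign_unique B' hsub, tendsto_nhds_unique B'.tendsto_right B.tendsto_right,
    tendsto_nhds_unique B'.tendsto_left
      ((B.continuousOn.continuousAt (Ioo_mem_nhds hs.1 hs.2)).mono_left nhdsWithin_le_nhds)]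

end IsBranch

end PMMap


theorem exists_int_eq_of_isPreconnected {X : Type*} [TopologicalSpace X] {s : Set X}
    (hs : IsPreconnected s) (hne : s.Nonempty) {f : X → ℝ} (hf : ContinuousOn f s)
    (hi : ∀ x ∈ s, ∃ k : ℤ, f x = k) : ∃ k : ℤ, ∀ x ∈ s, f x = k := by
  obtain ⟨x₀, hx₀⟩ := hne
  obtain ⟨k, hk⟩ := hi x₀ hx₀
  refine ⟨k, fun x hx => ?_⟩
  have : IsDiscrete (range ((↑) : ℤ → ℝ)) :=
    ⟨Int.isClosedEmbedding_coe_real.isEmbedding.toHomeomorph.symm.isEmbedding.discreteTopology⟩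
  rw [← hk]
  exact hs.constant_of_mapsTo this hf
    (fun y hy => let ⟨j, hj⟩ := hi y hy; ⟨j, hj.symm⟩) hx hx₀

namespace PMMap

variable (F : PMMap)

/-! ### A retraction of `S₀` onto `S₁` -/

theorem exists_mem_Icc (x : F.Ω) : ∃ i, (x : ℝ) ∈ Icc (F.a i) (F.b i) := mem_iUnion.1 x.2

theorem a_mem_Ω (i : Fin F.m) : F.a i ∈ F.Ω := Icc_subset_Ω i (left_mem_Icc.2 (F.a_lt_b i).le)

/-- The retraction of `S₀(Ω; ℝ)` onto `S₁(Ω; ℝ)` that maps `x` to `x - a`, where `a` is the left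
endpoint of the component of `x`. -/
def retraction : S0 F.Ω →ₗ[ℝ] S1 F.Ω :=
  Finsupp.linearCombination ℝ fun x : F.Ω =>
    ⟨F.pt x - F.pt (F.a (F.exists_mem_Icc x).choose), pt_sub_pt_mem isPreconnected_Icc
      (Icc_subset_Ω (F.exists_mem_Icc x).choose)
      (left_mem_Icc.2 (F.a_lt_b _).le) (F.exists_mem_Icc x).choose_spec⟩

variable {F}

theorem retraction_pt {i : Fin F.m} {x : ℝ} (hx : x ∈ Icc (F.a i) (F.b i)) :
    (F.retraction (F.pt x) : S0 F.Ω) = F.pt x - F.pt (F.a i) := by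
  have h := (F.exists_mem_Icc ⟨x, Icc_subset_Ω i hx⟩).choose_spec
  rw [pt_eq_single (Icc_subset_Ω i hx)]
  simp only [retraction, Finsupp.linearCombination_single, one_smul]
  rw [eq_of_mem_Icc h hx, pt_eq_single (Icc_subset_Ω i hx)]

theorem IsMonoInterval.exists_component {x y : ℝ} (h : F.IsMonoInterval x y) :
    ∃ i : Fin F.m, x ∈ Icc (F.a i) (F.b i) ∧ y ∈ Icc (F.a i) (F.b i) := by
  have hI := h.Icc_subset
  have hx : x ∈ Icc x y := left_mem_Icc.2 h.1.le
  obtain ⟨i, hi⟩ := mem_iUnion.1 (hI hx)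
  exact ⟨i, hi, subset_Icc_of_isPreconnected isPreconnected_Icc hI hx hi (right_mem_Icc.2 h.1.le)⟩

theorem retraction_apply (v : S1 F.Ω) : F.retraction v = v := by
  have : S1 F.Ω ≤ LinearMap.eqLocus ((S1 F.Ω).subtype ∘ₗ F.retraction) LinearMap.id :=
    S1_le_of_mono _ fun x y h => by
      obtain ⟨i, hx, hy⟩ := h.exists_component
      rw [LinearMap.mem_eqLocus, map_sub]
      simp [retraction_pt hx, retraction_pt hy]
  exact Subtype.ext (this v.2)

/-- Modulo `S₁` every point equals the left endpoint of its component. -/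
instance : FiniteDimensional ℝ (S0 F.Ω ⧸ S1 F.Ω) := by
  have : Submodule.span ℝ (range fun i : Fin F.m => (S1 F.Ω).mkQ (F.pt (F.a i))) = ⊤ := by
    refine eq_top_iff.2 fun v _ => ?_
    obtain ⟨w, rfl⟩ := (S1 F.Ω).mkQ_surjective v
    induction w using Finsupp.induction_linear with
    | zero => rw [map_zero]; exact Submodule.zero_mem _
    | add v w hv hw =>
      rw [map_add]
      exact Submodule.add_mem _ (hv trivial) (hw trivial)
    | single x c =>
      obtain ⟨i, hi⟩ := F.exists_mem_Icc x
      have h : Finsupp.single x c = c • F.pt x := by simp [pt]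
      have hm : F.pt (F.a i) - F.pt x ∈ S1 F.Ω := pt_sub_pt_mem isPreconnected_Icc
        (Icc_subset_Ω i) hi (left_mem_Icc.2 (F.a_lt_b i).le)
      rw [h, map_smul]
      refine Submodule.smul_mem _ _ (Submodule.subset_span ⟨i, ?_⟩)
      exact (Submodule.Quotient.eq _).2 hm
  exact ⟨this ▸ Submodule.fg_span (finite_range _)⟩

variable (F) in
/-- The extension of `(ε F_{#1})ⁿ` to `S₀(Ω; ℝ)` that vanishes at the left endpoints. -/
def extOne (n : ℕ) : Module.End ℝ (S0 F.Ω) :=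
  (S1 F.Ω).subtype ∘ₗ (F.epsSharpOne ^ n) ∘ₗ F.retraction

theorem extOne_pt_left (n : ℕ) (i : Fin F.m) : F.extOne n (F.pt (F.a i)) = 0 := by
  have : F.retraction (F.pt (F.a i)) = 0 := Subtype.ext (by
    rw [retraction_pt (left_mem_Icc.2 (F.a_lt_b i).le), sub_self]; rfl)
  simp [extOne, this]

theorem extOne_sub (n : ℕ) {i : Fin F.m} {x y : ℝ} (hx : x ∈ Icc (F.a i) (F.b i))
    (hy : y ∈ Icc (F.a i) (F.b i)) : ∃ v : S1 F.Ω, (v : S0 F.Ω) = F.pt y - F.pt x ∧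
      F.extOne n (F.pt y) - F.extOne n (F.pt x) = (F.epsSharpOne ^ n) v := by
  refine ⟨F.retraction (F.pt y - F.pt x), ?_, ?_⟩
  · rw [map_sub, Submodule.coe_sub, retraction_pt hx, retraction_pt hy]
    abel
  · rw [← map_sub]
    rfl

open Classical in
variable (F) in
/-- The part of `extOne - (ε F_{#0})ⁿ` that comes from the interval `[x, y]` of the `i`-th
component. -/
def extPart (n : ℕ) (i : Fin F.m) (x y : ℝ) : Module.End ℝ (S0 F.Ω) :=
  Finsupp.linearCombination ℝ fun s : F.Ω => if (s : ℝ) ∈ Icc (F.a i) (F.b i) then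
    F.extOne n (F.pt (max x (min s y))) - F.extOne n (F.pt x)
      - (if x < s ∧ s < y then (F.epsSharpZero ^ n) (F.pt s) else 0) else 0

open Classical in
theorem extPart_pt (n : ℕ) (i : Fin F.m) (x y : ℝ) (s : F.Ω) :
    F.extPart n i x y (Finsupp.single s 1) = if (s : ℝ) ∈ Icc (F.a i) (F.b i) then
    F.extOne n (F.pt (max x (min s y))) - F.extOne n (F.pt x)
      - (if x < s ∧ s < y then (F.epsSharpZero ^ n) (F.pt s) else 0) else 0 := by
  simp [extPart]

/-- The clamped point `max x (min s y)` makes the first difference telescope over adjacent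
intervals. The strict inequalities lose the term of `(ε F_{#0})ⁿ` at `c` itself, which is zero as `c
∈ iterC n`. -/
theorem extPart_add {n : ℕ} (i : Fin F.m) {x c y : ℝ} (hxc : x < c) (hcy : c < y)
    (hc : c ∈ F.iterC n) : F.extPart n i x y = F.extPart n i x c + F.extPart n i c y := by
  refine Finsupp.lhom_ext' fun s => LinearMap.ext_ring ?_
  simp only [LinearMap.comp_apply, Finsupp.lsingle_apply, LinearMap.add_apply, extPart_pt]
  by_cases hs : (s : ℝ) ∈ Icc (F.a i) (F.b i)
  · simp only [if_pos hs]
    rcases lt_trichotomy (s : ℝ) c with h | h | h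
    · rw [min_eq_left h.le, min_eq_left (h.trans hcy).le, max_eq_left h.le]
      simp [h, h.trans hcy, not_lt.2 h.le]
    · rw [h]
      simp [hxc, hcy, hxc.le, hcy.le, epsSharpZero_pow_pt_of_mem hc]
    · rw [min_eq_right h.le, max_eq_right (lt_min h hcy).le, max_eq_right hxc.le,
        max_eq_right (lt_min (hxc.trans h) (hxc.trans hcy)).le]
      simp only [h, hxc.trans h, not_lt.2 h.le, true_and, and_false, if_false, sub_zero]
      abel
  · simp only [if_neg hs, add_zero]

/-- Only the component of a point contributes, and clamping to it changes nothing. Endpoints of `Ω`,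
left out by the strict inequalities, belong to `C` and are killed by every positive power. -/
theorem extOne_sub_epsSharpZero_pow {n : ℕ} (hn : n ≠ 0) :
    F.extOne n - F.epsSharpZero ^ n = ∑ i, F.extPart n i (F.a i) (F.b i) := by
  obtain ⟨n, rfl⟩ := Nat.exists_eq_succ_of_ne_zero hn
  refine Finsupp.lhom_ext' fun s => LinearMap.ext_ring ?_
  simp only [LinearMap.comp_apply, Finsupp.lsingle_apply, LinearMap.sub_apply,
    LinearMap.sum_apply, extPart_pt]
  obtain ⟨i, hi⟩ := F.exists_mem_Icc s
  rw [Finset.sum_eq_single i (fun j _ hj => if_neg fun h => hj (eq_of_mem_Icc h hi))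
    fun h => absurd (Finset.mem_univ i) h, if_pos hi, min_eq_left hi.2, max_eq_right hi.1,
    extOne_pt_left, sub_zero]
  have hs : Finsupp.single s (1 : ℝ) = F.pt s := by simp [pt]
  rw [hs]
  congr 1
  split_ifs with h
  · rfl
  · refine epsSharpZero_pow_pt_of_mem (C_subset_iterC n ?_)
    by_cases ha : F.a i < s
    · have : (s : ℝ) = F.b i := le_antisymm hi.2 (not_lt.1 fun hb => h ⟨ha, hb⟩)
      exact this ▸ F.b_mem_C i
    · have : (s : ℝ) = F.a i := le_antisymm (not_lt.1 ha) hi.1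
      exact this ▸ F.a_mem_C i

/-! ### The trace and the fixed points of negative type -/

variable (F) in
/-- The affine coordinate on the `i`-th component of `Ω`, with values in `[0, 1]`. -/
def coord (i : Fin F.m) (s : ℝ) : ℝ := (s - F.a i) / (F.b i - F.a i)

theorem coord_le {i : Fin F.m} {s t : ℝ} : F.coord i s ≤ F.coord i t ↔ s ≤ t := by
  have h : 0 < F.b i - F.a i := sub_pos.2 (F.a_lt_b i)
  rw [coord, coord, div_le_div_iff_of_pos_right h, sub_le_sub_iff_right]

theorem coord_lt {i : Fin F.m} {s t : ℝ} : F.coord i s < F.coord i t ↔ s < t := by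
  rw [← not_le, coord_le, not_le]

theorem coord_a (i : Fin F.m) : F.coord i (F.a i) = 0 := by simp [coord]

theorem coord_b (i : Fin F.m) : F.coord i (F.b i) = 1 :=
  div_self (sub_ne_zero.2 (F.a_lt_b i).ne')

theorem continuous_coord (i : Fin F.m) : Continuous (F.coord i) := by
  unfold coord; fun_prop

variable (F) in
/-- The fixed points of negative type of the `n`-th iterate of `F` in `]x, y[`. -/
def decFix (n : ℕ) (x y : ℝ) : Set ℝ :=
  {s | s ∈ Ioo x y ∧ s ∉ F.iterC n ∧ F.toFun^[n] s = s ∧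
    ∃ U ∈ 𝓝 s, StrictAntiOn F.toFun^[n] U}

open Classical in
variable (F) in
/-- `h` is a lift to `ℝ` of the `n`-th iterate of `F` on the `i`-th component, followed by the
projection of `Ω` onto the circle that collapses all the other components and the endpoints. -/
structure IsCircleLift (n : ℕ) (i : Fin F.m) (h : ℝ → ℝ) : Prop where
  continuousOn : ContinuousOn h (Icc (F.a i) (F.b i))
  eq : ∀ s ∈ Ioo (F.a i) (F.b i), s ∉ F.iterC n → ∃ k : ℤ,
    h s - (if F.toFun^[n] s ∈ Icc (F.a i) (F.b i) then F.coord i (F.toFun^[n] s) else 0) = k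

theorem not_strictMonoOn_and_strictAntiOn_nhds {f : ℝ → ℝ} {s : ℝ} {U V : Set ℝ} (hU : U ∈ 𝓝 s)
    (hV : V ∈ 𝓝 s) (h : StrictMonoOn f U) (h' : StrictAntiOn f V) : False := by
  obtain ⟨p, q, hpq, hpU⟩ := mem_nhds_iff_exists_Ioo_subset.1 (Filter.inter_mem hU hV)
  exact not_strictMonoOn_and_strictAntiOn (hpq.1.trans hpq.2) (h.mono fun z hz => (hpU hz).1)
    (h'.mono fun z hz => (hpU hz).2)

theorem IsBranch.decFix_eq_empty {n : ℕ} {x y p q : ℝ} (B : F.IsBranch n x y 1 p q) :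
    F.decFix n x y = ∅ := by
  rw [eq_empty_iff_forall_notMem]
  rintro s ⟨hs, -, -, U, hU, hA⟩
  have hm := (B.sign.resolve_right fun h => by norm_num at h).2
  exact not_strictMonoOn_and_strictAntiOn_nhds (Ioo_mem_nhds hs.1 hs.2) hU hm hA

-- The function `Fⁿ(s) - s` decreases strictly from the limit `p - x` to the limit `q - y`, so it
-- has one zero if `x < p` and `q < y`, and none otherwise. As `q - y < p - x`, the inequalities `p
-- ≤ x` and `y ≤ q` exclude each other, whence the difference of indicators.
open Classical in
theorem IsBranch.ncard_decFix {n : ℕ} {x y p q : ℝ} (B : F.IsBranch n x y (-1) p q)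
    (hC : ∀ s ∈ Ioo x y, s ∉ F.iterC n) : (F.decFix n x y).Finite ∧
      ((F.decFix n x y).ncard : ℝ) = (if x < p then 1 else 0) - (if y ≤ q then 1 else 0) := by
  have hA := (B.sign.resolve_left fun h => by norm_num at h).2
  have hg : StrictAntiOn (fun s => F.toFun^[n] s - s) (Ioo x y) := fun s hs t ht hst =>
    sub_lt_sub (hA hs ht hst) hst
  have hgc : ContinuousOn (fun s => F.toFun^[n] s - s) (Ioo x y) :=
    B.continuousOn.sub continuousOn_id
  obtain ⟨hlt, himg⟩ := hg.image_Ioo_of_tendsto B.lt hgc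
    (B.tendsto_right.sub (Filter.tendsto_id.mono_left nhdsWithin_le_nhds))
    (B.tendsto_left.sub (Filter.tendsto_id.mono_left nhdsWithin_le_nhds))
  have hdec : F.decFix n x y = {s | s ∈ Ioo x y ∧ F.toFun^[n] s - s = 0} := by
    ext s
    exact ⟨fun h => ⟨h.1, sub_eq_zero.2 h.2.2.1⟩, fun h => ⟨h.1, hC s h.1, sub_eq_zero.1 h.2,
      _, Ioo_mem_nhds h.1.1 h.1.2, hA⟩⟩
  have hsub : (F.decFix n x y).Subsingleton := by
    rw [hdec]
    exact fun s hs t ht => hg.injOn hs.1 ht.1 (hs.2.trans ht.2.symm)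
  refine ⟨hsub.finite, ?_⟩
  have hiff : (F.decFix n x y).Nonempty ↔ q < y ∧ x < p := by
    have : (0 : ℝ) ∈ Ioo (q - y) (p - x) ↔ q < y ∧ x < p := by
      rw [mem_Ioo, sub_neg, sub_pos]
    rw [← this]
    rw [← himg, hdec]
    exact Iff.rfl
  by_cases h : q < y ∧ x < p
  · obtain ⟨s, hs⟩ := hiff.2 h
    rw [hsub.eq_singleton_of_mem hs, ncard_singleton, if_pos h.2, if_neg (not_le.2 h.1)]
    simp
  · rw [not_nonempty_iff_eq_empty.1 fun H => h (hiff.1 H), ncard_empty]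
    by_cases hp : x < p
    · have : y ≤ q := not_lt.1 fun hq => h ⟨hq, hp⟩
      simp [hp, this]
    · have h1 := (B.lt.trans_le' (not_lt.1 hp))
      have h2 : ¬ y ≤ q := fun hq => by linarith
      simp [hp, h2]

-- In the component, clamping gives `0` for `s ≤ x` and `σ (q - p)` for `s ≥ y`. In between, the
-- term of `(ε F_{#0})ⁿ` cancels the image of `s` and leaves `-σ p`. The result is a difference of
-- two rank-one maps, whose traces are evaluations of functionals.
open Classical in
theorem IsBranch.extPart_eq {n : ℕ} {i : Fin F.m} {x y σ p q : ℝ} (B : F.IsBranch n x y σ p q)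
    (hx : x ∈ Icc (F.a i) (F.b i)) (hy : y ∈ Icc (F.a i) (F.b i))
    (hC : ∀ s ∈ Ioo x y, s ∉ F.iterC n) :
    F.extPart n i x y =
      (Finsupp.linearCombination ℝ fun s : F.Ω =>
        if (s : ℝ) ∈ Icc (F.a i) (F.b i) ∧ y ≤ s then (1 : ℝ) else 0).smulRight (σ • F.pt q)
      - (Finsupp.linearCombination ℝ fun s : F.Ω =>
        if (s : ℝ) ∈ Icc (F.a i) (F.b i) ∧ x < s then (1 : ℝ) else 0).smulRight (σ • F.pt p) := by
  have hI : Ioo x y ⊆ F.Ω := fun z hz => Icc_subset_Ω i ⟨hx.1.trans hz.1.le, hz.2.le.trans hy.2⟩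
  refine Finsupp.lhom_ext' fun s => LinearMap.ext_ring ?_
  simp only [LinearMap.comp_apply, Finsupp.lsingle_apply, LinearMap.sub_apply, extPart_pt,
    LinearMap.smulRight_apply, Finsupp.linearCombination_single, one_smul]
  by_cases hs : (s : ℝ) ∈ Icc (F.a i) (F.b i)
  swap
  · simp [hs]
  simp only [hs, if_true, true_and]
  rcases le_or_gt (s : ℝ) x with h | h
  · rw [min_eq_left (h.trans B.lt.le), max_eq_left h]
    simp [not_lt.2 h, not_le.2 (h.trans_lt B.lt)]
  rcases le_or_gt y (s : ℝ) with h' | h'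
  · obtain ⟨v, hv, hv'⟩ := extOne_sub n hx hy
    rw [min_eq_right h', max_eq_right B.lt.le, hv', B.one v hv]
    simp [not_lt.2 h', h, h', smul_sub]
  · obtain ⟨v, hv, hv'⟩ := extOne_sub n hx hs
    rw [min_eq_left h'.le, max_eq_right h.le, hv', B.one_of_mem hI hC ⟨h, h'⟩ v hv,
      B.zero s ⟨h, h'⟩]
    simp [not_le.2 h', h, h', smul_sub]

open Classical in
theorem IsBranch.hasFinRankTrace_extPart {n : ℕ} {i : Fin F.m} {x y σ p q : ℝ}
    (B : F.IsBranch n x y σ p q) (hx : x ∈ Icc (F.a i) (F.b i)) (hy : y ∈ Icc (F.a i) (F.b i))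
    (hC : ∀ s ∈ Ioo x y, s ∉ F.iterC n) (hp : p ∈ F.Ω) (hq : q ∈ F.Ω) :
    HasFinRankTrace (F.extPart n i x y)
      (σ * (if q ∈ Icc (F.a i) (F.b i) ∧ y ≤ q then 1 else 0)
        - σ * (if p ∈ Icc (F.a i) (F.b i) ∧ x < p then 1 else 0)) := by
  rw [B.extPart_eq hx hy hC]
  convert! (hasFinRankTrace_smulRight _ _).sub (hasFinRankTrace_smulRight _ _) using 2
  · rw [map_smul, pt_eq_single hq, Finsupp.linearCombination_single, one_smul, smul_eq_mul]
  · rw [map_smul, pt_eq_single hp, Finsupp.linearCombination_single, one_smul, smul_eq_mul]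

end PMMap


/-! ### Traces on intervals as rounded rotation numbers -/

namespace PMMap

variable {F : PMMap}

theorem coord_mem {i : Fin F.m} {s : ℝ} (hs : s ∈ Icc (F.a i) (F.b i)) :
    0 ≤ F.coord i s ∧ F.coord i s ≤ 1 := by
  rw [← coord_a i, ← coord_b i, coord_le, coord_le]
  exact hs

-- If the branch has its image in the component `i`, then `h = N + coord ∘ Fⁿ` with a constant
-- integer `N`. The floor at `y` is then `N` or `N - 1` according to whether `y ≤ q`, and the
-- ceiling at `x` is `N + 1` or `N` according to whether `x < p`. If the image lies in another
-- component, `h` is a constant integer `N`; floor and ceiling are `N - 1` and `N`, and both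
-- indicators vanish.
open Classical in
theorem IsBranch.floor_sub_ceil {n : ℕ} {i : Fin F.m} {x y σ p q : ℝ} {h : ℝ → ℝ}
    (B : F.IsBranch n x y σ p q) (hx : x ∈ Icc (F.a i) (F.b i)) (hy : y ∈ Icc (F.a i) (F.b i))
    (hC : ∀ s ∈ Ioo x y, s ∉ F.iterC n) (hh : F.IsCircleLift n i h) :
    (((⌊h y - F.coord i y⌋ + 1 - ⌈h x - F.coord i x⌉ : ℤ)) : ℝ)
      = (if q ∈ Icc (F.a i) (F.b i) ∧ y ≤ q then 1 else 0)
        - (if p ∈ Icc (F.a i) (F.b i) ∧ x < p then 1 else 0) := by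
  obtain ⟨k, hpk, hqk, hk⟩ := B.exists_component
  have hxr : Filter.Tendsto h (𝓝[>] x) (𝓝 (h x)) := by
    have := (hh.continuousOn x hx).mono (Ioo_subset_Icc_self.trans (Icc_subset_Icc hx.1 hy.2))
    rwa [ContinuousWithinAt, nhdsWithin_Ioo_eq_nhdsGT B.lt] at this
  have hyl : Filter.Tendsto h (𝓝[<] y) (𝓝 (h y)) := by
    have := (hh.continuousOn y hy).mono (Ioo_subset_Icc_self.trans (Icc_subset_Icc hx.1 hy.2))
    rwa [ContinuousWithinAt, nhdsWithin_Ioo_eq_nhdsLT B.lt] at this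
  have hI : Ioo x y ⊆ Ioo (F.a i) (F.b i) := Ioo_subset_Ioo hx.1 hy.2
  have hcx0 := (coord_mem hx).1
  -- The strict bounds at `x` from above and at `y` from below rule out a further jump of ceiling
  -- and floor.
  have hcx1 : F.coord i x < 1 := by rw [← coord_b i, coord_lt]; exact B.lt.trans_le hy.2
  have hcy0 : 0 < F.coord i y := by rw [← coord_a i, coord_lt]; exact hx.1.trans_lt B.lt
  have hcy1 := (coord_mem hy).2
  have hne : (Ioo x y).Nonempty := nonempty_Ioo.2 B.lt
  have hhc : ContinuousOn h (Ioo x y) := hh.continuousOn.mono (hI.trans Ioo_subset_Icc_self)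
  by_cases hki : k = i
  · subst hki
    obtain ⟨N, hN⟩ := exists_int_eq_of_isPreconnected isPreconnected_Ioo hne
      (f := fun s => h s - F.coord k (F.toFun^[n] s))
      (hhc.sub ((continuous_coord k).comp_continuousOn B.continuousOn)) fun s hs => by
        obtain ⟨j, hj⟩ := hh.eq s (hI hs) (hC s hs)
        rw [if_pos (hk s hs)] at hj
        exact ⟨j, hj⟩
    have e : ∀ s ∈ Ioo x y, h s = N + F.coord k (F.toFun^[n] s) := fun s hs => by
      rw [← hN s hs]; ring
    have hxe : h x = N + F.coord k p := by
      refine tendsto_nhds_unique hxr (Filter.Tendsto.congr' ?_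
        ((((continuous_coord k).tendsto p).comp B.tendsto_right).const_add (N : ℝ)))
      filter_upwards [Ioo_mem_nhdsGT B.lt] with s hs using (e s hs).symm
    have hye : h y = N + F.coord k q := by
      refine tendsto_nhds_unique hyl (Filter.Tendsto.congr' ?_
        ((((continuous_coord k).tendsto q).comp B.tendsto_left).const_add (N : ℝ)))
      filter_upwards [Ioo_mem_nhdsLT B.lt] with s hs using (e s hs).symm
    have hp := coord_mem hpk
    have hq := coord_mem hqk
    have hfl : ⌊h y - F.coord k y⌋ = N - 1 + if y ≤ q then 1 else 0 := by
      rw [Int.floor_eq_iff, hye]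
      split_ifs with hyq
      · have := (coord_le (i := k)).2 hyq
        push_cast
        constructor <;> linarith
      · have := (coord_lt (i := k)).2 (not_le.1 hyq)
        push_cast
        constructor <;> linarith
    have hce : ⌈h x - F.coord k x⌉ = N + if x < p then 1 else 0 := by
      rw [Int.ceil_eq_iff, hxe]
      split_ifs with hxp
      · have := (coord_lt (i := k)).2 hxp
        push_cast
        constructor <;> linarith
      · have := (coord_le (i := k)).2 (not_lt.1 hxp)
        push_cast
        constructor <;> linarith
    rw [hfl, hce]
    simp only [hpk, hqk, true_and]
    push_cast
    ring
  · have hni : ∀ z ∈ Icc (F.a k) (F.b k), z ∉ Icc (F.a i) (F.b i) := fun z hz hz' =>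
      hki (eq_of_mem_Icc hz hz')
    obtain ⟨N, hN⟩ := exists_int_eq_of_isPreconnected isPreconnected_Ioo hne hhc fun s hs => by
        obtain ⟨j, hj⟩ := hh.eq s (hI hs) (hC s hs)
        rw [if_neg (hni _ (hk s hs)), sub_zero] at hj
        exact ⟨j, hj⟩
    have hxe : h x = N := by
      refine tendsto_nhds_unique hxr (Filter.Tendsto.congr' ?_ tendsto_const_nhds)
      filter_upwards [Ioo_mem_nhdsGT B.lt] with s hs using (hN s hs).symm
    have hye : h y = N := by
      refine tendsto_nhds_unique hyl (Filter.Tendsto.congr' ?_ tendsto_const_nhds)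
      filter_upwards [Ioo_mem_nhdsLT B.lt] with s hs using (hN s hs).symm
    have hfl : ⌊h y - F.coord i y⌋ = N - 1 := by
      rw [Int.floor_eq_iff, hye]
      push_cast
      constructor <;> linarith
    have hce : ⌈h x - F.coord i x⌉ = N := by
      rw [Int.ceil_eq_iff, hxe]
      constructor <;> linarith
    rw [hfl, hce]
    simp only [hni p hpk, hni q hqk, false_and, if_false]
    push_cast
    ring

theorem IsBranch.decFix_eq_empty_of_notMem {n : ℕ} {i k : Fin F.m} {x y σ p q : ℝ}
    (hx : x ∈ Icc (F.a i) (F.b i)) (hy : y ∈ Icc (F.a i) (F.b i))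
    (B : F.IsBranch n x y σ p q) (hp : p ∈ Icc (F.a k) (F.b k)) (hki : k ≠ i) :
    F.decFix n x y = ∅ := by
  obtain ⟨k', hpk, hqk, hk⟩ := B.exists_component
  obtain rfl := eq_of_mem_Icc hp hpk
  rw [eq_empty_iff_forall_notMem]
  rintro s ⟨hs, -, hfix, -⟩
  have := hk s hs
  rw [hfix] at this
  exact hki (eq_of_mem_Icc this ⟨hx.1.trans hs.1.le, hs.2.le.trans hy.2⟩)

-- Let `d` be the value given by `IsBranch.floor_sub_ceil`. An increasing branch has trace `d` and
-- no decreasing fixed point. A decreasing branch has trace `-d`, which is also the number `N` of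
-- its decreasing fixed points, and `-d = d + 2 N`.
open Classical in
theorem hasFinRankTrace_extPart_of_forall_notMem {n : ℕ} {i : Fin F.m} {x y : ℝ} {h : ℝ → ℝ}
    (hxy : x < y) (hx : x ∈ Icc (F.a i) (F.b i)) (hy : y ∈ Icc (F.a i) (F.b i))
    (hC : ∀ s ∈ Ioo x y, s ∉ F.iterC n) (hh : F.IsCircleLift n i h) :
    (F.decFix n x y).Finite ∧ HasFinRankTrace (F.extPart n i x y)
      ((⌊h y - F.coord i y⌋ + 1 - ⌈h x - F.coord i x⌉ : ℤ) + 2 * ((F.decFix n x y).ncard : ℝ)) := by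
  have hI : Ioo x y ⊆ F.Ω := fun z hz => Icc_subset_Ω i ⟨hx.1.trans hz.1.le, hz.2.le.trans hy.2⟩
  obtain ⟨σ, p, q, B⟩ := exists_isBranch n hxy hI hC
  obtain ⟨k, hp, hq, -⟩ := B.exists_component
  have ht := B.hasFinRankTrace_extPart hx hy hC (Icc_subset_Ω k hp) (Icc_subset_Ω k hq)
  have hf := B.floor_sub_ceil hx hy hC hh
  rw [hf]
  obtain rfl | rfl : σ = 1 ∨ σ = -1 := B.sign.imp (·.1) (·.1)
  · rw [B.decFix_eq_empty]
    simpa using ht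
  · by_cases hki : k = i
    · subst hki
      obtain ⟨h1, h2⟩ := B.ncard_decFix hC
      refine ⟨h1, ?_⟩
      rw [h2]
      convert! ht using 1
      simp only [hp, hq, true_and]
      ring
    · rw [B.decFix_eq_empty_of_notMem hx hy hp hki]
      have hni : ∀ z ∈ Icc (F.a k) (F.b k), z ∉ Icc (F.a i) (F.b i) := fun z hz hz' =>
        hki (eq_of_mem_Icc hz hz')
      simp only [hni p hp, hni q hq, false_and, if_false] at ht ⊢
      simpa using ht

variable (F) in
/-- The points of discontinuity of the `n`-th iterate in `]x, y[` where the lift `h` differs from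
the coordinate by an integer. -/
def cutInt (n : ℕ) (i : Fin F.m) (h : ℝ → ℝ) (x y : ℝ) : Set ℝ :=
  {c | c ∈ Ioo x y ∧ c ∈ F.iterC n ∧ ∃ k : ℤ, h c - F.coord i c = k}

theorem finite_cutInt (n : ℕ) (i : Fin F.m) (h : ℝ → ℝ) (x y : ℝ) :
    (F.cutInt n i h x y).Finite :=
  (finite_iterC n).subset fun _ hc => hc.2.1

open Classical in
theorem ncard_cutInt_add (n : ℕ) (i : Fin F.m) (h : ℝ → ℝ) {x c y : ℝ} (hxc : x < c)
    (hcy : c < y) (hc : c ∈ F.iterC n) : (F.cutInt n i h x y).ncard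
      = (F.cutInt n i h x c).ncard + (F.cutInt n i h c y).ncard
        + if ∃ k : ℤ, h c - F.coord i c = k then 1 else 0 := by
  have hd : Disjoint (F.cutInt n i h x c) (F.cutInt n i h c y) :=
    disjoint_left.2 fun z hz hz' => lt_asymm hz.1.2 hz'.1.1
  rw [← ncard_union_eq hd (finite_cutInt ..) (finite_cutInt ..)]
  have hcn : c ∉ F.cutInt n i h x c ∪ F.cutInt n i h c y := by
    rintro (hz | hz)
    · exact lt_irrefl _ hz.1.2
    · exact lt_irrefl _ hz.1.1
  have hne : ∀ z ∈ F.cutInt n i h x y, z ≠ c → z ∈ F.cutInt n i h x c ∪ F.cutInt n i h c y := by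
    rintro z ⟨hz, hz'⟩ hzc
    rcases lt_or_gt_of_ne hzc with hlt | hlt
    · exact Or.inl ⟨⟨hz.1, hlt⟩, hz'⟩
    · exact Or.inr ⟨⟨hlt, hz.2⟩, hz'⟩
  have hsub : F.cutInt n i h x c ∪ F.cutInt n i h c y ⊆ F.cutInt n i h x y := by
    rintro z (⟨hz, hz'⟩ | ⟨hz, hz'⟩)
    · exact ⟨⟨hz.1, hz.2.trans hcy⟩, hz'⟩
    · exact ⟨⟨hxc.trans hz.1, hz.2⟩, hz'⟩
  split_ifs with hk
  · rw [← ncard_insert_of_notMem hcn ((finite_cutInt ..).union (finite_cutInt ..))]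
    congr 1
    refine Subset.antisymm (fun z hz => ?_) (insert_subset ⟨⟨hxc, hcy⟩, hc, hk⟩ hsub)
    by_cases hzc : z = c
    · exact Or.inl hzc
    · exact Or.inr (hne z hz hzc)
  · rw [add_zero]
    congr 1
    exact Subset.antisymm (fun z hz => hne z hz fun hzc => hk (hzc ▸ hz.2.2)) hsub

theorem decFix_union (n : ℕ) {x c y : ℝ} (hxc : x < c) (hcy : c < y) (hc : c ∈ F.iterC n) :
    F.decFix n x y = F.decFix n x c ∪ F.decFix n c y := by
  ext z
  constructor
  · rintro ⟨hz, hzC, hz'⟩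
    rcases lt_trichotomy z c with h | h | h
    · exact Or.inl ⟨⟨hz.1, h⟩, hzC, hz'⟩
    · exact absurd hc (h ▸ hzC)
    · exact Or.inr ⟨⟨h, hz.2⟩, hzC, hz'⟩
  · rintro (⟨hz, hz'⟩ | ⟨hz, hz'⟩)
    · exact ⟨⟨hz.1, hz.2.trans hcy⟩, hz'⟩
    · exact ⟨⟨hxc.trans hz.1, hz.2⟩, hz'⟩

-- This is the contribution of an interior cut point: the floor comes from the interval on its left,
-- the ceiling from the one on its right.
open Classical in
theorem floor_add_one_sub_ceil (w : ℝ) :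
    ⌊w⌋ + 1 - ⌈w⌉ = if ∃ k : ℤ, w = k then 1 else 0 := by
  split_ifs with h
  · obtain ⟨k, rfl⟩ := h
    simp
  · have : ⌈w⌉ = ⌊w⌋ + 1 := by
      rw [Int.ceil_eq_iff]
      push_cast
      have h1 : (⌊w⌋ : ℝ) ≠ w := fun e => h ⟨_, e.symm⟩
      exact ⟨by linarith [lt_of_le_of_ne (Int.floor_le w) h1], (Int.lt_floor_add_one w).le⟩
    rw [this]
    ring

/-- Floors and ceilings telescope over the cut points, up to a defect of `1` at those where `h -
coord` is an integer; `cutInt` collects exactly these. -/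
theorem hasFinRankTrace_extPart {n : ℕ} {i : Fin F.m} {h : ℝ → ℝ} (hh : F.IsCircleLift n i h)
    {x y : ℝ} (hxy : x < y) (hx : x ∈ Icc (F.a i) (F.b i)) (hy : y ∈ Icc (F.a i) (F.b i)) :
    (F.decFix n x y).Finite ∧ HasFinRankTrace (F.extPart n i x y)
      ((⌊h y - F.coord i y⌋ + 1 - ⌈h x - F.coord i x⌉ : ℤ) + ((F.cutInt n i h x y).ncard : ℝ)
        + 2 * ((F.decFix n x y).ncard : ℝ)) := by
  refine interval_induction (S := F.iterC n) (P := fun x y => x ∈ Icc (F.a i) (F.b i) →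
    y ∈ Icc (F.a i) (F.b i) → (F.decFix n x y).Finite ∧ HasFinRankTrace (F.extPart n i x y)
      ((⌊h y - F.coord i y⌋ + 1 - ⌈h x - F.coord i x⌉ : ℤ) + ((F.cutInt n i h x y).ncard : ℝ)
        + 2 * ((F.decFix n x y).ncard : ℝ))) (finite_iterC n) ?_ ?_ hxy hx hy
  · intro x y hxy hC hx hy
    have : F.cutInt n i h x y = ∅ :=
      eq_empty_iff_forall_notMem.2 fun z hz => hC z hz.1 hz.2.1
    rw [this]
    simpa using hasFinRankTrace_extPart_of_forall_notMem hxy hx hy hC hh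
  · intro x c y hxc hcy hc h1 h2 hx hy
    have hcI : c ∈ Icc (F.a i) (F.b i) := ⟨hx.1.trans hxc.le, hcy.le.trans hy.2⟩
    obtain ⟨f1, t1⟩ := h1 hx hcI
    obtain ⟨f2, t2⟩ := h2 hcI hy
    have hd : Disjoint (F.decFix n x c) (F.decFix n c y) :=
      disjoint_left.2 fun z hz hz' => lt_asymm hz.1.2 hz'.1.1
    rw [decFix_union n hxc hcy hc, extPart_add i hxc hcy hc, ncard_union_eq hd f1 f2,
      ncard_cutInt_add n i h hxc hcy hc]
    refine ⟨f1.union f2, ?_⟩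
    convert! t1.add t2 using 1
    have := congrArg (Int.cast : ℤ → ℝ) (floor_add_one_sub_ceil (h c - F.coord i c))
    push_cast at this ⊢
    rw [← this]
    ring

/-- The traces that define the kneading determinant, in terms of the fixed points of negative type
and of lifts to `ℝ`. -/
theorem pairTrace_eq_sum {n : ℕ} (hn : n ≠ 0) {h : Fin F.m → ℝ → ℝ}
    (hh : ∀ i, F.IsCircleLift n i (h i)) :
    (∀ i, (F.decFix n (F.a i) (F.b i)).Finite) ∧
    pairTrace ((Submodule.topEquiv (R := ℝ) (M := S0 F.Ω)).symm.conj F.epsSharpZero ^ n)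
      (F.epsSharpOne ^ n) = ∑ i, ((⌊h i (F.b i) - 1⌋ + 1 - ⌈h i (F.a i)⌉ : ℤ)
        + ((F.cutInt n i (h i) (F.a i) (F.b i)).ncard : ℝ)
        + 2 * ((F.decFix n (F.a i) (F.b i)).ncard : ℝ)) := by
  have key := fun i => hasFinRankTrace_extPart (hh i) (F.a_lt_b i)
    (left_mem_Icc.2 (F.a_lt_b i).le) (right_mem_Icc.2 (F.a_lt_b i).le)
  refine ⟨fun i => (key i).1, pairTrace_topEquiv_conj _ _ F.retraction retraction_apply n ?_⟩
  have := HasFinRankTrace.sum Finset.univ fun i _ => (key i).2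
  rw [← extOne_sub_epsSharpZero_pow hn] at this
  simp only [coord_a, coord_b, sub_zero] at this
  exact this

end PMMap


/-! ### Singular homology by means of free modules on singular simplices -/

section Singular

open CategoryTheory Limits
open scoped Simplicial

theorem homologyπ_surjective (K : ChainComplex (ModuleCat.{u} ℝ) ℕ) (n : ℕ)
    (h : K.homology n) : ∃ z : K.cycles n, K.homologyπ n z = h :=
  (ModuleCat.epi_iff_surjective (K.homologyπ n)).1 inferInstance h

theorem iCycles_injective (K : ChainComplex (ModuleCat.{u} ℝ) ℕ) (n : ℕ) :
    Injective (K.iCycles n) :=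
  (ModuleCat.mono_iff_injective (K.iCycles n)).1 inferInstance

theorem homologyπ_eq_zero_iff (K : ChainComplex (ModuleCat.{u} ℝ) ℕ) (n : ℕ) (z : K.cycles n) :
    K.homologyπ n z = 0 ↔ ∃ w : K.X (n + 1), K.d (n + 1) n w = K.iCycles n z := by
  have hi : ∀ w : K.X (n + 1), K.iCycles n (K.toCycles (n + 1) n w) = K.d (n + 1) n w := fun w => by
    rw [← K.toCycles_i (n + 1) n]
    rfl
  constructor
  · intro hz
    let S : ShortComplex (ModuleCat.{u} ℝ) :=
      ShortComplex.mk (K.toCycles (n + 1) n) (K.homologyπ n) (K.toCycles_comp_homologyπ (n + 1) n)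
    have hS : S.Exact := S.exact_of_g_is_cokernel
      (K.homologyIsCokernel (n + 1) n (ChainComplex.prev ℕ n))
    obtain ⟨w, hw⟩ := S.moduleCat_exact_iff.1 hS z hz
    exact ⟨w, by rw [← hi]; exact congrArg _ hw⟩
  · rintro ⟨w, hw⟩
    rw [← hi] at hw
    rw [← iCycles_injective K n hw]
    have := K.toCycles_comp_homologyπ (n + 1) n
    exact congrArg (fun φ => φ.hom w) this

variable (G : Type u) [TopologicalSpace G]

/-- The singular simplices of dimension `n`. -/
abbrev Simp (n : ℕ) : Type u := C(stdSimplex ℝ (Fin (n + 1)), G)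

/-- The `i`-th face of the standard simplex. -/
def faceMap (n : ℕ) (i : Fin (n + 2)) :
    C(stdSimplex ℝ (Fin (n + 1)), stdSimplex ℝ (Fin (n + 2))) :=
  ⟨stdSimplex.map i.succAbove, stdSimplex.continuous_map _⟩

variable {G} in
/-- The boundary of a singular chain. -/
def bdry (n : ℕ) : (Simp G (n + 1) →₀ ℝ) →ₗ[ℝ] (Simp G n →₀ ℝ) :=
  Finsupp.linearCombination ℝ fun σ => ∑ i : Fin (n + 2), (-1 : ℝ) ^ (i : ℕ) •
    Finsupp.single (σ.comp (faceMap n i)) 1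

variable {G} in
/-- The chain map induced by `f`. -/
def push (f : C(G, G)) (n : ℕ) : (Simp G n →₀ ℝ) →ₗ[ℝ] (Simp G n →₀ ℝ) :=
  Finsupp.lmapDomain ℝ ℝ fun σ => f.comp σ

variable {G} in
theorem bdry_push (f : C(G, G)) (n : ℕ) (z : Simp G (n + 1) →₀ ℝ) :
    bdry n (push f (n + 1) z) = push f n (bdry n z) := by
  have : bdry n ∘ₗ push f (n + 1) = push f n ∘ₗ bdry n := by
    refine Finsupp.lhom_ext' fun σ => LinearMap.ext_ring ?_
    simp [bdry, push, Finsupp.mapDomain_single, ContinuousMap.comp_assoc]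
  exact congrArg (fun φ => φ z) this

/-- The coefficients. -/
abbrev coeffR : ModuleCat.{u} ℝ := ModuleCat.of ℝ (ULift.{u} ℝ)

/-- The singular chain complex. -/
abbrev chainCx : ChainComplex (ModuleCat.{u} ℝ) ℕ :=
  ((AlgebraicTopology.singularChainComplexFunctor (ModuleCat.{u} ℝ)).obj coeffR).obj (TopCat.of G)

variable {G}

/-- The chain map induced by `f` on the singular chain complex. -/
abbrev chainCxMap (f : C(G, G)) : chainCx G ⟶ chainCx G :=
  ((AlgebraicTopology.singularChainComplexFunctor (ModuleCat.{u} ℝ)).obj coeffR).map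
    (TopCat.ofHom f)

/-- The singular simplices as elements of the singular simplicial set. -/
def simpEquiv (n : ℕ) : (TopCat.toSSet.obj (TopCat.of G)) _⦋n⦌ ≃ Simp G n :=
  TopCat.toSSetObjEquiv (TopCat.of G) (.op ⦋n⦌)

/-- The generator of the singular chain complex given by a singular simplex. -/
def chainGen (n : ℕ) (σ : Simp G n) : (chainCx G).X n :=
  ((TopCat.toSSet.obj (TopCat.of G)).ιChainComplex (R := coeffR) ((simpEquiv n).symm σ)).hom
    (ULift.up 1)

/-- The free module on the singular simplices, as a module of the singular chain complex. -/
def toChainCx (n : ℕ) : (Simp G n →₀ ℝ) →ₗ[ℝ] (chainCx G).X n :=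
  Finsupp.linearCombination ℝ (chainGen n)

theorem toChainCx_single (n : ℕ) (σ : Simp G n) :
    toChainCx n (Finsupp.single σ 1) = chainGen n σ := by
  simp [toChainCx]

/-- The chain module is the coproduct, over the simplices, of copies of the coefficients; its
universal property provides the inverse `ψ`. -/
theorem toChainCx_bijective (n : ℕ) : Bijective (toChainCx (G := G) n) := by
  let ψ : (chainCx G).X n ⟶ ModuleCat.of ℝ (Simp G n →₀ ℝ) :=
    ((TopCat.toSSet.obj (TopCat.of G)).isColimitChainComplexXCofan coeffR n).desc
      (Cofan.mk _ fun x => ModuleCat.ofHom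
        ((Finsupp.lsingle (simpEquiv n x)).comp ULift.moduleEquiv.toLinearMap))
  have hψ : ∀ x, (TopCat.toSSet.obj (TopCat.of G)).ιChainComplex (R := coeffR) x ≫ ψ
      = ModuleCat.ofHom ((Finsupp.lsingle (simpEquiv n x)).comp ULift.moduleEquiv.toLinearMap) :=
    fun x => ((TopCat.toSSet.obj (TopCat.of G)).isColimitChainComplexXCofan coeffR n).fac _ ⟨x⟩
  have h1 : ∀ c, ψ.hom (toChainCx n c) = c := by
    have : ψ.hom ∘ₗ toChainCx n = LinearMap.id := by
      refine Finsupp.lhom_ext' fun σ => LinearMap.ext_ring ?_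
      simp only [LinearMap.comp_apply, Finsupp.lsingle_apply, toChainCx_single, LinearMap.id_apply]
      have := congrArg (fun φ => φ.hom (ULift.up 1)) (hψ ((simpEquiv n).symm σ))
      refine Eq.trans this ?_
      simp
    exact fun c => congrArg (fun φ => φ c) this
  have h2 : ∀ x, toChainCx n (ψ.hom x) = x := by
    have : ψ ≫ ModuleCat.ofHom (toChainCx n) = 𝟙 _ := by
      refine SSet.chainComplex_hom_ext fun x => ?_
      refine (Category.assoc _ _ _).symm.trans
        ((congrArg (· ≫ ModuleCat.ofHom (toChainCx n)) (hψ x)).trans ?_)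
      refine ModuleCat.hom_ext (LinearMap.ext fun r => ?_)
      obtain ⟨r⟩ := r
      simp only [ModuleCat.hom_comp, ModuleCat.hom_ofHom, LinearMap.comp_apply]
      have e : Finsupp.lsingle (R := ℝ) (simpEquiv n x) ((ULift.moduleEquiv (R := ℝ)) (ULift.up.{u} r))
          = r • Finsupp.single (simpEquiv n x) (1 : ℝ) := by simp
      refine (congrArg (toChainCx n) e).trans ?_
      rw [map_smul, toChainCx_single, chainGen, Equiv.symm_apply_apply]
      refine (LinearMap.map_smul ((TopCat.toSSet.obj (TopCat.of G)).ιChainComplex (R := coeffR)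
        x).hom r (ULift.up 1)).symm.trans ?_
      have e' : r • (ULift.up 1 : ULift.{u} ℝ) = ULift.up r := by
        ext; simp
      exact congrArg ((TopCat.toSSet.obj (TopCat.of G)).ιChainComplex (R := coeffR) x).hom e'
    exact fun x => congrArg (fun φ => φ.hom x) this
  exact ⟨LeftInverse.injective h1, fun x => ⟨_, h2 x⟩⟩

theorem d_toChainCx (n : ℕ) (c : Simp G (n + 1) →₀ ℝ) :
    (chainCx G).d (n + 1) n (toChainCx (n + 1) c) = toChainCx n (bdry n c) := by
  have : ((chainCx G).d (n + 1) n).hom ∘ₗ toChainCx (n + 1) = toChainCx n ∘ₗ bdry n := by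
    refine Finsupp.lhom_ext' fun σ => LinearMap.ext_ring ?_
    simp only [LinearMap.comp_apply, Finsupp.lsingle_apply, toChainCx_single]
    have := congrArg (fun φ => φ.hom (ULift.up 1))
      (SSet.ιChainComplex_d (TopCat.toSSet.obj (TopCat.of G)) coeffR ((simpEquiv (n + 1)).symm σ))
    refine Eq.trans this ?_
    simp only [bdry, Finsupp.linearCombination_single, one_smul, map_sum, map_smul,
      toChainCx_single, ModuleCat.hom_sum, LinearMap.sum_apply]
    refine Finset.sum_congr rfl fun i _ => ?_
    rw [ModuleCat.hom_zsmul, LinearMap.smul_apply, ← Int.cast_smul_eq_zsmul ℝ]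
    push_cast
    rfl
  exact congrArg (fun φ => φ c) this

theorem chainCxMap_toChainCx (f : C(G, G)) (n : ℕ) (c : Simp G n →₀ ℝ) :
    (chainCxMap f).f n (toChainCx n c) = toChainCx n (push f n c) := by
  have : ((chainCxMap f).f n).hom ∘ₗ toChainCx n = toChainCx n ∘ₗ push f n := by
    refine Finsupp.lhom_ext' fun σ => LinearMap.ext_ring ?_
    simp only [LinearMap.comp_apply, Finsupp.lsingle_apply, toChainCx_single]
    have := congrArg (fun φ => φ.hom (ULift.up 1))
      (SSet.ι_chainComplexMap_f _ _ (TopCat.toSSet.map (TopCat.ofHom f)) coeffR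
        ((simpEquiv n).symm σ))
    refine Eq.trans this ?_
    rw [push, Finsupp.lmapDomain_apply, Finsupp.mapDomain_single, toChainCx_single]
    rfl
  exact congrArg (fun φ => φ c) this

/-- Homology classes are classes of cycles, up to boundaries. -/
theorem exists_homology_class (n : ℕ) (Z : Submodule ℝ (Simp G n →₀ ℝ))
    (hZ : ∀ c, c ∈ Z ↔ (chainCx G).d n ((ComplexShape.down ℕ).next n) (toChainCx n c) = 0) :
    ∃ κ : Z →ₗ[ℝ] (chainCx G).homology n, Surjective κ ∧
      (∀ z : Z, κ z = 0 ↔ ∃ c : Simp G (n + 1) →₀ ℝ, bdry n c = z) ∧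
      ∀ (f : C(G, G)) (z z' : Z), push f n z = z' →
        homologyMap f n (κ z) = κ z' := by
  let k : ModuleCat.of ℝ Z ⟶ (chainCx G).X n := ModuleCat.ofHom ((toChainCx n).comp Z.subtype)
  have hk : k ≫ (chainCx G).d n ((ComplexShape.down ℕ).next n) = 0 :=
    ModuleCat.hom_ext (LinearMap.ext fun z => (hZ z).1 z.2)
  -- Elements of `Z` lift to cycles of the complex; `κ` is this lift followed by the projection to
  -- homology.
  let l := (chainCx G).liftCycles k _ rfl hk
  have hl : ∀ z : Z, (chainCx G).iCycles n (l z) = toChainCx n z := fun z =>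
    congrArg (fun φ => φ.hom z) ((chainCx G).liftCycles_i k _ rfl hk)
  refine ⟨(l ≫ (chainCx G).homologyπ n).hom, fun h => ?_, fun z => ?_, fun f z z' hz => ?_⟩
  · obtain ⟨x, rfl⟩ := homologyπ_surjective _ n h
    obtain ⟨c, hc⟩ := (toChainCx_bijective n).2 ((chainCx G).iCycles n x)
    have hcZ : c ∈ Z := by
      rw [hZ, hc]
      exact congrArg (fun φ : (chainCx G).cycles n ⟶ _ => φ.hom x)
        ((chainCx G).iCycles_d n ((ComplexShape.down ℕ).next n))
    refine ⟨⟨c, hcZ⟩, ?_⟩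
    have : l ⟨c, hcZ⟩ = x := iCycles_injective _ n ((hl _).trans hc)
    exact congrArg (fun y => (chainCx G).homologyπ n y) this
  · refine (homologyπ_eq_zero_iff (chainCx G) n (l z)).trans ?_
    rw [hl]
    constructor
    · rintro ⟨w, hw⟩
      obtain ⟨c, rfl⟩ := (toChainCx_bijective (n + 1)).2 w
      rw [d_toChainCx] at hw
      exact ⟨c, (toChainCx_bijective n).1 hw⟩
    · rintro ⟨c, hc⟩
      exact ⟨toChainCx (n + 1) c, by rw [d_toChainCx, hc]⟩
  · have h1 : HomologicalComplex.cyclesMap (chainCxMap f) n (l z) = l z' := by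
      refine iCycles_injective _ n ?_
      rw [hl, ← hz, ← chainCxMap_toChainCx, ← hl]
      exact congrArg (fun φ => φ.hom (l z)) (HomologicalComplex.cyclesMap_i (chainCxMap f) n)
    have h2 := congrArg (fun φ => φ.hom (l z))
      (HomologicalComplex.homologyπ_naturality (chainCxMap f) n)
    refine Eq.trans h2 ?_
    exact congrArg (fun y => (chainCx G).homologyπ n y) h1

variable (G) in
/-- The first homology is the quotient of the cycles by the boundaries. -/
theorem exists_homology_class_one : ∃ κ : LinearMap.ker (bdry (G := G) 0) →ₗ[ℝ]
      (chainCx G).homology 1, Surjective κ ∧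
      (∀ z : LinearMap.ker (bdry (G := G) 0), κ z = 0 ↔ ∃ c : Simp G 2 →₀ ℝ, bdry 1 c = z) ∧
      ∀ (f : C(G, G)) (z z' : LinearMap.ker (bdry (G := G) 0)), push f 1 z = z' →
        homologyMap f 1 (κ z) = κ z' := by
  refine exists_homology_class 1 _ fun c => ?_
  have hn : (ComplexShape.down ℕ).next 1 = 0 := ChainComplex.next_nat_succ 0
  rw [hn, d_toChainCx, LinearMap.mem_ker]
  exact ((map_eq_zero_iff _ (toChainCx_bijective 0).1)).symm

variable (G) in
/-- The homology in degree `0` is the quotient of the `0`-chains by the boundaries. -/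
theorem exists_homology_class_zero : ∃ κ : (Simp G 0 →₀ ℝ) →ₗ[ℝ]
      (chainCx G).homology 0, Surjective κ ∧ (∀ c, κ (bdry 0 c) = 0) ∧
      ∀ (f : C(G, G)) (z : Simp G 0 →₀ ℝ), homologyMap f 0 (κ z) = κ (push f 0 z) := by
  -- In degree `0` the outgoing differential is zero, so every chain is a cycle.
  obtain ⟨κ, h1, h2, h3⟩ := exists_homology_class (G := G) 0 ⊤ fun c => by
    simp
  refine ⟨κ ∘ₗ (Submodule.topEquiv (R := ℝ) (M := Simp G 0 →₀ ℝ)).symm.toLinearMap,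
    h1.comp (LinearEquiv.surjective _), fun c => (h2 _).2 ⟨c, rfl⟩, fun f z => h3 f _ _ rfl⟩

end Singular


/-! ### Affine singular simplices and winding numbers -/

section Paths

variable {G : Type u} [TopologicalSpace G]

section Affine

variable {E : Type*} [AddCommGroup E] [Module ℝ E] [TopologicalSpace E] [ContinuousAdd E]
  [ContinuousSMul ℝ E]

theorem continuous_stdSimplex_apply {n : ℕ} (i : Fin n) :
    Continuous fun s : stdSimplex ℝ (Fin n) => s i :=
  (continuous_apply i).comp continuous_subtype_val

/-- The path that is the image of the segment `[p, q]` under `φ`. -/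
def seg (φ : C(E, G)) (p q : E) : Simp G 1 :=
  φ.comp ⟨fun s => s 0 • p + s 1 • q,
    ((continuous_stdSimplex_apply 0).smul continuous_const).add
      ((continuous_stdSimplex_apply 1).smul continuous_const)⟩

/-- The singular simplex that is the image of the triangle `p q r` under `φ`. -/
def tri (φ : C(E, G)) (p q r : E) : Simp G 2 :=
  φ.comp ⟨fun s => s 0 • p + s 1 • q + s 2 • r,
    (((continuous_stdSimplex_apply 0).smul continuous_const).add
      ((continuous_stdSimplex_apply 1).smul continuous_const)).add
      ((continuous_stdSimplex_apply 2).smul continuous_const)⟩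

theorem seg_apply (φ : C(E, G)) (p q : E) (s : stdSimplex ℝ (Fin 2)) :
    seg φ p q s = φ (s 0 • p + s 1 • q) := rfl

theorem faceMap_apply (n : ℕ) (i : Fin (n + 2)) (s : stdSimplex ℝ (Fin (n + 1))) (y : Fin (n + 2)) :
    faceMap n i s y = ∑ x, if i.succAbove x = y then s x else 0 := by
  change stdSimplex.map i.succAbove s y = _
  rw [stdSimplex.map_coe, FunOnFinite.linearMap_apply_apply]
  rw [Finset.sum_filter]

theorem bdry_single_one (σ : Simp G 2) : bdry 1 (Finsupp.single σ 1)
    = Finsupp.single (σ.comp (faceMap 1 0)) 1 - Finsupp.single (σ.comp (faceMap 1 1)) 1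
      + Finsupp.single (σ.comp (faceMap 1 2)) 1 := by
  rw [bdry, Finsupp.linearCombination_single, one_smul]
  refine (Fin.sum_univ_three _).trans ?_
  norm_num [sub_eq_add_neg]

theorem bdry_tri (φ : C(E, G)) (p q r : E) :
    bdry 1 (Finsupp.single (tri φ p q r) 1) = Finsupp.single (seg φ q r) 1
      - Finsupp.single (seg φ p r) 1 + Finsupp.single (seg φ p q) 1 := by
  have h0 : (tri φ p q r).comp (faceMap 1 0) = seg φ q r := by
    ext s
    simp [tri, seg, faceMap_apply, Fin.sum_univ_two, Fin.succAbove]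
  have h1 : (tri φ p q r).comp (faceMap 1 1) = seg φ p r := by
    ext s
    simp [tri, seg, faceMap_apply, Fin.sum_univ_two, Fin.succAbove]
  have h2 : (tri φ p q r).comp (faceMap 1 2) = seg φ p q := by
    ext s
    simp [tri, seg, faceMap_apply, Fin.sum_univ_two, Fin.succAbove]
  rw [bdry_single_one, h0, h1, h2]

/-- Segments add up, modulo boundaries. -/
theorem seg_add_mem (φ : C(E, G)) (p q r : E) :
    Finsupp.single (seg φ q r) 1 - Finsupp.single (seg φ p r) 1 + Finsupp.single (seg φ p q) 1 ∈
      LinearMap.range (bdry (G := G) 1) :=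
  ⟨_, bdry_tri φ p q r⟩

end Affine

/-- A point, as a singular simplex. -/
def pnt (x : G) : Simp G 0 := ContinuousMap.const _ x

theorem eq_pnt (σ : Simp G 0) : σ = pnt (σ default) := by
  ext s
  rw [Subsingleton.elim s default]
  rfl

/-- The endpoints of the standard simplex of dimension `1`. -/
abbrev vtx {n : ℕ} (i : Fin (n + 1)) : stdSimplex ℝ (Fin (n + 1)) := stdSimplex.vertex i

theorem faceMap_vtx (n : ℕ) (i : Fin (n + 2)) (x : Fin (n + 1)) :
    faceMap n i (vtx x) = vtx (i.succAbove x) :=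
  stdSimplex.map_vertex _ _

theorem bdry_path (γ : Simp G 1) : bdry 0 (Finsupp.single γ 1)
    = Finsupp.single (pnt (γ (vtx 1))) 1 - Finsupp.single (pnt (γ (vtx 0))) 1 := by
  have h : ∀ i, γ.comp (faceMap 0 i) = pnt (γ (vtx (i.succAbove 0))) := fun i => by
    rw [eq_pnt (γ.comp (faceMap 0 i)), ContinuousMap.comp_apply, ← faceMap_vtx]
    congr 3
    exact Subsingleton.elim _ _
  simp only [bdry, Finsupp.linearCombination_single, one_smul, h]
  simp [sub_eq_add_neg]

theorem vtx_apply_self {n : ℕ} (i : Fin (n + 1)) : vtx i i = (1 : ℝ) := by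
  change (stdSimplex.vertex i : Fin (n + 1) → ℝ) i = 1
  simp

theorem vtx_apply_ne {n : ℕ} {i j : Fin (n + 1)} (h : j ≠ i) : vtx i j = (0 : ℝ) := by
  change (stdSimplex.vertex i : Fin (n + 1) → ℝ) j = 0
  simp [h]

/-- A retraction of the ambient space to the standard simplex. -/
theorem exists_retraction_stdSimplex (n : ℕ) :
    ∃ r : C(Fin (n + 1) → ℝ, stdSimplex ℝ (Fin (n + 1))), ∀ s : stdSimplex ℝ (Fin (n + 1)),
      r (s : Fin (n + 1) → ℝ) = s := by
  let S : (Fin (n + 1) → ℝ) → ℝ := fun x => ∑ i, max (x i) 0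
  have hS : Continuous S := by fun_prop
  have hp : ∀ x, 0 < max (S x) 1 := fun x => lt_max_of_lt_right one_pos
  -- Negative coordinates are cut off. If the remaining sum `S x` is less than `1`, the missing mass
  -- is spread evenly, otherwise the point is divided by `S x`; the denominator `max (S x) 1` covers
  -- both cases.
  let r : (Fin (n + 1) → ℝ) → Fin (n + 1) → ℝ := fun x i =>
    (max (x i) 0 + (max (S x) 1 - S x) / (n + 1)) / max (S x) 1
  have hr : Continuous r := by
    refine continuous_pi fun i => Continuous.div ?_ (by fun_prop) fun x => (hp x).ne'
    fun_prop
  refine ⟨⟨fun x => ⟨r x, fun i => ?_, ?_⟩, hr.subtype_mk _⟩, fun s => ?_⟩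
  · refine div_nonneg (add_nonneg (le_max_right _ _) (div_nonneg ?_ (by positivity))) (hp x).le
    exact sub_nonneg.2 (le_max_left _ _)
  · have h := (hp x).ne'
    simp only [r]
    rw [← Finset.sum_div, Finset.sum_add_distrib, Finset.sum_const]
    simp only [Finset.card_univ, Fintype.card_fin, nsmul_eq_mul]
    have hn : ((n : ℝ) + 1) ≠ 0 := by positivity
    push_cast
    change (S x + _) / _ = 1
    field_simp
    ring
  · have h1 : ∀ i, max ((s : Fin (n + 1) → ℝ) i) 0 = s i := fun i => max_eq_left (s.2.1 i)
    have h2 : S s = 1 := by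
      simp only [S, h1]
      exact s.2.2
    refine Subtype.ext (funext fun i => ?_)
    change r s i = s i
    simp [r, h2]

/-! ### Lifts from the circle to the line, and winding numbers -/

theorem exists_lift {E : Type*} [TopologicalSpace E] [SimplyConnectedSpace E]
    [LocallyPathConnectedSpace E] (θ : C(E, AddCircle (1 : ℝ))) :
    ∃ h : C(E, ℝ), ∀ x, ((h x : ℝ) : AddCircle (1 : ℝ)) = θ x := by
  obtain ⟨e⟩ : Nonempty E := inferInstance
  obtain ⟨t, ht⟩ := QuotientAddGroup.mk_surjective (θ e)
  obtain ⟨h, hh, -⟩ := (AddCircle.isCoveringMap_coe (1 : ℝ)).existsUnique_continuousMap_lifts θ e t ht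
  exact ⟨h, fun x => congrFun hh.2 x⟩

/-- The retraction extends `θ` to the ambient vector space, where covering theory applies. -/
theorem exists_lift_stdSimplex {n : ℕ} (θ : C(stdSimplex ℝ (Fin (n + 1)), AddCircle (1 : ℝ))) :
    ∃ h : C(stdSimplex ℝ (Fin (n + 1)), ℝ), ∀ x, ((h x : ℝ) : AddCircle (1 : ℝ)) = θ x := by
  obtain ⟨r, hr⟩ := exists_retraction_stdSimplex n
  obtain ⟨h, hh⟩ := exists_lift (θ.comp r)
  refine ⟨h.comp ⟨Subtype.val, continuous_subtype_val⟩, fun x => ?_⟩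
  refine (hh _).trans ?_
  exact congrArg θ (hr x)

theorem coe_eq_coe_iff (x y : ℝ) :
    ((x : ℝ) : AddCircle (1 : ℝ)) = y ↔ ∃ k : ℤ, x - y = k := by
  rw [← sub_eq_zero, ← AddCircle.coe_sub, AddCircle.coe_eq_zero_iff]
  simp [eq_comm]

/-- Two lifts of a path differ by a continuous integer-valued function, hence by a constant. -/
theorem exists_wind (q : C(G, AddCircle (1 : ℝ))) (γ : Simp G 1) : ∃ w : ℝ,
    ∀ h : C(stdSimplex ℝ (Fin 2), ℝ), (∀ s, ((h s : ℝ) : AddCircle (1 : ℝ)) = q (γ s)) →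
      h (vtx 1) - h (vtx 0) = w := by
  obtain ⟨h, hh⟩ := exists_lift_stdSimplex (q.comp γ)
  refine ⟨h (vtx 1) - h (vtx 0), fun h' hh' => ?_⟩
  obtain ⟨k, hk⟩ := exists_int_eq_of_isPreconnected (f := fun s => h' s - h s) isPreconnected_univ
    univ_nonempty (by fun_prop) fun s _ => (coe_eq_coe_iff _ _).1 ((hh' s).trans (hh s).symm)
  linarith [hk (vtx 0) (mem_univ _), hk (vtx 1) (mem_univ _)]

/-- The winding number of a path with respect to a map to the circle. -/
def wind (q : C(G, AddCircle (1 : ℝ))) (γ : Simp G 1) : ℝ := (exists_wind q γ).choose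

theorem wind_eq {q : C(G, AddCircle (1 : ℝ))} {γ : Simp G 1} {h : C(stdSimplex ℝ (Fin 2), ℝ)}
    (hh : ∀ s, ((h s : ℝ) : AddCircle (1 : ℝ)) = q (γ s)) :
    wind q γ = h (vtx 1) - h (vtx 0) :=
  ((exists_wind q γ).choose_spec h hh).symm

theorem wind_seg {E : Type*} [AddCommGroup E] [Module ℝ E] [TopologicalSpace E] [ContinuousAdd E]
    [ContinuousSMul ℝ E] {q : C(G, AddCircle (1 : ℝ))} {φ : C(E, G)} (h : C(E, ℝ))
    (hh : ∀ x, ((h x : ℝ) : AddCircle (1 : ℝ)) = q (φ x)) (x y : E) :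
    wind q (seg φ x y) = h y - h x := by
  rw [wind_eq (h := seg h x y) fun s => hh _, seg_apply, seg_apply]
  simp [vtx_apply_self, vtx_apply_ne]

/-- The winding number of a chain. -/
def windL (q : C(G, AddCircle (1 : ℝ))) : (Simp G 1 →₀ ℝ) →ₗ[ℝ] ℝ :=
  Finsupp.linearCombination ℝ (wind q)

/-- A lift over the triangle restricts to lifts over its three sides, and its values at the vertices
cancel. -/
theorem windL_bdry (q : C(G, AddCircle (1 : ℝ))) (c : Simp G 2 →₀ ℝ) : windL q (bdry 1 c) = 0 := by
  have : windL q ∘ₗ bdry 1 = 0 := by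
    refine Finsupp.lhom_ext' fun σ => LinearMap.ext_ring ?_
    obtain ⟨h, hh⟩ := exists_lift_stdSimplex (q.comp σ)
    have hw : ∀ i, wind q (σ.comp (faceMap 1 i))
        = h (vtx (i.succAbove 1)) - h (vtx (i.succAbove 0)) := fun i => by
      rw [wind_eq (q := q) (γ := σ.comp (faceMap 1 i)) (h := h.comp (faceMap 1 i)) fun s => hh _]
      simp [faceMap_vtx]
    simp only [LinearMap.comp_apply, Finsupp.lsingle_apply, bdry_single_one, windL, map_add,
      map_sub, Finsupp.linearCombination_single, hw]
    simp [Fin.succAbove]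
  exact congrArg (fun φ => φ c) this

/-- Every path is the image of the segment `[0, 1]`. -/
theorem exists_eq_seg (γ : Simp G 1) : ∃ φ : C(ℝ, G), γ = seg φ 0 1 := by
  refine ⟨γ.comp (ContinuousMap.comp ⟨_, stdSimplexHomeomorphUnitInterval.symm.continuous⟩
    ⟨projIcc (0 : ℝ) 1 zero_le_one, continuous_projIcc⟩), ?_⟩
  ext s
  rw [seg_apply]
  simp only [ContinuousMap.comp_apply, ContinuousMap.coe_mk]
  congr 1
  rw [Homeomorph.eq_symm_apply]
  have : s 0 • (0 : ℝ) + s 1 • 1 = (stdSimplexHomeomorphUnitInterval s : ℝ) := by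
    rw [smul_zero, zero_add, smul_eq_mul, mul_one]
    rfl
  rw [this, projIcc_val]

end Paths


/-! ### The first homology of a graph -/

section GraphHomology

variable {G : Type u} [TopologicalSpace G] {m : ℕ}

/-- A parametrization of a graph by finitely many intervals, injective except that endpoints of
intervals may be identified with each other. -/
structure IsParam (c : Fin m → C(unitInterval, G)) : Prop where
  surj : ∀ x, ∃ j t, c j t = x
  inj : ∀ j k t u, c j t = c k u → (j = k ∧ t = u) ∨ ((t = 0 ∨ t = 1) ∧ (u = 0 ∨ u = 1))

/-- The extension of a path to the real line by constants. -/
def lineExt (c : C(unitInterval, G)) : C(ℝ, G) :=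
  c.comp ⟨projIcc (0 : ℝ) 1 zero_le_one, continuous_projIcc⟩

theorem lineExt_apply (c : C(unitInterval, G)) (t : ℝ) : lineExt c t = c (projIcc 0 1 zero_le_one t) := rfl

theorem lineExt_coe (c : C(unitInterval, G)) (t : unitInterval) : lineExt c t = c t := by
  rw [lineExt_apply, projIcc_val]

theorem lineExt_zero (c : C(unitInterval, G)) : lineExt c 0 = c 0 := lineExt_coe c 0

theorem lineExt_one (c : C(unitInterval, G)) : lineExt c 1 = c 1 := lineExt_coe c 1

variable {c : Fin m → C(unitInterval, G)}

/-- The loop or arc given by a parametrization. -/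
def edge (c : Fin m → C(unitInterval, G)) (j : Fin m) : Simp G 1 := seg (lineExt (c j)) 0 1

namespace IsParam

variable [T2Space G] (hc : IsParam c)
include hc

theorem isQuotientMap : IsQuotientMap fun p : Fin m × unitInterval => c p.1 p.2 := by
  have h : Continuous fun p : Fin m × unitInterval => c p.1 p.2 :=
    continuous_prod_of_discrete_left.2 fun j => (c j).continuous
  exact h.isClosedMap.isQuotientMap h fun x => by
    obtain ⟨j, t, h⟩ := hc.surj x
    exact ⟨(j, t), h⟩

/-- Maps on a graph may be defined edge by edge. -/
theorem exists_desc {Y : Type*} [TopologicalSpace Y] (Q : Fin m → C(unitInterval, Y))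
    (hQ : ∀ j k t u, (t = 0 ∨ t = 1) → (u = 0 ∨ u = 1) → c j t = c k u → Q j t = Q k u) :
    ∃ q : C(G, Y), ∀ j t, q (c j t) = Q j t := by
  let g : C(Fin m × unitInterval, Y) := ⟨fun p => Q p.1 p.2,
    continuous_prod_of_discrete_left.2 fun j => (Q j).continuous⟩
  have hg : ∀ p p' : Fin m × unitInterval, c p.1 p.2 = c p'.1 p'.2 → g p = g p' := by
    rintro ⟨j, t⟩ ⟨k, u⟩ h
    rcases hc.inj j k t u h with ⟨rfl, rfl⟩ | ⟨ht, hu⟩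
    · rfl
    · exact hQ j k t u ht hu h
  let p₀ : C(Fin m × unitInterval, G) := ⟨_, hc.isQuotientMap.continuous⟩
  have hp₀ : IsQuotientMap p₀ := hc.isQuotientMap
  refine ⟨hp₀.lift g fun a b h => hg a b h, fun j t => ?_⟩
  exact congrArg (fun φ => φ (j, t)) (hp₀.lift_comp g fun a b h => hg a b h)

/-- All endpoints of edges go to `0`, as `1 = 0` in the circle, so the identifications impose no
condition. -/
theorem exists_circ (i : Fin m) : ∃ q : C(G, AddCircle (1 : ℝ)),
    ∀ j t, q (c j t) = if j = i then (((t : unitInterval) : ℝ) : AddCircle (1 : ℝ)) else 0 := by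
  classical
  obtain ⟨q, hq⟩ := hc.exists_desc (Y := AddCircle (1 : ℝ))
    (fun j => ⟨fun t => if j = i then ((t : ℝ) : AddCircle (1 : ℝ)) else 0, by
      split_ifs
      · exact (AddCircle.continuous_mk' 1).comp continuous_subtype_val
      · exact continuous_const⟩) (by
      have key : ∀ (j : Fin m) (t : unitInterval), (t = 0 ∨ t = 1) →
          (if j = i then ((t : ℝ) : AddCircle (1 : ℝ)) else 0) = 0 := by
        rintro j t (rfl | rfl)
        · simp
        · split_ifs
          · exact AddCircle.coe_period 1
          · rfl
      intro j k t u ht hu _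
      exact (key j t ht).trans (key k u hu).symm)
  refine ⟨q, fun j t => (hq j t).trans ?_⟩
  simp only [ContinuousMap.coe_mk]

/-- The map to the circle that collapses all edges but one. -/
def circ (i : Fin m) : C(G, AddCircle (1 : ℝ)) := (hc.exists_circ i).choose

theorem circ_apply (i j : Fin m) (t : unitInterval) :
    hc.circ i (c j t) = if j = i then ((t : ℝ) : AddCircle (1 : ℝ)) else 0 :=
  (hc.exists_circ i).choose_spec j t

/-- The homotopy that moves points along the edges by means of a reparametrization. -/
theorem exists_homotopy (k : C(ℝ, ℝ)) (h0 : k 0 = 0) (h1 : k 1 = 1) :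
    ∃ H : C(G × ℝ, G), ∀ j (t : unitInterval) τ, τ ∈ Icc (0 : ℝ) 1 →
      H (c j t, τ) = lineExt (c j) ((1 - τ) * k t + τ * t) := by
  -- Descending a map to the path space avoids any question about products of quotient maps.
  obtain ⟨H, hH⟩ := hc.exists_desc (Y := C(unitInterval, G)) (fun j =>
    ContinuousMap.curry ⟨fun p : unitInterval × unitInterval =>
      lineExt (c j) ((1 - (p.2 : ℝ)) * k p.1 + p.2 * p.1), by fun_prop⟩) (by
      intro j k' t u ht hu h
      ext τ
      have key : ∀ (j : Fin m) (t : unitInterval), (t = 0 ∨ t = 1) →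
          lineExt (c j) ((1 - (τ : ℝ)) * k t + τ * t) = c j t := by
        rintro j t (rfl | rfl)
        · simp [h0, lineExt_zero]
        · simp [h1, lineExt_one]
      exact (key j t ht).trans (h.trans (key k' u hu).symm))
  refine ⟨⟨fun p => H p.1 (projIcc 0 1 zero_le_one p.2), ?_⟩, fun j t τ hτ => ?_⟩
  · have : Continuous fun p : G × ℝ => (projIcc (0 : ℝ) 1 zero_le_one p.2 : unitInterval) :=
      continuous_projIcc.comp continuous_snd
    fun_prop
  · change H (c j t) _ = _
    rw [hH]
    simp [projIcc_of_mem _ hτ]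

end IsParam

end GraphHomology


/-! ### Paths modulo boundaries and edges -/

section GraphHomology

variable {G : Type u} [TopologicalSpace G] {m : ℕ}

/-- The boundaries and the edges, as a space of `1`-chains. -/
def bdryEdge (c : Fin m → C(unitInterval, G)) : Submodule ℝ (Simp G 1 →₀ ℝ) :=
  LinearMap.range (bdry 1) ⊔ Submodule.span ℝ (range fun j => Finsupp.single (edge c j) 1)

/-- The class of a path modulo boundaries and edges. -/
def cls (c : Fin m → C(unitInterval, G)) (γ : Simp G 1) : (Simp G 1 →₀ ℝ) ⧸ bdryEdge c :=
  (bdryEdge c).mkQ (Finsupp.single γ 1)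

variable {c : Fin m → C(unitInterval, G)}

theorem cls_seg {E : Type*} [AddCommGroup E] [Module ℝ E] [TopologicalSpace E] [ContinuousAdd E]
    [ContinuousSMul ℝ E] (φ : C(E, G)) (p q r : E) :
    cls c (seg φ p r) = cls c (seg φ p q) + cls c (seg φ q r) := by
  have h : (bdryEdge c).mkQ _ = 0 := (Submodule.Quotient.mk_eq_zero _).2
    ((le_sup_left : _ ≤ bdryEdge c) (seg_add_mem φ p q r))
  rw [map_add, map_sub] at h
  have h' : cls c (seg φ q r) - cls c (seg φ p r) + cls c (seg φ p q) = 0 := h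
  rw [← sub_eq_zero, ← neg_eq_zero, ← h']
  abel

theorem cls_seg_self {E : Type*} [AddCommGroup E] [Module ℝ E] [TopologicalSpace E]
    [ContinuousAdd E] [ContinuousSMul ℝ E] (φ : C(E, G)) (p : E) : cls c (seg φ p p) = 0 := by
  simpa using cls_seg (c := c) φ p p p

theorem cls_edge (j : Fin m) : cls c (edge c j) = 0 :=
  (Submodule.Quotient.mk_eq_zero _).2 ((le_sup_right : _ ≤ bdryEdge c)
    (Submodule.subset_span ⟨j, rfl⟩))

namespace IsParam

variable (hc : IsParam c)
include hc

/-- Distinct parameters of one point are ends of edges, where the class is zero: the segment is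
constant or a whole edge. Hence `stem` is independent of choices. -/
theorem cls_seg_eq {j k : Fin m} {t u : unitInterval} (h : c j t = c k u) :
    cls c (seg (lineExt (c j)) 0 (t : ℝ)) = cls c (seg (lineExt (c k)) 0 (u : ℝ)) := by
  have key : ∀ (j : Fin m) (t : unitInterval), (t = 0 ∨ t = 1) →
      cls c (seg (lineExt (c j)) 0 (t : ℝ)) = 0 := by
    rintro j t (rfl | rfl)
    · exact cls_seg_self _ _
    · exact cls_edge j
  rcases hc.inj j k t u h with ⟨rfl, rfl⟩ | ⟨ht, hu⟩
  · rfl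
  · rw [key j t ht, key k u hu]

/-- The class of the path from the origin of an edge to a point of this edge. -/
def stem (x : G) : (Simp G 1 →₀ ℝ) ⧸ bdryEdge c :=
  cls c (seg (lineExt (c (hc.surj x).choose)) 0 ((hc.surj x).choose_spec.choose : ℝ))

theorem stem_apply (j : Fin m) (t : unitInterval) :
    hc.stem (c j t) = cls c (seg (lineExt (c j)) 0 (t : ℝ)) :=
  hc.cls_seg_eq (hc.surj (c j t)).choose_spec.choose_spec

theorem stem_lineExt (j : Fin m) {t : ℝ} (ht : t ∈ Icc (0 : ℝ) 1) :
    hc.stem (lineExt (c j) t) = cls c (seg (lineExt (c j)) 0 t) := by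
  lift t to unitInterval using ht
  rw [lineExt_coe, stem_apply]

variable [T2Space G]

/-- Every point has a neighborhood that is contracted to a point by a reparametrization of the
edges. -/
theorem exists_nhds (x : G) : ∃ U : Set G, IsOpen U ∧ x ∈ U ∧ ∃ k : C(ℝ, ℝ), k 0 = 0 ∧ k 1 = 1 ∧
    (∀ t ∈ Icc (0 : ℝ) 1, k t ∈ Icc (0 : ℝ) 1) ∧
    ∃ x' : G, ∀ j (t : unitInterval), c j t ∈ U → lineExt (c j) (k t) = x' := by
  have hclosed : ∀ K : Set (Fin m × unitInterval), IsClosed K →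
      IsOpen ((fun p : Fin m × unitInterval => c p.1 p.2) '' K)ᶜ := fun K hK =>
    (hK.isCompact.image hc.isQuotientMap.continuous).isClosed.isOpen_compl
  have hfst : ∀ A : Set (Fin m), IsClosed {p : Fin m × unitInterval | p.1 ∈ A} := fun A =>
    (isClosed_discrete A).preimage continuous_fst
  have hle : ∀ r : ℝ, IsClosed {p : Fin m × unitInterval | (p.2 : ℝ) ≤ r} := fun r =>
    isClosed_le (by fun_prop) continuous_const
  have hge : ∀ r : ℝ, IsClosed {p : Fin m × unitInterval | r ≤ (p.2 : ℝ)} := fun r =>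
    isClosed_le continuous_const (by fun_prop)
  obtain ⟨j₀, t₀, rfl⟩ := hc.surj x
  by_cases ht₀ : t₀ = 0 ∨ t₀ = 1
  -- At an end of edges, `U` consists of the outer thirds of edges that are attached to the point,
  -- and the reparametrization collapses the outer thirds to `0` and `1`.
  · refine ⟨_, hclosed _ (((hge (1 / 3)).union (hfst {j | c j 0 ≠ c j₀ t₀})).inter
      ((hle (2 / 3)).union (hfst {j | c j 1 ≠ c j₀ t₀}))), ?_,
      ⟨fun t => max 0 (min 1 (3 * t - 1)), by fun_prop⟩, ?_, ?_, ?_, c j₀ t₀, fun j t h => ?_⟩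
    · rintro ⟨⟨j, t⟩, ⟨h1, h2⟩, h⟩
      have ht : t = 0 ∨ t = 1 := by
        rcases hc.inj _ _ _ _ h with ⟨-, rfl⟩ | ⟨ht, -⟩
        · exact ht₀
        · exact ht
      rcases ht with rfl | rfl
      · rcases h1 with h1 | h1
        · norm_num at h1
        · exact h1 h
      · rcases h2 with h2 | h2
        · norm_num at h2
        · exact h2 h
    · norm_num
    · norm_num
    · exact fun t _ => ⟨le_max_left _ _, max_le zero_le_one (min_le_left _ _)⟩
    · by_cases hK : ((t : ℝ) < 1 / 3 ∧ c j 0 = c j₀ t₀) ∨ ((2 / 3 : ℝ) < t ∧ c j 1 = c j₀ t₀)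
      · rcases hK with ⟨h1, h2⟩ | ⟨h1, h2⟩
        · rw [← h2, ← lineExt_zero]
          congr 1
          exact max_eq_left ((min_le_right _ _).trans (by linarith))
        · rw [← h2, ← lineExt_one]
          congr 1
          change max 0 (min 1 (3 * (t : ℝ) - 1)) = 1
          rw [min_eq_left (by linarith), max_eq_right zero_le_one]
      · refine absurd ⟨(j, t), ?_, rfl⟩ h
        push Not at hK
        constructor
        · by_cases h1 : (1 / 3 : ℝ) ≤ t
          · exact Or.inl h1
          · exact Or.inr (hK.1 (not_le.1 h1))
        · by_cases h1 : (t : ℝ) ≤ 2 / 3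
          · exact Or.inl h1
          · exact Or.inr (hK.2 (not_le.1 h1))
  · push Not at ht₀
    have h0 : (0 : ℝ) < t₀ := unitInterval.pos_iff_ne_zero.2 ht₀.1
    have h1 : (t₀ : ℝ) < 1 := unitInterval.lt_one_iff_ne_one.2 ht₀.2
    -- At an interior point, `U` is the part `t₀ / 2 < t < (1 + t₀) / 2` of its edge, collapsed to
    -- `t₀`.
    refine ⟨_, hclosed _ ((hfst {j₀}ᶜ).union ((hle (t₀ / 2)).union (hge ((1 + t₀) / 2)))), ?_,
      ⟨fun t => min (2 * t) t₀ + max 0 (2 * t - 1 - t₀), by fun_prop⟩, ?_, ?_, ?_, c j₀ t₀,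
      fun j t h => ?_⟩
    · rintro ⟨⟨j, t⟩, hK, h⟩
      rcases hc.inj _ _ _ _ h with ⟨h2, h3⟩ | ⟨-, ht | ht⟩
      · change j = j₀ at h2
        change t = t₀ at h3
        subst h2 h3
        rcases hK with hK | hK | hK
        · exact hK rfl
        · change (t : ℝ) ≤ t / 2 at hK
          linarith
        · change (1 + (t : ℝ)) / 2 ≤ t at hK
          linarith
      · exact ht₀.1 ht
      · exact ht₀.2 ht
    · change min (2 * (0 : ℝ)) t₀ + max 0 (2 * 0 - 1 - (t₀ : ℝ)) = 0
      rw [min_eq_left (by linarith), max_eq_left (by linarith)]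
      norm_num
    · change min (2 * (1 : ℝ)) t₀ + max 0 (2 * 1 - 1 - (t₀ : ℝ)) = 1
      rw [min_eq_right (by linarith), max_eq_right (by linarith)]
      ring
    · rintro t ⟨ht0, ht1⟩
      change min (2 * t) t₀ + max 0 (2 * t - 1 - (t₀ : ℝ)) ∈ Icc (0 : ℝ) 1
      refine ⟨add_nonneg (le_min (by linarith) h0.le) (le_max_left _ _), ?_⟩
      rcases le_total (2 * t - 1 - (t₀ : ℝ)) 0 with h | h
      · rw [max_eq_left h]
        linarith [min_le_right (2 * t) (t₀ : ℝ)]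
      · rw [max_eq_right h]
        linarith [min_le_right (2 * t) (t₀ : ℝ)]
    · by_cases hK : j = j₀ ∧ (t₀ : ℝ) / 2 < t ∧ (t : ℝ) < (1 + t₀) / 2
      · obtain ⟨rfl, h2, h3⟩ := hK
        rw [← lineExt_coe]
        congr 1
        change min (2 * (t : ℝ)) t₀ + max 0 (2 * (t : ℝ) - 1 - (t₀ : ℝ)) = t₀
        rw [min_eq_right (by linarith), max_eq_left (by linarith), add_zero]
      · refine absurd ⟨(j, t), ?_, rfl⟩ h
        by_cases h1 : j = j₀
        · by_cases h2 : (t : ℝ) ≤ t₀ / 2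
          · exact Or.inr (Or.inl h2)
          · by_contra h3
            refine hK ⟨h1, not_le.1 h2, ?_⟩
            by_contra h4
            exact h3 (Or.inr (Or.inr (not_lt.1 h4)))
        · exact Or.inl h1

/-- The homotopy along the edges gives a map `Φ` of the square `[s, t] × [0, 1]`. Its top side is
the path, its bottom side is constant, and its vertical sides run inside edges, so their classes are
differences of stems. Comparing the two ways around the diagonal gives the class of the path. -/
theorem cls_seg_of_local {U : Set G} {k : C(ℝ, ℝ)} (h0 : k 0 = 0) (h1 : k 1 = 1)
    (hk : ∀ t ∈ Icc (0 : ℝ) 1, k t ∈ Icc (0 : ℝ) 1) {x' : G}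
    (hU : ∀ j (t : unitInterval), c j t ∈ U → lineExt (c j) (k t) = x') (φ : C(ℝ, G)) {s t : ℝ}
    (hst : s ≤ t) (hφ : ∀ u ∈ Icc s t, φ u ∈ U) :
    cls c (seg φ s t) = hc.stem (φ t) - hc.stem (φ s) := by
  obtain ⟨H, hH⟩ := hc.exists_homotopy k h0 h1
  let Φ : C(ℝ × ℝ, G) := ⟨fun p => H (φ p.1, p.2), by fun_prop⟩
  have hΦ1 : ∀ u, Φ (u, 1) = φ u := fun u => by
    obtain ⟨j, r, hr⟩ := hc.surj (φ u)
    change H (φ u, 1) = φ u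
    rw [← hr, hH j r 1 ⟨zero_le_one, le_rfl⟩]
    simp [lineExt_coe]
  have hΦ0 : ∀ u ∈ Icc s t, Φ (u, 0) = x' := fun u hu => by
    obtain ⟨j, r, hr⟩ := hc.surj (φ u)
    change H (φ u, 0) = x'
    rw [← hr, hH j r 0 ⟨le_rfl, zero_le_one⟩, ← hU j r (hr ▸ hφ u hu)]
    simp
  have top : seg Φ (s, 1) (t, 1) = seg φ s t := by
    ext r
    have hr := stdSimplex.add_eq_one r
    rw [seg_apply, seg_apply, ← hΦ1]
    congr 1
    ext <;> simp [hr]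
  have bot : seg Φ (s, 0) (t, 0) = seg (ContinuousMap.const ℝ x') 0 0 := by
    ext r
    have hr := stdSimplex.add_eq_one r
    have hr0 := stdSimplex.zero_le r 0
    have hr1 := stdSimplex.zero_le r 1
    rw [seg_apply, seg_apply, ContinuousMap.const_apply]
    have : r 0 • (s, (0 : ℝ)) + r 1 • (t, (0 : ℝ)) = (r 0 * s + r 1 * t, 0) := by
      ext <;> simp
    rw [this]
    rw [← eq_sub_iff_add_eq] at hr
    rw [hr]
    exact hΦ0 _ ⟨by nlinarith, by nlinarith⟩
  have side : ∀ u ∈ Icc s t, cls c (seg Φ (u, 0) (u, 1)) = hc.stem (φ u) - hc.stem x' := by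
    intro u hu
    obtain ⟨j, r, hr⟩ := hc.surj (φ u)
    have : seg Φ (u, 0) (u, 1) = seg (lineExt (c j)) (k r) r := by
      ext τ
      have hτ := stdSimplex.add_eq_one τ
      have hτ0 := stdSimplex.zero_le τ 0
      have hτ1 := stdSimplex.zero_le τ 1
      have : τ 0 • (u, (0 : ℝ)) + τ 1 • (u, (1 : ℝ)) = (u, τ 1) := by
        ext <;> simp [← add_mul, hτ]
      rw [seg_apply, seg_apply, this]
      change H (φ u, τ 1) = _
      rw [← hr, hH j r _ ⟨hτ1, by linarith⟩, ← hτ]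
      simp
    rw [this, ← hr, hc.stem_apply, ← hU j r (hr ▸ hφ u hu), hc.stem_lineExt j (hk r r.2),
      cls_seg (lineExt (c j)) 0 (k r) r]
    abel
  have e1 := cls_seg (c := c) Φ (s, 0) (t, 0) (t, 1)
  have e2 := cls_seg (c := c) Φ (s, 0) (s, 1) (t, 1)
  rw [e1, bot, cls_seg_self, top, side s ⟨le_rfl, hst⟩, side t ⟨hst, le_rfl⟩, zero_add] at e2
  rw [← sub_eq_iff_eq_add'] at e2
  rw [← e2]
  abel

/-- A Lebesgue subdivision cuts the path into pieces that lie in the neighborhoods of `exists_nhds`;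
classes add up and stems telescope. -/
theorem cls_eq (γ : Simp G 1) : cls c γ = hc.stem (γ (vtx 1)) - hc.stem (γ (vtx 0)) := by
  obtain ⟨φ, rfl⟩ := exists_eq_seg γ
  choose U hUo hxU k h0 h1 hk x' hU using hc.exists_nhds
  obtain ⟨t, ht0, htm, ⟨n, hn⟩, ht⟩ := exists_monotone_Icc_subset_open_cover_unitInterval
    (c := fun x => (fun s : unitInterval => φ s) ⁻¹' U x)
    (fun x => (hUo x).preimage (by fun_prop)) fun s _ => mem_iUnion.2 ⟨φ s, hxU _⟩
  have key : ∀ n, cls c (seg φ 0 (t n : ℝ)) = hc.stem (φ (t n : ℝ)) - hc.stem (φ 0) := by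
    intro n
    induction n with
    | zero => rw [ht0]; simp [cls_seg_self]
    | succ n ih =>
      obtain ⟨x, hx⟩ := ht n
      have hle : (t n : ℝ) ≤ t (n + 1) := htm n.le_succ
      rw [cls_seg φ 0 (t n : ℝ) (t (n + 1)), ih,
        hc.cls_seg_of_local (h0 x) (h1 x) (hk x) (hU x) φ hle fun u hu =>
          hx (a := ⟨u, (t n).2.1.trans hu.1, hu.2.trans (t (n + 1)).2.2⟩) ⟨hu.1, hu.2⟩]
      abel
  have := key n
  rw [hn n le_rfl] at this
  simpa [seg_apply, vtx_apply_self, vtx_apply_ne] using this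

/-- A `1`-cycle is the sum of a boundary and a linear combination of edges. -/
theorem mem_bdryEdge_of_cycle {z : Simp G 1 →₀ ℝ} (hz : bdry 0 z = 0) : z ∈ bdryEdge c := by
  let S : (Simp G 0 →₀ ℝ) →ₗ[ℝ] (Simp G 1 →₀ ℝ) ⧸ bdryEdge c :=
    Finsupp.linearCombination ℝ fun σ => hc.stem (σ default)
  -- Hence the class of a chain modulo boundaries and edges depends on its boundary only.
  have : (bdryEdge c).mkQ = S ∘ₗ bdry 0 := by
    refine Finsupp.lhom_ext' fun γ => LinearMap.ext_ring ?_
    simp only [LinearMap.comp_apply, Finsupp.lsingle_apply, bdry_path, map_sub]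
    refine (hc.cls_eq γ).trans ?_
    simp [S, pnt]
  rw [← Submodule.Quotient.mk_eq_zero, ← Submodule.mkQ_apply, this, LinearMap.comp_apply, hz,
    map_zero]

end IsParam

end GraphHomology


/-! ### Linear algebra: factorizations and traces on subspaces -/

section Factor

variable {V W U : Type*} [AddCommGroup V] [Module ℝ V] [AddCommGroup W] [Module ℝ W]
  [AddCommGroup U] [Module ℝ U]

theorem exists_factor_of_ker_le (T : V →ₗ[ℝ] W) (L : V →ₗ[ℝ] U)
    (h : LinearMap.ker T ≤ LinearMap.ker L) : ∃ μ : W →ₗ[ℝ] U, ∀ v, μ (T v) = L v := by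
  obtain ⟨g, hg⟩ := T.rangeRestrict.exists_rightInverse_of_surjective T.range_rangeRestrict
  obtain ⟨r, hr⟩ := (LinearMap.range T).subtype.exists_leftInverse_of_injective
    (Submodule.ker_subtype _)
  refine ⟨L ∘ₗ g ∘ₗ r, fun v => ?_⟩
  have h1 : r (T v) = T.rangeRestrict v :=
    congrArg (fun φ => φ (T.rangeRestrict v)) hr
  have h2 : T (g (T.rangeRestrict v)) = T v :=
    congrArg Subtype.val (congrArg (fun φ => φ (T.rangeRestrict v)) hg)
  have h3 : g (T.rangeRestrict v) - v ∈ LinearMap.ker L := h (by simp [h2])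
  rw [LinearMap.comp_apply, LinearMap.comp_apply, h1, ← sub_eq_zero, ← map_sub]
  exact h3

theorem exists_equiv_of_ker_eq (P : V →ₗ[ℝ] W) (κ : V →ₗ[ℝ] U) (hP : Surjective P)
    (hκ : Surjective κ) (h : LinearMap.ker P = LinearMap.ker κ) :
    ∃ e : W ≃ₗ[ℝ] U, ∀ v, e (P v) = κ v := by
  refine ⟨(P.quotKerEquivOfSurjective hP).symm ≪≫ₗ
    Submodule.quotEquivOfEq _ _ h ≪≫ₗ κ.quotKerEquivOfSurjective hκ, fun v => ?_⟩
  have : (P.quotKerEquivOfSurjective hP).symm (P v) = Submodule.Quotient.mk v := by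
    rw [LinearEquiv.symm_apply_eq]
    rfl
  simp only [LinearEquiv.trans_apply, this]
  rfl

theorem trace_pi {m : ℕ} (B : Module.End ℝ (Fin m → ℝ)) :
    LinearMap.trace ℝ _ B = ∑ i, B (Pi.single i 1) i := by
  rw [LinearMap.trace_eq_matrix_trace ℝ (Pi.basisFun ℝ (Fin m)), Matrix.trace]
  simp

/-- The trace of an endomorphism and that of its restriction to an invariant subspace. -/
theorem trace_restrict_sub {m : ℕ} (N : Submodule ℝ (Fin m → ℝ)) : ∃ l : Fin m →
    (Fin m → ℝ) →ₗ[ℝ] ℝ, (∀ i, ∀ v ∈ N, l i v = 0) ∧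
      ∀ (A : Module.End ℝ (Fin m → ℝ)) (hA : ∀ v ∈ N, A v ∈ N),
        ∑ i, A (Pi.single i 1) i - LinearMap.trace ℝ N (A.restrict hA)
          = ∑ i, l i (A (Pi.single i 1)) := by
  obtain ⟨r, hr⟩ := N.subtype.exists_leftInverse_of_injective (Submodule.ker_subtype _)
  have hr' : ∀ v : N, r v = v := fun v => congrArg (fun φ => φ v) hr
  -- With `r` a projection onto `N`, the trace of `A` on `N` is that of `r A`, so the difference is
  -- the trace of `(1 - r) A`.
  refine ⟨fun i => LinearMap.proj i ∘ₗ (1 - N.subtype ∘ₗ r), fun i v hv => ?_, fun A hA => ?_⟩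
  · have : (r v : Fin m → ℝ) = v := congrArg Subtype.val (hr' ⟨v, hv⟩)
    simp [this]
  · have h1 : A.restrict hA = r ∘ₗ (A ∘ₗ N.subtype) := LinearMap.ext fun v => by
      simp only [LinearMap.comp_apply]
      exact (hr' ⟨A v, hA v v.2⟩).symm
    have h2 : LinearMap.trace ℝ N (A.restrict hA)
        = LinearMap.trace ℝ _ ((N.subtype ∘ₗ r) ∘ₗ A) := by
      rw [h1, LinearMap.trace_comp_comm', LinearMap.comp_assoc, LinearMap.trace_comp_comm']
    rw [h2, trace_pi, ← Finset.sum_sub_distrib]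
    rfl

end Factor

/-! ### Traces on the homology of a graph -/

section GraphHomology

variable {G : Type u} [TopologicalSpace G] {m : ℕ} {c : Fin m → C(unitInterval, G)}

namespace IsParam

variable [T2Space G] (hc : IsParam c)

theorem wind_seg_lineExt (i j : Fin m) {t : ℝ} (ht : t ∈ Icc (0 : ℝ) 1) :
    wind (hc.circ i) (seg (lineExt (c j)) 0 t) = if j = i then t else 0 := by
  by_cases h : j = i
  · rw [wind_seg (h := ⟨fun x => (projIcc (0 : ℝ) 1 zero_le_one x : ℝ),
      continuous_subtype_val.comp continuous_projIcc⟩) fun x => ?_]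
    · simp [h, projIcc_of_mem _ ht]
    · rw [lineExt_apply, circ_apply, if_pos h]
      rfl
  · rw [wind_seg (h := 0) fun x => ?_]
    · simp [h]
    · rw [lineExt_apply, circ_apply, if_neg h]
      rfl

/-- The winding numbers of a chain. -/
def windPi : (Simp G 1 →₀ ℝ) →ₗ[ℝ] (Fin m → ℝ) := LinearMap.pi fun i => windL (hc.circ i)

theorem windPi_single (γ : Simp G 1) (i : Fin m) :
    hc.windPi (Finsupp.single γ 1) i = wind (hc.circ i) γ := by
  simp [windPi, windL]

theorem windPi_bdry (b : Simp G 2 →₀ ℝ) : hc.windPi (bdry 1 b) = 0 :=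
  funext fun i => windL_bdry (hc.circ i) b

theorem windPi_seg (j : Fin m) {t : ℝ} (ht : t ∈ Icc (0 : ℝ) 1) :
    hc.windPi (Finsupp.single (seg (lineExt (c j)) 0 t) 1) = Pi.single j t := by
  ext i
  rw [windPi_single, wind_seg_lineExt hc i j ht, Pi.single_apply]
  simp [eq_comm]

theorem windPi_sum_edge (x : Fin m → ℝ) :
    hc.windPi (∑ j, x j • Finsupp.single (edge c j) 1) = x := by
  rw [map_sum]
  simp only [map_smul, edge, hc.windPi_seg _ (right_mem_Icc.2 zero_le_one)]
  ext i
  simp [Finset.sum_apply, Pi.single_apply]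

/-- Winding numbers kill boundaries and send the edges to the standard basis, so they recover the
coefficients of the edges. -/
theorem exists_eq_of_cycle {z : Simp G 1 →₀ ℝ} (hz : bdry 0 z = 0) : ∃ b : Simp G 2 →₀ ℝ,
    z = bdry 1 b + ∑ j, hc.windPi z j • Finsupp.single (edge c j) 1 := by
  obtain ⟨y, ⟨b, rfl⟩, e, he, rfl⟩ := Submodule.mem_sup.1 (hc.mem_bdryEdge_of_cycle hz)
  obtain ⟨x, rfl⟩ := (Submodule.mem_span_range_iff_exists_fun ℝ).1 he
  refine ⟨b, ?_⟩
  rw [map_add, windPi_bdry, zero_add, windPi_sum_edge]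

/-- A functional on winding numbers that vanishes on cycles is bounded on all paths. -/
theorem exists_bound_path (l : (Fin m → ℝ) →ₗ[ℝ] ℝ)
    (hl : ∀ z, bdry 0 z = 0 → l (hc.windPi z) = 0) :
    ∃ K, ∀ γ : Simp G 1, |l (hc.windPi (Finsupp.single γ 1))| ≤ K := by
  -- The functional factors through the boundary, so on a path it is the increment of a function `ν`
  -- on `G`. This `ν` is affine along each edge, hence bounded.
  obtain ⟨μ, hμ⟩ := exists_factor_of_ker_le (bdry (G := G) 0) (l ∘ₗ hc.windPi) hl
  let ν : G → ℝ := fun x => μ (Finsupp.single (pnt x) 1)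
  have hν : ∀ γ : Simp G 1, l (hc.windPi (Finsupp.single γ 1)) = ν (γ (vtx 1)) - ν (γ (vtx 0)) :=
    fun γ => by
      refine (hμ _).symm.trans ?_
      rw [bdry_path, map_sub]
  let K : ℝ := ∑ j, (|ν (c j 0)| + |l (Pi.single j 1)|)
  have hK : ∀ x, |ν x| ≤ K := fun x => by
    obtain ⟨j, t, rfl⟩ := hc.surj x
    have h := hν (seg (lineExt (c j)) 0 (t : ℝ))
    rw [windPi_seg hc j t.2] at h
    have h1 : (seg (lineExt (c j)) 0 (t : ℝ)) (vtx 1) = c j t := by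
      simp [seg_apply, vtx_apply_self, vtx_apply_ne, lineExt_coe]
    have h0 : (seg (lineExt (c j)) 0 (t : ℝ)) (vtx 0) = c j 0 := by
      simp [seg_apply, vtx_apply_ne, lineExt_zero]
    have h2 : l (Pi.single j (t : ℝ)) = t * l (Pi.single j 1) := by
      rw [← smul_eq_mul, ← map_smul, ← Pi.single_smul, smul_eq_mul, mul_one]
    rw [h0, h1, h2] at h
    have h3 : ν (c j t) = ν (c j 0) + t * l (Pi.single j 1) := by linarith
    calc |ν (c j t)| ≤ |ν (c j 0)| + |t * l (Pi.single j 1)| := h3 ▸ abs_add_le _ _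
      _ ≤ |ν (c j 0)| + |l (Pi.single j 1)| := by
        rw [abs_mul, abs_of_nonneg t.2.1]
        gcongr
        exact mul_le_of_le_one_left (abs_nonneg _) t.2.2
      _ ≤ K := Finset.single_le_sum (f := fun j => |ν (c j 0)| + |l (Pi.single j 1)|)
        (fun j _ => by positivity) (Finset.mem_univ j)
  refine ⟨K + K, fun γ => ?_⟩
  rw [hν]
  exact (abs_sub _ _).trans (add_le_add (hK _) (hK _))

/-- The trace in the first homology, up to a bounded error. -/
theorem exists_bound_trace_one : ∃ K, ∀ g : C(G, G),
    |LinearMap.trace ℝ _ (homologyMap g 1) - ∑ i, wind (hc.circ i) (g.comp (edge c i))| ≤ K := by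
  let Z := LinearMap.ker (bdry (G := G) 0)
  -- The winding vectors of cycles form a subspace `N` of `ℝᵐ` isomorphic to `H₁`.
  let N : Submodule ℝ (Fin m → ℝ) := Z.map hc.windPi
  obtain ⟨l, hl, hlA⟩ := trace_restrict_sub N
  choose K hK using fun i => hc.exists_bound_path (l i) fun z hz => hl i _ ⟨z, hz, rfl⟩
  obtain ⟨κ, hκs, hκ0, hκ⟩ := exists_homology_class_one G
  let P : Z →ₗ[ℝ] N := (hc.windPi ∘ₗ Z.subtype).codRestrict N fun z => ⟨z, z.2, rfl⟩
  have hPs : Surjective P := by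
    rintro ⟨_, z, hz, rfl⟩
    exact ⟨⟨z, hz⟩, rfl⟩
  have hker : LinearMap.ker P = LinearMap.ker κ := by
    ext z
    rw [LinearMap.mem_ker, LinearMap.mem_ker, hκ0]
    constructor
    · intro h
      have h' : hc.windPi z = 0 := congrArg Subtype.val h
      obtain ⟨b, hb⟩ := hc.exists_eq_of_cycle z.2
      exact ⟨b, by rw [hb, h']; simp⟩
    · rintro ⟨b, hb⟩
      refine Subtype.ext ?_
      change hc.windPi z = 0
      rw [← hb, windPi_bdry]
  obtain ⟨e, he⟩ := exists_equiv_of_ker_eq (V := Z) (W := N)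
    (U := (chainCx G).homology 1) P κ hPs hκs hker
  refine ⟨∑ i, K i, fun g => ?_⟩
  -- The columns are the winding vectors of the images of the edges, which need not be cycles. Only
  -- the restriction of `A` to `N` is the action of `g` on `H₁`.
  let A : Module.End ℝ (Fin m → ℝ) := Fintype.linearCombination ℝ fun i =>
    hc.windPi (Finsupp.single (g.comp (edge c i)) 1)
  have hA1 : ∀ i, A (Pi.single i 1) = hc.windPi (Finsupp.single (g.comp (edge c i)) 1) := fun i => by
    simp [A]
  have hAz : ∀ z, bdry 0 z = 0 → A (hc.windPi z) = hc.windPi (push g 1 z) := fun z hz => by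
    obtain ⟨b, hb⟩ := hc.exists_eq_of_cycle hz
    conv_rhs => rw [hb, map_add, ← bdry_push, map_add, windPi_bdry, zero_add]
    have hp : ∀ j, push g 1 (Finsupp.single (edge c j) 1)
        = Finsupp.single (g.comp (edge c j)) 1 := fun j => by
      rw [push, Finsupp.lmapDomain_apply, Finsupp.mapDomain_single]
    rw [map_sum, map_sum]
    simp only [map_smul, hp]
    rw [Fintype.linearCombination_apply]
  have hpush : ∀ z ∈ Z, push g 1 z ∈ Z := fun z hz => by
    rw [LinearMap.mem_ker] at hz ⊢
    rw [bdry_push, hz, map_zero]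
  have hAN : ∀ v ∈ N, A v ∈ N := by
    rintro _ ⟨z, hz, rfl⟩
    rw [hAz z hz]
    exact ⟨_, hpush z hz, rfl⟩
  have htr : LinearMap.trace ℝ _ (homologyMap g 1) = LinearMap.trace ℝ N (A.restrict hAN) := by
    have : homologyMap g 1 = e.conj (A.restrict hAN) := by
      refine LinearMap.ext fun h => ?_
      obtain ⟨z, rfl⟩ := hκs h
      have h1 : A.restrict hAN (P z) = P ⟨_, hpush z z.2⟩ := Subtype.ext (hAz z z.2)
      have h2 : e.conj (A.restrict hAN) (κ z) = κ ⟨_, hpush z z.2⟩ := by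
        rw [LinearEquiv.conj_apply_apply, ← he z, LinearEquiv.symm_apply_apply, ← he, h1]
      exact (hκ g z ⟨_, hpush z z.2⟩ rfl).trans h2.symm
    rw [this]
    exact LinearMap.trace_conj' _ _
  have h1 : ∑ i, wind (hc.circ i) (g.comp (edge c i)) = ∑ i, A (Pi.single i 1) i := by
    simp only [hA1, windPi_single]
  -- The error is a sum of functionals vanishing on `N`, evaluated at winding vectors of paths, so
  -- its bound does not depend on `g`.
  rw [htr, h1, abs_sub_comm, hlA A hAN]
  refine (Finset.abs_sum_le_sum_abs _ _).trans (Finset.sum_le_sum fun i _ => ?_)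
  rw [hA1]
  exact hK i _

omit [T2Space G] in
include hc in
/-- The trace in homology of degree `0` is bounded. -/
theorem exists_bound_trace_zero : ∃ K, ∀ g : C(G, G),
    |LinearMap.trace ℝ _ (homologyMap g 0)| ≤ K := by
  obtain ⟨κ, hκs, hκ0, hκ⟩ := exists_homology_class_zero G
  let v : Fin m → (chainCx G).homology 0 := fun j => κ (Finsupp.single (pnt (c j 0)) 1)
  have hv : ∀ x : G, ∃ j, κ (Finsupp.single (pnt x) 1) = v j := fun x => by
    obtain ⟨j, t, rfl⟩ := hc.surj x
    refine ⟨j, ?_⟩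
    have h := hκ0 (Finsupp.single (seg (lineExt (c j)) 0 (t : ℝ)) 1)
    rw [bdry_path, map_sub, sub_eq_zero] at h
    simpa [seg_apply, vtx_apply_self, vtx_apply_ne, lineExt_coe, lineExt_zero] using h
  -- The origins of the edges span `H₀`, and their classes are mapped to one another, so only
  -- finitely many endomorphisms occur.
  let T : Set (Module.End ℝ ((chainCx G).homology 0)) :=
    ⋃ τ : Fin m → Fin m, {B | ∀ j, B (v j) = v (τ j)}
  have hT : T.Finite := by
    refine Set.finite_iUnion fun τ => Set.Subsingleton.finite fun B hB B' hB' => ?_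
    have : B ∘ₗ κ = B' ∘ₗ κ := by
      refine Finsupp.lhom_ext' fun σ => LinearMap.ext_ring ?_
      simp only [LinearMap.comp_apply, Finsupp.lsingle_apply]
      rw [eq_pnt σ]
      obtain ⟨j, hj⟩ := hv (σ default)
      rw [hj]
      exact (hB j).trans (hB' j).symm
    refine LinearMap.ext fun h => ?_
    obtain ⟨z, rfl⟩ := hκs h
    exact congrArg (fun φ => φ z) this
  obtain ⟨K, hK⟩ := (hT.image fun B => |LinearMap.trace ℝ _ B|).bddAbove
  refine ⟨K, fun g => hK ⟨homologyMap g 0, ?_, rfl⟩⟩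
  choose τ hτ using fun j => hv (g (c j 0))
  refine mem_iUnion.2 ⟨τ, fun j => ?_⟩
  refine (hκ g _).trans ((congrArg κ ?_).trans (hτ j))
  rw [push, Finsupp.lmapDomain_apply, Finsupp.mapDomain_single]
  rfl

end IsParam

theorem homologyMap_comp (f g : C(G, G)) (i : ℕ) :
    homologyMap (f.comp g) i = homologyMap f i * homologyMap g i := by
  simp only [homologyMap]
  have : TopCat.ofHom (f.comp g) = CategoryTheory.CategoryStruct.comp (TopCat.ofHom g) (TopCat.ofHom f) := rfl
  rw [this, CategoryTheory.Functor.map_comp]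
  rfl

theorem homologyMap_iterate (f : C(G, G)) (i n : ℕ) :
    homologyMap ⟨f^[n], f.continuous.iterate n⟩ i = homologyMap f i ^ n := by
  induction n with
  | zero =>
    have : (⟨f^[0], f.continuous.iterate 0⟩ : C(G, G)) = ContinuousMap.id G := rfl
    rw [this, pow_zero, homologyMap, TopCat.ofHom_id, CategoryTheory.Functor.map_id]
    rfl
  | succ n ih =>
    rw [pow_succ, ← ih, ← homologyMap_comp]
    rfl

end GraphHomology


/-! ### Induced graph maps -/

namespace PMMap

variable {F : PMMap}

theorem exists_iterate_mem_C {n : ℕ} {s : ℝ} (hs : s ∈ F.iterC n) :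
    ∃ k, s ∈ F.Ω ∧ s ∉ F.iterC k ∧ F.toFun^[k] s ∈ F.C := by
  induction n generalizing s with
  | zero => exact absurd hs (notMem_empty s)
  | succ n ih =>
    obtain ⟨hΩ, hs⟩ := hs
    by_cases hC : s ∈ F.C
    · exact ⟨0, hΩ, notMem_empty s, hC⟩
    · obtain ⟨k, -, h1, h2⟩ := ih (hs.resolve_left hC)
      exact ⟨k + 1, hΩ, fun h => h.2.elim hC h1, h2⟩

theorem finite_boundary : F.boundary.Finite := by
  refine Finite.of_finite_image (f := Subtype.val) ?_ Subtype.val_injective.injOn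
  refine ((finite_range F.a).union (finite_range F.b)).subset ?_
  rintro _ ⟨x, ⟨i, h | h⟩, rfl⟩
  · exact Or.inl ⟨i, h.symm⟩
  · exact Or.inr ⟨i, h.symm⟩

theorem mem_boundary_iff {i : Fin F.m} {x : F.Ω} (hx : (x : ℝ) ∈ Icc (F.a i) (F.b i)) :
    x ∈ F.boundary ↔ (x : ℝ) = F.a i ∨ (x : ℝ) = F.b i := by
  refine ⟨?_, fun h => ⟨i, h⟩⟩
  rintro ⟨j, h⟩
  have hj : (x : ℝ) ∈ Icc (F.a j) (F.b j) := by
    rcases h with h | h <;> rw [h]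
    · exact left_mem_Icc.2 (F.a_lt_b j).le
    · exact right_mem_Icc.2 (F.a_lt_b j).le
  rwa [eq_of_mem_Icc hx hj]

theorem mem_Ioo_of_notMem_boundary {x : F.Ω} (hx : x ∉ F.boundary) :
    ∃ i, (x : ℝ) ∈ Ioo (F.a i) (F.b i) := by
  obtain ⟨i, hi⟩ := F.exists_mem_Icc x
  rw [mem_boundary_iff hi, not_or] at hx
  exact ⟨i, lt_of_le_of_ne hi.1 (Ne.symm hx.1), lt_of_le_of_ne hi.2 hx.2⟩

theorem notMem_boundary_of_mem_Ioo {i : Fin F.m} {x : F.Ω} (hx : (x : ℝ) ∈ Ioo (F.a i) (F.b i)) :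
    x ∉ F.boundary := by
  rw [mem_boundary_iff (Ioo_subset_Icc_self hx), not_or]
  exact ⟨hx.1.ne', hx.2.ne⟩

/-- The affine parametrization of the `i`-th interval. -/
def param (F : PMMap) (i : Fin F.m) (t : unitInterval) : F.Ω :=
  ⟨F.a i + t * (F.b i - F.a i), Icc_subset_Ω i (by
    have := F.a_lt_b i
    have h0 := t.2.1
    have h1 := t.2.2
    constructor <;> nlinarith)⟩

theorem continuous_param (i : Fin F.m) : Continuous (F.param i) := by
  unfold param; fun_prop

theorem coord_param (i : Fin F.m) (t : unitInterval) : F.coord i (F.param i t) = t := by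
  have := sub_pos.2 (F.a_lt_b i)
  simp only [coord, param]
  field_simp
  ring

theorem param_mem (i : Fin F.m) (t : unitInterval) :
    (F.param i t : ℝ) ∈ Icc (F.a i) (F.b i) := by
  rw [mem_Icc, ← coord_le, ← coord_le (t := F.b i), coord_param, coord_a, coord_b]
  exact t.2

theorem coord_injective (i : Fin F.m) : Injective (F.coord i) := fun _ _ h =>
  le_antisymm (coord_le.1 h.le) (coord_le.1 h.ge)

theorem param_coord {i : Fin F.m} {x : F.Ω} (hx : (x : ℝ) ∈ Icc (F.a i) (F.b i)) :
    F.param i ⟨F.coord i x, coord_mem hx⟩ = x :=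
  Subtype.ext (coord_injective i (coord_param i _))

theorem param_mem_boundary_iff {i : Fin F.m} {t : unitInterval} :
    F.param i t ∈ F.boundary ↔ t = 0 ∨ t = 1 := by
  rw [mem_boundary_iff (param_mem i t), ← (coord_injective i).eq_iff,
    ← (coord_injective i).eq_iff (b := F.b i), coord_param, coord_a, coord_b]
  simp

end PMMap

section Induced

open PMMap

variable {G : Type u} [TopologicalSpace G] {f : C(G, G)} {F : PMMap} {π : F.Ω → G}

namespace IsInducedVia

variable (h : IsInducedVia f F π)
include h

theorem notMem_image_boundary {x : F.Ω} (hx : x ∉ F.boundary) : π x ∉ π '' F.boundary := by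
  have : π x ∈ π '' F.boundaryᶜ := ⟨x, hx, rfl⟩
  rwa [h.image_eq] at this

theorem eq_of_notMem_boundary {x y : F.Ω} (hx : x ∉ F.boundary) (hxy : π x = π y) : x = y := by
  have hy : y ∉ F.boundary := fun hy => h.notMem_image_boundary hx (hxy ▸ ⟨y, hy, rfl⟩)
  exact congrArg Subtype.val (h.isEmbedding.injective (a₁ := ⟨x, hx⟩) (a₂ := ⟨y, hy⟩) hxy)

theorem surjective : Surjective π := fun g => by
  by_cases hg : g ∈ π '' F.boundary
  · obtain ⟨x, -, hx⟩ := hg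
    exact ⟨x, hx⟩
  · rw [← mem_compl_iff, ← h.image_eq] at hg
    obtain ⟨x, -, hx⟩ := hg
    exact ⟨x, hx⟩

theorem iterate {n : ℕ} {x y : F.Ω} (hx : (x : ℝ) ∉ F.iterC n)
    (hy : (y : ℝ) = F.toFun^[n] x) : π y = f^[n] (π x) := by
  induction n generalizing x with
  | zero => exact congrArg π (Subtype.ext hy)
  | succ n ih =>
    have hC : (x : ℝ) ∉ F.C := fun hC => hx ⟨x.2, Or.inl hC⟩
    have h1 : ((F.app x hC : F.Ω) : ℝ) ∉ F.iterC n := fun h => hx ⟨x.2, Or.inr h⟩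
    rw [iterate_succ_apply, ← h.comm x hC]
    exact ih h1 hy

/-- The edges of the graph. -/
def edges (i : Fin F.m) : C(unitInterval, G) := ⟨fun t => π (F.param i t),
  h.continuous.comp (continuous_param i)⟩

theorem edges_coord {i : Fin F.m} {x : F.Ω} (hx : (x : ℝ) ∈ Icc (F.a i) (F.b i)) :
    h.edges i ⟨F.coord i x, coord_mem hx⟩ = π x :=
  congrArg π (param_coord hx)

theorem isParam : IsParam h.edges where
  surj g := by
    obtain ⟨x, rfl⟩ := h.surjective g
    obtain ⟨i, hi⟩ := F.exists_mem_Icc x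
    exact ⟨i, _, h.edges_coord hi⟩
  inj j k t u e := by
    by_cases hb : F.param j t ∈ F.boundary
    · by_cases hb' : F.param k u ∈ F.boundary
      · exact Or.inr ⟨param_mem_boundary_iff.1 hb, param_mem_boundary_iff.1 hb'⟩
      · have := h.eq_of_notMem_boundary hb' e.symm
        exact absurd (this ▸ hb) hb'
    · have := h.eq_of_notMem_boundary hb e
      have hjk : j = k := eq_of_mem_Icc (param_mem j t) (this ▸ param_mem k u)
      subst hjk
      refine Or.inl ⟨rfl, Subtype.ext ?_⟩
      rw [← coord_param j t, this, coord_param]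

open Classical in
theorem circ_apply [T2Space G] (i : Fin F.m) (x : F.Ω) : h.isParam.circ i (π x)
    = ((if (x : ℝ) ∈ Icc (F.a i) (F.b i) then F.coord i x else 0 : ℝ) : AddCircle (1 : ℝ)) := by
  obtain ⟨j, hj⟩ := F.exists_mem_Icc x
  rw [← h.edges_coord hj, h.isParam.circ_apply]
  by_cases hji : j = i
  · subst hji
    rw [if_pos rfl, if_pos hj]
  · rw [if_neg hji, if_neg fun hi => hji (eq_of_mem_Icc hj hi)]
    rfl

/-- The lifts of the maps to the circles given by the edges. -/
theorem exists_isCircleLift [T2Space G] (n : ℕ) (i : Fin F.m) : ∃ l : ℝ → ℝ,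
    F.IsCircleLift n i l ∧
    (∀ x : F.Ω, (x : ℝ) ∈ Icc (F.a i) (F.b i) →
      ((l x : ℝ) : AddCircle (1 : ℝ)) = h.isParam.circ i (f^[n] (π x))) ∧
    wind (h.isParam.circ i) ((⟨f^[n], f.continuous.iterate n⟩ : C(G, G)).comp (edge h.edges i))
      = l (F.b i) - l (F.a i) := by
  classical
  let fn : C(G, G) := ⟨f^[n], f.continuous.iterate n⟩
  obtain ⟨θ, hθ⟩ := exists_lift ((h.isParam.circ i).comp (fn.comp (lineExt (h.edges i))))
  have hl : ∀ x : F.Ω, (x : ℝ) ∈ Icc (F.a i) (F.b i) →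
      ((θ (F.coord i x) : ℝ) : AddCircle (1 : ℝ)) = h.isParam.circ i (f^[n] (π x)) := by
    intro x hx
    rw [hθ]
    have : lineExt (h.edges i) (F.coord i x) = π x :=
      (lineExt_coe _ ⟨F.coord i x, coord_mem hx⟩).trans (h.edges_coord hx)
    simp only [ContinuousMap.comp_apply, this]
    rfl
  refine ⟨fun s => θ (F.coord i s), ⟨(θ.continuous.comp (continuous_coord i)).continuousOn,
    fun s hs hsC => ?_⟩, hl, ?_⟩
  · have hsΩ : s ∈ F.Ω := Icc_subset_Ω i (Ioo_subset_Icc_self hs)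
    have h1 := hl ⟨s, hsΩ⟩ (Ioo_subset_Icc_self hs)
    rw [← h.iterate (x := ⟨s, hsΩ⟩) (y := ⟨_, iterate_mem_Ω hsΩ hsC⟩) hsC rfl, h.circ_apply] at h1
    exact (coe_eq_coe_iff _ _).1 h1
  · simp only [coord_a, coord_b]
    exact wind_seg θ hθ 0 1

/-- The points of the periodic orbits through the images of the points of `C`. -/
def criticalOrbits (_ : IsInducedVia f F π) : Set G :=
  ⋃ x ∈ {x | x ∈ π '' (Subtype.val ⁻¹' (F.C : Set ℝ)) ∧ x ∈ periodicPts f},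
    (fun k => f^[k] x) '' (Iio (minimalPeriod f x))

theorem finite_criticalOrbits : h.criticalOrbits.Finite := by
  refine Set.Finite.biUnion ?_ fun x _ => (finite_Iio _).image _
  refine Finite.subset (Finite.image π ?_) fun x hx => hx.1
  exact F.C.finite_toSet.preimage Subtype.val_injective.injOn

/-- The orbit of `x` reaches `C`. As `π x` is periodic, the image of that point of `C` is periodic
too, and `π x` lies on its cycle. -/
theorem mem_criticalOrbits {n k : ℕ} (hn : n ≠ 0) {x : F.Ω} (hx : (x : ℝ) ∈ F.iterC k)
    (hfx : f^[n] (π x) = π x) : π x ∈ h.criticalOrbits := by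
  obtain ⟨k, -, hk, hC⟩ := exists_iterate_mem_C hx
  have e := h.iterate (y := ⟨_, F.C_subset hC⟩) hk rfl
  have hp : IsPeriodicPt f n (π x) := hfx
  have hp' : f^[k] (π x) ∈ periodicPts f := ⟨n, Nat.pos_of_ne_zero hn, hp.apply_iterate k⟩
  refine mem_biUnion (x := f^[k] (π x)) ⟨⟨⟨_, F.C_subset hC⟩, hC, e⟩, hp'⟩ ?_
  -- After `k` steps, `n * k - k` more steps lead back to `π x`.
  refine ⟨(n * k - k) % minimalPeriod f (f^[k] (π x)),
    Nat.mod_lt _ (minimalPeriod_pos_of_mem_periodicPts hp'), ?_⟩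
  change f^[_] _ = _
  rw [iterate_mod_minimalPeriod_eq, ← iterate_add_apply,
    Nat.sub_add_cancel (Nat.le_mul_of_pos_left k (Nat.pos_of_ne_zero hn))]
  exact hp.mul_const k

/-- At such a cut point `s`, the points `fⁿ(π s)` and `π s` have the same image in the circle. The
circle map is injective over the interior of the edge, so `π s` is fixed by `fⁿ` and lies on a
critical orbit. The bound is independent of `n`. -/
theorem ncard_cutInt_le [T2Space G] {n : ℕ} (hn : n ≠ 0) (i : Fin F.m) {l : ℝ → ℝ}
    (hl : ∀ x : F.Ω, (x : ℝ) ∈ Icc (F.a i) (F.b i) →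
      ((l x : ℝ) : AddCircle (1 : ℝ)) = h.isParam.circ i (f^[n] (π x))) :
    (F.cutInt n i l (F.a i) (F.b i)).ncard ≤ h.criticalOrbits.ncard := by
  classical
  have hΩ : ∀ s ∈ F.cutInt n i l (F.a i) (F.b i), s ∈ F.Ω := fun s hs =>
    Icc_subset_Ω i (Ioo_subset_Icc_self hs.1)
  refine ncard_le_ncard_of_injOn (fun s => if hs : s ∈ F.Ω then π ⟨s, hs⟩ else π ⟨_, F.a_mem_Ω i⟩)
    (fun s hs => ?_) (fun s hs t ht hst => ?_) h.finite_criticalOrbits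
  · simp only [hΩ s hs, dif_pos]
    obtain ⟨hsI, hsC, hk⟩ := hs
    have hsI' := Ioo_subset_Icc_self hsI
    have hsΩ : s ∈ F.Ω := Icc_subset_Ω i hsI'
    refine h.mem_criticalOrbits (x := ⟨s, hsΩ⟩) hn hsC ?_
    obtain ⟨y, hy⟩ := h.surjective (f^[n] (π ⟨s, hsΩ⟩))
    have h1 := hl ⟨s, hsΩ⟩ hsI'
    rw [← hy, (coe_eq_coe_iff _ _).2 hk, h.circ_apply] at h1
    obtain ⟨k, hk'⟩ := (coe_eq_coe_iff _ _).1 h1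
    have c0 : 0 < F.coord i s := by rw [← coord_a i, coord_lt]; exact hsI.1
    have c1 : F.coord i s < 1 := by rw [← coord_b i, coord_lt]; exact hsI.2
    have hk0 : ∀ r : ℝ, 0 ≤ r → r ≤ 1 → F.coord i s - r = k → F.coord i s = r := by
      intro r r0 r1 hr
      have l1 : (-1 : ℝ) < k := by linarith
      have l2 : (k : ℝ) < 1 := by linarith
      have l3 : -1 < k := by exact_mod_cast l1
      have l4 : k < 1 := by exact_mod_cast l2
      have : k = 0 := by omega
      rw [this, Int.cast_zero, sub_eq_zero] at hr
      exact hr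
    rw [← hy]
    by_cases hyI : (y : ℝ) ∈ Icc (F.a i) (F.b i)
    · rw [if_pos hyI] at hk'
      have := hk0 _ (coord_mem hyI).1 (coord_mem hyI).2 hk'
      exact congrArg π (Subtype.ext (coord_injective i this)).symm
    · rw [if_neg hyI] at hk'
      exact absurd (hk0 0 le_rfl zero_le_one hk') c0.ne'
  · simp only [hΩ s hs, hΩ t ht, dif_pos] at hst
    exact congrArg Subtype.val (h.eq_of_notMem_boundary (notMem_boundary_of_mem_Ioo hs.1) hst)

end IsInducedVia

end Induced


/-! ### Fixed points of negative type, and the uniform bound -/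

section Induced

open PMMap

variable {G : Type u} [TopologicalSpace G] {f : C(G, G)} {F : PMMap} {π : F.Ω → G}

namespace IsInducedVia

variable (h : IsInducedVia f F π)
include h

/-- The chart of the graph given by `π`. -/
theorem exists_chart [T2Space G] {x₀ : F.Ω} (hx₀ : x₀ ∉ F.boundary) :
    ∃ e : OpenPartialHomeomorph G ℝ, (∀ x : F.Ω, π x ∈ e.source ↔ x ∉ F.boundary) ∧
      ∀ x : F.Ω, x ∉ F.boundary → e (π x) = x := by
  have hne : Nonempty (F.boundaryᶜ : Set F.Ω) := ⟨⟨x₀, hx₀⟩⟩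
  have h1 : IsOpenEmbedding (F.boundaryᶜ.domRestrict π) := by
    refine ⟨h.isEmbedding, ?_⟩
    rw [range_domRestrict, h.image_eq]
    exact (finite_boundary.image π).isClosed.isOpen_compl
  have h2 : IsOpenEmbedding fun x : (F.boundaryᶜ : Set F.Ω) => ((x : F.Ω) : ℝ) := by
    refine ⟨IsEmbedding.subtypeVal.comp IsEmbedding.subtypeVal, ?_⟩
    have : range (fun x : (F.boundaryᶜ : Set F.Ω) => ((x : F.Ω) : ℝ))
        = ⋃ i, Ioo (F.a i) (F.b i) := by
      ext s
      rw [mem_iUnion]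
      constructor
      · rintro ⟨x, rfl⟩
        exact mem_Ioo_of_notMem_boundary x.2
      · rintro ⟨i, hi⟩
        exact ⟨⟨⟨s, Icc_subset_Ω i (Ioo_subset_Icc_self hi)⟩, notMem_boundary_of_mem_Ioo hi⟩, rfl⟩
    rw [this]
    exact isOpen_iUnion fun i => isOpen_Ioo
  let e₁ := h1.toOpenPartialHomeomorph
  let e₂ := h2.toOpenPartialHomeomorph
  refine ⟨e₁.symm.trans e₂, fun x => ?_, fun x hx => ?_⟩
  · have : (e₁.symm.trans e₂).source = π '' F.boundaryᶜ := by
      simp [e₁, e₂, range_domRestrict]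
    rw [this]
    refine ⟨?_, fun hx => ⟨x, hx, rfl⟩⟩
    rintro ⟨y, hy, hyx⟩
    rwa [← h.eq_of_notMem_boundary hy hyx]
  · have h3 : e₁ ⟨x, hx⟩ = π x := rfl
    have h4 : e₁.symm (π x) = ⟨x, hx⟩ := by
      rw [← h3]
      exact e₁.left_inv (by simp [e₁])
    change e₂ (e₁.symm (π x)) = x
    rw [h4]
    rfl

/-- Decreasing fixed points of the piecewise monotone map give fixed points of negative type. -/
theorem mem_fixNeg [T2Space G] {n : ℕ} {i : Fin F.m} {x : F.Ω}
    (hx : (x : ℝ) ∈ F.decFix n (F.a i) (F.b i)) : π x ∈ fixNeg f^[n] := by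
  obtain ⟨hxI, hxC, hfx, U, hU, hanti⟩ := hx
  have hxb := notMem_boundary_of_mem_Ioo hxI
  obtain ⟨e, hes, he⟩ := h.exists_chart hxb
  have hfix : f^[n] (π x) = π x := (h.iterate hxC hfx.symm).symm
  have hfn : Continuous f^[n] := f.continuous.iterate n
  have hsrc : e.source ∈ 𝓝 (π x) := e.open_source.mem_nhds ((hes x).2 hxb)
  have hV : U ∩ (F.iterC n)ᶜ ∈ 𝓝 (e (π x)) := by
    rw [he x hxb]
    exact Filter.inter_mem hU ((finite_iterC n).isClosed.isOpen_compl.mem_nhds hxC)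
  refine ⟨hfix, fun hv => h.notMem_image_boundary hxb (h.vertices_subset hv), e,
    e.source ∩ (f^[n] ⁻¹' e.source ∩ e ⁻¹' (U ∩ (F.iterC n)ᶜ)),
    Filter.inter_mem hsrc (Filter.inter_mem (hfn.continuousAt.preimage_mem_nhds
      (by rwa [hfix])) ((e.continuousAt ((hes x).2 hxb)).preimage_mem_nhds hV)),
    inter_subset_left, ?_, ?_⟩
  · rintro _ ⟨y, hy, rfl⟩
    exact hy.2.1
  · have key : ∀ y ∈ e.source ∩ (f^[n] ⁻¹' e.source ∩ e ⁻¹' (U ∩ (F.iterC n)ᶜ)),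
        e (f^[n] y) = F.toFun^[n] (e y) ∧ e y ∈ U := by
      intro y hy
      obtain ⟨s, rfl⟩ := h.surjective y
      obtain ⟨h1, h2, h3⟩ := hy
      rw [hes] at h1
      rw [mem_preimage, he s h1] at h3
      have h4 := h.iterate (y := ⟨_, iterate_mem_Ω s.2 h3.2⟩) h3.2 rfl
      rw [mem_preimage, ← h4, hes] at h2
      rw [← h4, he _ h2, he s h1]
      exact ⟨rfl, h3.1⟩
    intro y hy z hz hyz
    rw [(key y hy).1, (key z hz).1]
    exact hanti (key y hy).2 (key z hz).2 hyz

/-- Up to finitely many exceptions that do not depend on `n`, the fixed points of negative type are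
given by decreasing fixed points of the piecewise monotone map. -/
theorem mem_decFix_of_mem_fixNeg [T2Space G] {n : ℕ} (hn : n ≠ 0) {x : F.Ω} (hx : x ∉ F.boundary)
    (hxc : π x ∉ h.criticalOrbits) (hfx : π x ∈ fixNeg f^[n]) :
    ∃ i, (x : ℝ) ∈ F.decFix n (F.a i) (F.b i) := by
  obtain ⟨hfix, -, e', U, hU, hUs, hfUs, hdec⟩ := hfx
  obtain ⟨i, hi⟩ := mem_Ioo_of_notMem_boundary hx
  have hxC : (x : ℝ) ∉ F.iterC n := fun hC => hxc (h.mem_criticalOrbits hn hC hfix)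
  obtain ⟨e, hes, he⟩ := h.exists_chart hx
  have hfn : Continuous f^[n] := f.continuous.iterate n
  have hxs := (hes x).2 hx
  have hFx : F.toFun^[n] x = x := by
    have h1 := h.iterate (y := ⟨_, iterate_mem_Ω x.2 hxC⟩) hxC rfl
    rw [hfix] at h1
    exact congrArg Subtype.val (h.eq_of_notMem_boundary hx h1.symm).symm
  -- the inverse of the chart, and the transition map
  have hσ : ∀ y : F.Ω, y ∉ F.boundary → e.symm y = π y := fun y hy => by
    rw [← he y hy]
    exact e.left_inv ((hes y).2 hy)
  have hσx : e.symm (x : ℝ) = π x := hσ x hx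
  have hxt : (x : ℝ) ∈ e.target := by
    rw [← he x hx]
    exact e.map_source hxs
  have hσc : ContinuousAt e.symm (x : ℝ) := e.continuousAt_symm hxt
  have hA : e.target ∩ e.symm ⁻¹' U ∈ 𝓝 (x : ℝ) :=
    Filter.inter_mem (e.open_target.mem_nhds hxt) (hσc.preimage_mem_nhds (by rwa [hσx]))
  obtain ⟨a, b, hab, hJ⟩ := mem_nhds_iff_exists_Ioo_subset.1 hA
  -- The chart `e'` is arbitrary, but the transition map is continuous and injective on an interval,
  -- hence strictly monotone. Conjugation by it preserves decreasing maps, whatever its orientation.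
  have hg : StrictMonoOn (e' ∘ e.symm) (Ioo a b) ∨ StrictAntiOn (e' ∘ e.symm) (Ioo a b) := by
    refine ContinuousOn.strictMonoOn_of_injOn_Ioo (hab.1.trans hab.2) ?_ ?_
    · refine e'.continuousOn.comp (e.continuousOn_symm.mono fun s hs => (hJ hs).1) fun s hs => ?_
      exact hUs (hJ hs).2
    · intro s hs t ht hst
      exact e.symm.injOn (hJ hs).1 (hJ ht).1 (e'.injOn (hUs (hJ hs).2) (hUs (hJ ht).2) hst)
  have hB : Ioo a b ∩ (F.iterC n)ᶜ ∩ (fun s => f^[n] (e.symm s)) ⁻¹' (e.source ∩ e ⁻¹' Ioo a b)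
      ∈ 𝓝 (x : ℝ) := by
    refine Filter.inter_mem (Filter.inter_mem (Ioo_mem_nhds hab.1 hab.2)
      ((finite_iterC n).isClosed.isOpen_compl.mem_nhds hxC)) ?_
    have hc : ContinuousAt (fun s => f^[n] (e.symm s)) (x : ℝ) :=
      hfn.continuousAt.comp hσc
    refine hc.preimage_mem_nhds ?_
    rw [hσx, hfix]
    refine Filter.inter_mem (e.open_source.mem_nhds hxs)
      ((e.continuousAt hxs).preimage_mem_nhds ?_)
    rw [he x hx]
    exact Ioo_mem_nhds hab.1 hab.2
  have key : ∀ s ∈ Ioo a b ∩ (F.iterC n)ᶜ ∩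
      (fun s => f^[n] (e.symm s)) ⁻¹' (e.source ∩ e ⁻¹' Ioo a b),
      F.toFun^[n] s ∈ Ioo a b ∧ e.symm (F.toFun^[n] s) = f^[n] (e.symm s) := by
    rintro s ⟨⟨hs, hsC⟩, h2, h3⟩
    obtain ⟨y, hy⟩ := h.surjective (e.symm s)
    have hys := e.map_target (hJ hs).1
    rw [← hy, hes] at hys
    have hsy : (y : ℝ) = s := by
      rw [← he y hys, hy]
      exact e.right_inv (hJ hs).1
    subst hsy
    have h4 := h.iterate (y := ⟨_, iterate_mem_Ω y.2 hsC⟩) hsC rfl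
    rw [hy] at h4
    change f^[n] (e.symm y) ∈ e.source at h2
    change e (f^[n] (e.symm y)) ∈ Ioo a b at h3
    rw [← h4] at h3
    rw [← h4, hes] at h2
    rw [he _ h2] at h3
    refine ⟨h3, ?_⟩
    rw [← h4]
    exact hσ ⟨F.toFun^[n] y, _⟩ h2
  refine ⟨i, hi, hxC, hFx, _, hB, fun s hs t ht hst => ?_⟩
  obtain ⟨hs1, hs2⟩ := key s hs
  obtain ⟨ht1, ht2⟩ := key t ht
  have hsU := (hJ hs.1.1).2
  have htU := (hJ ht.1.1).2
  rcases hg with hg | hg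
  · have := hdec _ hsU _ htU (hg hs.1.1 ht.1.1 hst)
    rw [← hs2, ← ht2] at this
    exact (hg.lt_iff_lt ht1 hs1).1 this
  · have := hdec _ htU _ hsU (hg hs.1.1 ht.1.1 hst)
    rw [← hs2, ← ht2] at this
    exact (hg.lt_iff_gt hs1 ht1).1 this

/-- With `D` the set of decreasing fixed points of `Fⁿ`, on which `π` is injective, one has `π(D) ⊆
Fix⁻(fⁿ) ⊆ π(D) ∪ B`, where the finite set `B` of critical orbits and images of endpoints does not
depend on `n`. -/
theorem exists_bound_fixNeg [T2Space G] : ∃ K : ℝ, ∀ n, n ≠ 0 →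
    (∀ i, (F.decFix n (F.a i) (F.b i)).Finite) →
    |((fixNeg f^[n]).ncard : ℝ) - ∑ i, ((F.decFix n (F.a i) (F.b i)).ncard : ℝ)| ≤ K := by
  classical
  let B : Set G := h.criticalOrbits ∪ π '' F.boundary
  have hB : B.Finite := h.finite_criticalOrbits.union (finite_boundary.image π)
  refine ⟨B.ncard, fun n hn hfin => ?_⟩
  let D : Set F.Ω := {x | ∃ i, (x : ℝ) ∈ F.decFix n (F.a i) (F.b i)}
  have hDv : Subtype.val '' D = ⋃ i, F.decFix n (F.a i) (F.b i) := by
    ext s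
    rw [mem_iUnion]
    constructor
    · rintro ⟨x, hx, rfl⟩
      exact hx
    · rintro ⟨i, hi⟩
      exact ⟨⟨s, Icc_subset_Ω i (Ioo_subset_Icc_self hi.1)⟩, ⟨i, hi⟩, rfl⟩
  have hD : D.Finite := Finite.of_finite_image (f := Subtype.val)
    (hDv ▸ finite_iUnion hfin) Subtype.val_injective.injOn
  have hDb : ∀ x ∈ D, x ∉ F.boundary := fun x ⟨i, hi⟩ => notMem_boundary_of_mem_Ioo hi.1
  have hcard : (π '' D).ncard = ∑ i, (F.decFix n (F.a i) (F.b i)).ncard := by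
    rw [InjOn.ncard_image fun x hx y _ hxy => h.eq_of_notMem_boundary (hDb x hx) hxy,
      ← ncard_image_of_injective D Subtype.val_injective, hDv,
      ncard_iUnion_of_finite hfin, finsum_eq_sum_of_fintype]
    intro i j hij
    refine disjoint_left.2 fun s hi hj => hij ?_
    exact eq_of_mem_Icc (Ioo_subset_Icc_self hi.1) (Ioo_subset_Icc_self hj.1)
  have h1 : π '' D ⊆ fixNeg f^[n] := by
    rintro _ ⟨x, ⟨i, hi⟩, rfl⟩
    exact h.mem_fixNeg hi
  have h2 : fixNeg f^[n] ⊆ π '' D ∪ B := by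
    intro g hg
    obtain ⟨x, rfl⟩ := h.surjective g
    by_cases hx : x ∈ F.boundary
    · exact Or.inr (Or.inr ⟨x, hx, rfl⟩)
    · by_cases hxc : π x ∈ h.criticalOrbits
      · exact Or.inr (Or.inl hxc)
      · exact Or.inl ⟨x, h.mem_decFix_of_mem_fixNeg hn hx hxc hg, rfl⟩
  have hfin2 : (π '' D ∪ B).Finite := (hD.image π).union hB
  have l1 := ncard_le_ncard h1 (hfin2.subset h2)
  have l2 := (ncard_le_ncard h2 hfin2).trans (ncard_union_le _ _)
  rw [hcard] at l1 l2
  have l1' : ∑ i, ((F.decFix n (F.a i) (F.b i)).ncard : ℝ) ≤ (fixNeg f^[n]).ncard := by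
    exact_mod_cast l1
  have l2' : ((fixNeg f^[n]).ncard : ℝ)
      ≤ ∑ i, ((F.decFix n (F.a i) (F.b i)).ncard : ℝ) + B.ncard := by
    exact_mod_cast l2
  rw [abs_of_nonneg (by linarith)]
  linarith

/-- The traces that occur in the definition of the three series nearly cancel. -/
theorem exists_bound [T2Space G] : ∃ K : ℝ, ∀ n, n ≠ 0 →
    |2 * ((fixNeg f^[n]).ncard : ℝ)
      + -(LinearMap.trace ℝ _ (homologyMap f 0 ^ n) - LinearMap.trace ℝ _ (homologyMap f 1 ^ n))
      + -pairTrace ((Submodule.topEquiv (R := ℝ) (M := S0 F.Ω)).symm.conj F.epsSharpZero ^ n)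
        (F.epsSharpOne ^ n)| ≤ K := by
  obtain ⟨K₀, hK₀⟩ := h.isParam.exists_bound_trace_zero
  obtain ⟨K₁, hK₁⟩ := h.isParam.exists_bound_trace_one
  obtain ⟨K₂, hK₂⟩ := h.exists_bound_fixNeg
  refine ⟨2 * K₂ + K₀ + K₁ + F.m * (h.criticalOrbits.ncard + 2), fun n hn => ?_⟩
  choose l hl hlq hlw using h.exists_isCircleLift n
  obtain ⟨hfin, htr⟩ := pairTrace_eq_sum hn hl
  rw [htr, ← homologyMap_iterate, ← homologyMap_iterate]
  have b0 := abs_le.1 (hK₀ ⟨f^[n], f.continuous.iterate n⟩)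
  have b1 := abs_le.1 (hK₁ ⟨f^[n], f.continuous.iterate n⟩)
  have b2 := abs_le.1 (hK₂ n hn hfin)
  simp only [hlw] at b1
  -- On each edge the two roundings cost less than `2` in total, and the cut points at most the
  -- number of points on critical orbits.
  have b3 : |∑ i, (l i (F.b i) - l i (F.a i)
      - ((⌊l i (F.b i) - 1⌋ + 1 - ⌈l i (F.a i)⌉ : ℤ)
        + ((F.cutInt n i (l i) (F.a i) (F.b i)).ncard : ℝ)))|
      ≤ F.m * (h.criticalOrbits.ncard + 2) := by
    refine (Finset.abs_sum_le_sum_abs _ _).trans ((Finset.sum_le_card_nsmul _ _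
      ((h.criticalOrbits.ncard : ℝ) + 2) fun i _ => ?_).trans ?_)
    · have c1 : ((F.cutInt n i (l i) (F.a i) (F.b i)).ncard : ℝ) ≤ h.criticalOrbits.ncard := by
        exact_mod_cast h.ncard_cutInt_le hn i (hlq i)
      have c2 : (0 : ℝ) ≤ (F.cutInt n i (l i) (F.a i) (F.b i)).ncard := Nat.cast_nonneg _
      have f1 := Int.floor_le (l i (F.b i) - 1)
      have f2 := Int.lt_floor_add_one (l i (F.b i) - 1)
      have f3 := Int.le_ceil (l i (F.a i))
      have f4 := Int.ceil_lt_add_one (l i (F.a i))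
      push_cast
      rw [abs_le]
      constructor <;> linarith
    · simp [mul_add]
  rw [Finset.sum_sub_distrib] at b3
  have b3 := abs_le.1 b3
  rw [Finset.sum_add_distrib, ← Finset.mul_sum]
  rw [abs_le]
  constructor <;> linarith [b0.1, b0.2, b1.1, b1.2, b2.1, b2.2, b3.1, b3.2]

end IsInducedVia

end Induced

end PMGraph

end

theorem corollaryc3 {G : Type u} [TopologicalSpace G] (hG : PMGraph.IsGraph G)
    (f : C(G, G)) (hf : PMGraph.IsPMG f) (F : PMGraph.PMMap) (hfF : PMGraph.IsInducedBy f F)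
    (z₀ : ℂ) (hz₀ : ‖z₀‖ < 1) (hD : PMGraph.IsZeroOf F.kneadingDet z₀) :
    PMGraph.radius (PMGraph.zetaMT f) ≤ ENNReal.ofReal ‖z₀‖ := by
  have := hG.2.1
  obtain ⟨π, h⟩ := hfF
  obtain ⟨K, hK⟩ := h.exists_bound
  refine PMGraph.radius_le_of_isZeroOf hK ?_ hz₀ hD
  rw [PMGraph.zetaMT, PMGraph.zetaNeg, PMGraph.zetaL, PMGraph.expSeries_inv,
    PMGraph.expSeries_mul]
  exact PMGraph.expSeries_mul _ _
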